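/- Let $N\ge 5$ be an integer and let $\alpha,\beta\in\mathbb R$ satisfy $$\alpha>2-N,\qquad \alpha-2<\beta\le \frac{N}{N-2}\,\alpha .$$ Put $p^*=\frac{2(N+\beta)}{N-4+2\alpha-\beta}$, and let $\mathcal D^{2,2}_{\alpha,\beta}(\mathbb R^N)$ be the completion of $C_0^\infty(\mathbb R^N)$ with respect to the norm $$\|u\|=\Big(\int_{\mathbb R^N}|x|^{-\beta}\,|\mathrm{div}(|x|^\alpha\nabla u)|^2\,dx\Big)^{1/2},$$ realized as a space of (classes of) real functions in $L^{p^*}(\mathbb R^N,|x|^\beta dx)$: $u$ belongs to it if $u$ is the limit in $L^{p^*}(|x|^\beta dx)$ of functions $\varphi_n\in C_0^\infty(\mathbb R^N)$ for which $\mathrm{div}(|x|^\alpha\nabla\varphi_n)$ converges in $L^2(|x|^{-\beta}dx)$, and the limit of the latter is denoted $\mathrm{div}(|x|^\alpha\nabla u)$. Consider the equation $$\mathrm{div}\big(|x|^{\alpha}\nabla(|x|^{-\beta}\mathrm{div}(|x|^\alpha\nabla u))\big)=|x|^\beta|u|^{p^*-2}u\quad\text{in }\mathbb R^N,\qquad u\in\mathcal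 D^{2,2}_{\alpha,\beta}(\mathbb R^N),$$ in the weak sense, that is, $$\int_{\mathbb R^N}|x|^{-\beta}\,\mathrm{div}(|x|^\alpha\nabla u)\,\mathrm{div}(|x|^\alpha\nabla\psi)\,dx=\int_{\mathbb R^N}|x|^\beta|u|^{p^*-2}u\,\psi\,dx\quad\text{for all }\psi\in C_0^\infty(\mathbb R^N).$$ Define $$U(x)=\frac{C_{N,\alpha,\beta}}{(1+|x|^{2+\beta-\alpha})^{\frac{N-4+2\alpha-\beta}{2+\beta-\alpha}}},\qquad C_{N,\alpha,\beta}=\big[(N-4+2\alpha-\beta)(N-2+\alpha)(N+\beta)(N+2-\alpha+2\beta)\big]^{\frac{N-4+2\alpha-\beta}{4(2+\beta-\alpha)}},$$ and $U_\lambda(x)=\lambda^{\frac{N-4+2\alpha-\beta}{2}}U(\lambda x)$ for $\lambda>0$. Then the equation has exactly one nontrivial radial solution up to scaling and change of sign: for every $\lambda>0$ both $U_\lambda$ and $-U_\lambda$ are nontrivial radial solutions, and every nontrivial radial solution equals $U_\lambda$ or $-U_\lambda$ almost everywhere for some $\lambda>0$. -/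

import Mathlib

open MeasureTheory Filter Topology
open scoped ContDiff

noncomputable section

namespace WeightedCKN

/-- The measure `|x|^γ dx` on `ℝ^N`. -/
def powMeasure (N : ℕ) (γ : ℝ) : Measure (EuclideanSpace ℝ (Fin N)) :=
  volume.withDensity fun x => ENNReal.ofReal (‖x‖ ^ γ)

/-- The divergence `∑ i, ∂ᵢ Fᵢ` of a vector field. -/
def divergence {N : ℕ} (F : EuclideanSpace ℝ (Fin N) → EuclideanSpace ℝ (Fin N))
    (x : EuclideanSpace ℝ (Fin N)) : ℝ :=
  ∑ i : Fin N, (fderiv ℝ F x (EuclideanSpace.single i 1)) i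

/-- The operator `φ ↦ div (|x|^α ∇ φ)`, used on smooth functions; for those the field
`|x|^α ∇ φ` is smooth away from the origin, so the values are the classical ones for `x ≠ 0`. -/
def divPowGrad {N : ℕ} (α : ℝ) (φ : EuclideanSpace ℝ (Fin N) → ℝ)
    (x : EuclideanSpace ℝ (Fin N)) : ℝ :=
  divergence (fun y => ‖y‖ ^ α • gradient φ y) x

/-- The class `C_0^∞(ℝ^N)` of smooth functions with compact support (which may contain the
origin). -/
def IsTest {N : ℕ} (φ : EuclideanSpace ℝ (Fin N) → ℝ) : Prop :=
  ContDiff ℝ ∞ φ ∧ HasCompactSupport φ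

/-- The critical exponent `p^*_{α,β} = 2(N+β)/(N-4+2α-β)`. -/
def critExp (N : ℕ) (α β : ℝ) : ℝ :=
  2 * (N + β) / (N - 4 + 2 * α - β)

/-- `InD22 α β u w` says that `u` belongs to the space `𝒟^{2,2}_{α,β}(ℝ^N)` and that
`w = div (|x|^α ∇ u)`.  The space is the completion of `C_0^∞(ℝ^N)` for the norm
`‖φ‖ = (∫ |x|^{-β} |div (|x|^α ∇ φ)|^2 dx)^{1/2}`, realized as a space of functions in
`L^{p^*}(|x|^β dx)`: there are test functions `φ n` that converge to `u` in that Lebesgue space and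
for which `div (|x|^α ∇ (φ n))` converges in `L^2(|x|^{-β} dx)` (equivalently, `φ n` is Cauchy for
the norm); the limit `w` is `div (|x|^α ∇ u)` in the sense of distributions on `ℝ^N ∖ {0}`, so it
is determined by `u` almost everywhere. -/
def InD22 {N : ℕ} (α β : ℝ) (u w : EuclideanSpace ℝ (Fin N) → ℝ) : Prop :=
  MemLp u (ENNReal.ofReal (critExp N α β)) (powMeasure N β) ∧
  MemLp w 2 (powMeasure N (-β)) ∧
  ∃ φ : ℕ → EuclideanSpace ℝ (Fin N) → ℝ,
    (∀ n, IsTest (φ n)) ∧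
    Tendsto (fun n => eLpNorm (fun x => φ n x - u x)
      (ENNReal.ofReal (critExp N α β)) (powMeasure N β)) atTop (𝓝 0) ∧
    Tendsto (fun n => eLpNorm (fun x => divPowGrad α (φ n) x - w x)
      2 (powMeasure N (-β))) atTop (𝓝 0)

/-- `u ∈ 𝒟^{2,2}_{α,β}(ℝ^N)` is a weak solution of
`div (|x|^α ∇ (|x|^{-β} div (|x|^α ∇ u))) = |x|^β |u|^{p^*-2} u` in `ℝ^N`. -/
def IsSolution {N : ℕ} (α β : ℝ) (u : EuclideanSpace ℝ (Fin N) → ℝ) : Prop :=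
  ∃ w : EuclideanSpace ℝ (Fin N) → ℝ, InD22 α β u w ∧
    ∀ ψ : EuclideanSpace ℝ (Fin N) → ℝ, IsTest ψ →
      ∫ x, ‖x‖ ^ (-β) * w x * divPowGrad α ψ x =
        ∫ x, ‖x‖ ^ β * (|u x| ^ (critExp N α β - 2) * u x) * ψ x

/-- `u` is (almost everywhere) a function of `|x|`. -/
def IsRadial {N : ℕ} (u : EuclideanSpace ℝ (Fin N) → ℝ) : Prop :=
  ∃ f : ℝ → ℝ, u =ᵐ[volume] fun x => f ‖x‖

/-- A nontrivial radial solution in `𝒟^{2,2}_{α,β}(ℝ^N)`. -/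
def IsNontrivialRadialSolution {N : ℕ} (α β : ℝ) (u : EuclideanSpace ℝ (Fin N) → ℝ) : Prop :=
  IsSolution α β u ∧ IsRadial u ∧ ¬ u =ᵐ[volume] 0

/-- The constant `C_{N,α,β}`. -/
def bubbleConst (N : ℕ) (α β : ℝ) : ℝ :=
  ((N - 4 + 2 * α - β) * (N - 2 + α) * (N + β) * (N + 2 - α + 2 * β)) ^
    ((N - 4 + 2 * α - β) / (4 * (2 + β - α)))

/-- The profile `U(x) = C_{N,α,β} (1 + |x|^{2+β-α})^{-(N-4+2α-β)/(2+β-α)}`. -/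
def bubble {N : ℕ} (α β : ℝ) (x : EuclideanSpace ℝ (Fin N)) : ℝ :=
  bubbleConst N α β /
    (1 + ‖x‖ ^ (2 + β - α)) ^ ((N - 4 + 2 * α - β) / (2 + β - α))

/-- The rescaled profile `U_l(x) = l^{(N-4+2α-β)/2} U(l x)`. -/
def bubbleScaled {N : ℕ} (α β l : ℝ) (x : EuclideanSpace ℝ (Fin N)) : ℝ :=
  l ^ ((N - 4 + 2 * α - β) / 2) * bubble α β (l • x)

end WeightedCKN

end

/-!
For a radial function `u = v(|x|)` the equation is an ordinary differential equation. Put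
`k = (N - 4 + 2 α - β) / 2` and `t = 2 + β - α`; both are positive under the hypotheses, and with
`L v = r ^ (-(2 k + 2 t - 1)) * (r ^ (2 k + t + 1) * v')'` one has `div (|x|^α ∇ u) = |x|^β L v`,
the critical exponent is `2 + 2 t / k`, and the equation becomes `L (L v) = |v| ^ (2 t / k) v`.
It is written as a first order system (`RadialSystem`) for `v`, `W = L v` and their fluxes `P`, `Q`.

*The bubbles are solutions.* On powers of `1 + c r ^ t` the operator `L` acts explicitly, and
`L (L v) = |v| ^ (2 t / k) v` holds for `v = A (1 + c r ^ t) ^ (-2 k / t)` when `A` and `c` are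
related as in `isSolution_one_add_mul_rpow`. To see that this classical solution is a weak one in
the right space, `v` and `-L v`, both of which decrease to zero at infinity, are approximated by
radial test functions with cut-off derivatives (`DecreasingProfile.exists_approx`). These converge
under domination, which gives the membership in the space and, by the symmetry of
`div (|x|^α ∇ ·)` on test functions, the weak equation (`isSolution_of_profiles`).

*Radial solutions are bubbles.* The weak formulation, tested with radial functions that are constant
near the origin, shows that a radial weak solution has a profile solving the radial system, with
`P` and `Q` the integrals over balls of `w = div (|x|^α ∇ u)` and of the nonlinearity
(`exists_radialSystem`). As `w` is square integrable, `P` is of lower order than `r ^ (k + t)`; this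
excludes the critical singularity `r ^ (-k)`, and a smallness iteration then shows that `v` and `W`
have limits at the origin (`RadialSystem.exists_tendsto`). The system is cooperative, so solutions
are ordered by their initial values (`RadialSystem.le_of_le`). If two of them have the same value
`v 0` but different values `W 0`, their difference grows at least like `r ^ t`, and they cannot both
be in the critical Lebesgue space (`RadialSystem.initial_le`). Hence a radial solution is determined
by `v 0` (`RadialSystem.eq_of_initial_eq`). The value `0` belongs to the zero solution, and the
bubbles and their negatives realize all other values.
-/

namespace WeightedCKN

open Set

/-! ### Comparison of functions through their derivatives -/

theorem le_of_hasDerivAt_le {F G F' G' : ℝ → ℝ} {R c d : ℝ}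
    (hF : ∀ r ∈ Ioc 0 R, HasDerivAt F (F' r) r) (hG : ∀ r ∈ Ioc 0 R, HasDerivAt G (G' r) r)
    (hle : ∀ r ∈ Ioc 0 R, F' r ≤ G' r) (hFc : Tendsto F (𝓝[>] 0) (𝓝 c))
    (hGd : Tendsto G (𝓝[>] 0) (𝓝 d)) (hcd : c ≤ d) : ∀ r ∈ Ioc 0 R, F r ≤ G r := by
  intro r hr
  have hd : ∀ s ∈ Ioc 0 R, HasDerivAt (fun s => F s - G s) (F' s - G' s) s :=
    fun s hs => (hF s hs).sub (hG s hs)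
  have hanti : AntitoneOn (fun s => F s - G s) (Ioc 0 R) := by
    refine antitoneOn_of_deriv_nonpos (convex_Ioc 0 R)
      (fun s hs => (hd s hs).continuousAt.continuousWithinAt)
      (fun s hs => (hd s (interior_subset hs)).differentiableAt.differentiableWithinAt) ?_
    intro s hs
    rw [(hd s (interior_subset hs)).deriv]
    linarith [hle s (interior_subset hs)]
  have hlim : F r - G r ≤ c - d := by
    refine ge_of_tendsto (hFc.sub hGd) ?_
    filter_upwards [Ioo_mem_nhdsGT hr.1] with s hs
    exact hanti ⟨hs.1, hs.2.le.trans hr.2⟩ hr hs.2.le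
  linarith

theorem abs_le_of_abs_hasDerivAt_le {F G F' G' : ℝ → ℝ} {R : ℝ}
    (hF : ∀ r ∈ Ioc 0 R, HasDerivAt F (F' r) r) (hG : ∀ r ∈ Ioc 0 R, HasDerivAt G (G' r) r)
    (hle : ∀ r ∈ Ioc 0 R, |F' r| ≤ G' r) (hF0 : Tendsto F (𝓝[>] 0) (𝓝 0))
    (hG0 : Tendsto G (𝓝[>] 0) (𝓝 0)) : ∀ r ∈ Ioc 0 R, |F r| ≤ G r := by
  intro r hr
  refine abs_le'.2 ⟨?_, ?_⟩
  · exact le_of_hasDerivAt_le hF hG (fun s hs => (le_abs_self _).trans (hle s hs)) hF0 hG0 le_rfl r hr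
  · refine le_of_hasDerivAt_le (F := fun s => -F s) (fun s hs => (hF s hs).neg) hG
      (fun s hs => (neg_le_abs _).trans (hle s hs)) hF0.neg hG0 (by simp) r hr

/-- The comparison integrated from the endpoint `R`, for functions that may blow up at `0`. -/
theorem abs_le_add_of_abs_hasDerivAt_le {F G F' G' : ℝ → ℝ} {R : ℝ}
    (hF : ∀ r ∈ Ioc 0 R, HasDerivAt F (F' r) r) (hG : ∀ r ∈ Ioc 0 R, HasDerivAt G (G' r) r)
    (hle : ∀ r ∈ Ioc 0 R, |F' r| ≤ -G' r) (hGR : 0 ≤ G R) :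
    ∀ r ∈ Ioc 0 R, |F r| ≤ |F R| + G r := by
  intro r hr
  have key : ∀ F F' : ℝ → ℝ, (∀ r ∈ Ioc 0 R, HasDerivAt F (F' r) r) →
      (∀ r ∈ Ioc 0 R, |F' r| ≤ -G' r) → F r ≤ F R + G r := by
    intro F F' hF hle
    have hd : ∀ s ∈ Ioc 0 R, HasDerivAt (fun s => F s - G s) (F' s - G' s) s :=
      fun s hs => (hF s hs).sub (hG s hs)
    have hmono : MonotoneOn (fun s => F s - G s) (Ioc 0 R) := by
      refine monotoneOn_of_deriv_nonneg (convex_Ioc 0 R)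
        (fun s hs => (hd s hs).continuousAt.continuousWithinAt)
        (fun s hs => (hd s (interior_subset hs)).differentiableAt.differentiableWithinAt) ?_
      intro s hs
      rw [(hd s (interior_subset hs)).deriv]
      linarith [hle s (interior_subset hs), neg_le_abs (F' s)]
    have := hmono hr ⟨hr.1.trans_le hr.2, le_rfl⟩ hr.2
    simp only at this
    linarith
  refine abs_le'.2 ⟨?_, ?_⟩
  · linarith [key F F' hF hle, le_abs_self (F R)]
  · have := key (fun s => -F s) (fun s => -F' s) (fun s hs => (hF s hs).neg)
      (by simpa using hle)
    linarith [neg_le_abs (F R)]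

theorem tendsto_mul_rpow_nhdsGT_zero {σ : ℝ} (hσ : 0 < σ) (C : ℝ) :
    Tendsto (fun s : ℝ => C * s ^ σ) (𝓝[>] 0) (𝓝 0) := by
  have := ((Real.continuousAt_rpow_const 0 σ (Or.inr hσ.le)).tendsto.const_mul C).mono_left
    (nhdsWithin_le_nhds (s := Ioi 0))
  simpa [Real.zero_rpow hσ.ne'] using this

theorem hasDerivAt_div_mul_rpow {r σ : ℝ} (hr : 0 < r) (hσ : σ ≠ 0) (C : ℝ) :
    HasDerivAt (fun r : ℝ => C / σ * r ^ σ) (C * r ^ (σ - 1)) r := by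
  refine ((Real.hasDerivAt_rpow_const (p := σ) (Or.inl hr.ne')).const_mul (C / σ)).congr_deriv ?_
  rw [← mul_assoc, div_mul_cancel₀ _ hσ]

/-- A derivative bounded by the integrable power `r ^ (σ - 1)` gives a limit at `0`. -/
theorem exists_tendsto_of_abs_deriv_le {F F' : ℝ → ℝ} {R C σ : ℝ} (hR : 0 < R) (hσ : 0 < σ)
    (hF : ∀ r ∈ Ioc 0 R, HasDerivAt F (F' r) r)
    (hle : ∀ r ∈ Ioc 0 R, |F' r| ≤ C * r ^ (σ - 1)) : ∃ A, Tendsto F (𝓝[>] 0) (𝓝 A) := by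
  have hpow : ∀ r ∈ Ioc 0 R, HasDerivAt (fun r : ℝ => C / σ * r ^ σ) (C * r ^ (σ - 1)) r :=
    fun r hr => hasDerivAt_div_mul_rpow hr.1 hσ.ne' C
  have hC : ∀ r ∈ Ioc 0 R, 0 ≤ C * r ^ (σ - 1) := fun r hr => (abs_nonneg _).trans (hle r hr)
  have hd : ∀ s ∈ Ioc 0 R,
      HasDerivAt (fun s => F s + C / σ * s ^ σ) (F' s + C * s ^ (σ - 1)) s :=
    fun s hs => (hF s hs).add (hpow s hs)
  have hmono : MonotoneOn (fun s => F s + C / σ * s ^ σ) (Ioc 0 R) := by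
    refine monotoneOn_of_deriv_nonneg (convex_Ioc 0 R)
      (fun s hs => (hd s hs).continuousAt.continuousWithinAt)
      (fun s hs => (hd s (interior_subset hs)).differentiableAt.differentiableWithinAt) ?_
    intro s hs
    rw [(hd s (interior_subset hs)).deriv]
    linarith [hle s (interior_subset hs), neg_le_abs (F' s)]
  have hd' : ∀ s ∈ Ioc 0 R,
      HasDerivAt (fun s => F s - C / σ * s ^ σ) (F' s - C * s ^ (σ - 1)) s :=
    fun s hs => (hF s hs).sub (hpow s hs)
  have hanti : AntitoneOn (fun s => F s - C / σ * s ^ σ) (Ioc 0 R) := by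
    refine antitoneOn_of_deriv_nonpos (convex_Ioc 0 R)
      (fun s hs => (hd' s hs).continuousAt.continuousWithinAt)
      (fun s hs => (hd' s (interior_subset hs)).differentiableAt.differentiableWithinAt) ?_
    intro s hs
    rw [(hd' s (interior_subset hs)).deriv]
    linarith [hle s (interior_subset hs), le_abs_self (F' s)]
  have hCnn : 0 ≤ C := by
    have := hC R ⟨hR, le_rfl⟩
    exact nonneg_of_mul_nonneg_left this (Real.rpow_pos_of_pos hR _)
  have hbdd : BddBelow ((fun s => F s + C / σ * s ^ σ) '' Ioo 0 R) := by
    refine ⟨F R - C / σ * R ^ σ, ?_⟩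
    rintro _ ⟨s, hs, rfl⟩
    have h1 := hanti ⟨hs.1, hs.2.le⟩ ⟨hR, le_rfl⟩ hs.2.le
    have h2 : 0 ≤ C / σ * s ^ σ := mul_nonneg (div_nonneg hCnn hσ.le) (Real.rpow_nonneg hs.1.le _)
    simp only at h1 ⊢
    linarith
  have hlim := (hmono.mono Ioo_subset_Ioc_self).tendsto_nhdsWithin_Ioo_right
    (nonempty_Ioo.2 hR) hbdd
  refine ⟨_, (hlim.sub (tendsto_mul_rpow_nhdsGT_zero hσ (C / σ))).congr fun s => ?_⟩
  simp

/-! ### The odd power nonlinearity -/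

theorem hasDerivAt_abs_rpow_mul_self {q : ℝ} (hq : 0 < q) (x : ℝ) :
    HasDerivAt (fun x : ℝ => |x| ^ q * x) ((q + 1) * |x| ^ q) x := by
  rcases lt_trichotomy x 0 with hx | rfl | hx
  · have h := ((hasDerivAt_neg x).rpow_const (p := q + 1) (Or.inl (by linarith))).neg
    have h2 : (fun x : ℝ => |x| ^ q * x) =ᶠ[𝓝 x] fun y => -(-y) ^ (q + 1) := by
      filter_upwards [Iio_mem_nhds hx] with y hy
      rw [abs_of_neg hy, Real.rpow_add_one (by simpa using hy.ne)]
      ring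
    refine (h.congr_of_eventuallyEq h2).congr_deriv ?_
    rw [abs_of_neg hx, add_sub_cancel_right]; ring
  · rw [hasDerivAt_iff_tendsto_slope]
    have h0 : Tendsto (fun y : ℝ => |y| ^ q) (𝓝[≠] 0) (𝓝 0) := by
      have : Continuous fun y : ℝ => |y| ^ q := continuous_abs.rpow_const fun _ => Or.inr hq.le
      have := this.tendsto 0
      rw [abs_zero, Real.zero_rpow hq.ne'] at this
      exact this.mono_left nhdsWithin_le_nhds
    rw [abs_zero, Real.zero_rpow hq.ne', mul_zero]
    refine h0.congr' ?_
    filter_upwards [self_mem_nhdsWithin] with y hy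
    have : y ≠ 0 := hy
    simp [slope_def_field, this]
  · have h := ((hasDerivAt_id x).rpow_const (p := q + 1) (Or.inl hx.ne'))
    have h2 : (fun x : ℝ => |x| ^ q * x) =ᶠ[𝓝 x] fun y => y ^ (q + 1) := by
      filter_upwards [Ioi_mem_nhds hx] with y hy
      rw [abs_of_pos hy, Real.rpow_add_one (ne_of_gt hy)]
    refine (h.congr_of_eventuallyEq h2).congr_deriv ?_
    rw [abs_of_pos hx]; simp

theorem monotone_abs_rpow_mul_self {q : ℝ} (hq : 0 < q) : Monotone fun x : ℝ => |x| ^ q * x := by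
  refine monotone_of_deriv_nonneg (fun x => (hasDerivAt_abs_rpow_mul_self hq x).differentiableAt) ?_
  intro x
  rw [(hasDerivAt_abs_rpow_mul_self hq x).deriv]
  positivity

theorem abs_rpow_mul_self_sub_le {q S x y : ℝ} (hq : 0 < q) (hx : |x| ≤ S) (hy : |y| ≤ S)
    (hyx : y ≤ x) : |x| ^ q * x - |y| ^ q * y ≤ (q + 1) * S ^ q * (x - y) := by
  refine (convex_Icc (-S) S).image_sub_le_mul_sub_of_deriv_le
    (f := fun x : ℝ => |x| ^ q * x) ?_ ?_ ?_ y (abs_le.1 hy) x (abs_le.1 hx) hyx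
  · exact fun z _ => (hasDerivAt_abs_rpow_mul_self hq z).continuousAt.continuousWithinAt
  · exact fun z _ => (hasDerivAt_abs_rpow_mul_self hq z).differentiableAt.differentiableWithinAt
  · intro z hz
    rw [(hasDerivAt_abs_rpow_mul_self hq z).deriv]
    have : |z| ≤ S := abs_le.2 (mem_Icc.1 (interior_subset hz))
    gcongr

/-! ### The radial system -/

/-- The fourth order radial equation as a first order system on `(0, ∞)`: in terms of
`L v = r ^ (-(2 k + 2 t - 1)) * (r ^ (2 k + t + 1) * v')'` it says `L u = W` and
`L W = |u| ^ (2 t / k) * u`, the fluxes `P = r ^ (2 k + t + 1) * u'` and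
`Q = r ^ (2 k + t + 1) * W'` vanishing at the origin. -/
structure RadialSystem (k t : ℝ) (u W P Q : ℝ → ℝ) : Prop where
  deriv_u : ∀ r, 0 < r → HasDerivAt u (r ^ (-(2 * k + t + 1)) * P r) r
  deriv_P : ∀ r, 0 < r → HasDerivAt P (r ^ (2 * k + 2 * t - 1) * W r) r
  deriv_W : ∀ r, 0 < r → HasDerivAt W (r ^ (-(2 * k + t + 1)) * Q r) r
  deriv_Q : ∀ r, 0 < r →
    HasDerivAt Q (r ^ (2 * k + 2 * t - 1) * (|u r| ^ (2 * t / k) * u r)) r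
  tendsto_P : Tendsto P (𝓝[>] 0) (𝓝 0)
  tendsto_Q : Tendsto Q (𝓝[>] 0) (𝓝 0)

/-- One application of the inverse of `L` gains a factor `1 / l` in the weighted supremum norm with
weight `exp (l * r ^ t)`. -/
theorem le_mul_exp_of_flux {k t l M R A : ℝ} (hk : 0 < k) (ht : 0 < t) (hl : 0 < l) (hM : 0 ≤ M)
    {F G H : ℝ → ℝ} (hF : ∀ r, 0 < r → HasDerivAt F (r ^ (-(2 * k + t + 1)) * G r) r)
    (hG : ∀ r, 0 < r → HasDerivAt G (r ^ (2 * k + 2 * t - 1) * H r) r)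
    (hG0 : Tendsto G (𝓝[>] 0) (𝓝 0)) (hF0 : Tendsto F (𝓝[>] 0) (𝓝 A)) (hA : A ≤ 0)
    (hH : ∀ r ∈ Ioc 0 R, H r ≤ M * Real.exp (l * r ^ t)) :
    ∀ r ∈ Ioc 0 R, F r ≤ M / ((2 * k + 2 * t) * (l * t)) * Real.exp (l * r ^ t) := by
  have hexp : ∀ r, 0 < r → HasDerivAt (fun r : ℝ => Real.exp (l * r ^ t))
      (Real.exp (l * r ^ t) * (l * (t * r ^ (t - 1)))) r := fun r hr =>
    (((Real.hasDerivAt_rpow_const (p := t) (Or.inl hr.ne')).const_mul l).exp)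
  have hexp0 : Tendsto (fun r : ℝ => Real.exp (l * r ^ t)) (𝓝[>] 0) (𝓝 1) := by
    have := (Real.continuous_exp.tendsto 0).comp (tendsto_mul_rpow_nhdsGT_zero ht l)
    simpa [Function.comp_def] using this
  have hkt : 0 < 2 * k + 2 * t := by linarith
  have h1 : ∀ r ∈ Ioc 0 R,
      G r ≤ M / (2 * k + 2 * t) * r ^ (2 * k + 2 * t) * Real.exp (l * r ^ t) := by
    refine le_of_hasDerivAt_le (fun r hr => hG r hr.1)
      (fun r hr => (hasDerivAt_div_mul_rpow hr.1 hkt.ne' M).mul (hexp r hr.1)) ?_ hG0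
      ((tendsto_mul_rpow_nhdsGT_zero hkt _).mul hexp0) (by simp)
    intro r hr
    have hr0 := hr.1
    have : 0 ≤ M / (2 * k + 2 * t) * r ^ (2 * k + 2 * t) *
        (Real.exp (l * r ^ t) * (l * (t * r ^ (t - 1)))) := by positivity
    have h2 : r ^ (2 * k + 2 * t - 1) * H r
        ≤ r ^ (2 * k + 2 * t - 1) * (M * Real.exp (l * r ^ t)) := by
      gcongr
      exact hH r hr
    linarith
  refine le_of_hasDerivAt_le (fun r hr => hF r hr.1)
      (fun r hr => (hexp r hr.1).const_mul _) ?_ hF0 (hexp0.const_mul _)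
      (hA.trans (by positivity))
  intro r hr
  have hr0 := hr.1
  calc r ^ (-(2 * k + t + 1)) * G r
      ≤ r ^ (-(2 * k + t + 1)) *
        (M / (2 * k + 2 * t) * r ^ (2 * k + 2 * t) * Real.exp (l * r ^ t)) := by
        gcongr
        exact h1 r hr
    _ = M / (2 * k + 2 * t) * Real.exp (l * r ^ t) *
        (r ^ (-(2 * k + t + 1)) * r ^ (2 * k + 2 * t)) := by ring
    _ = M / (2 * k + 2 * t) * Real.exp (l * r ^ t) * r ^ (t - 1) := by
        rw [← Real.rpow_add hr0]; ring_nf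
    _ = _ := by field_simp

theorem exists_bound_Ioc {u : ℝ → ℝ} {A R : ℝ} (hu : ∀ r, 0 < r → ContinuousAt u r)
    (hA : Tendsto u (𝓝[>] 0) (𝓝 A)) : ∃ S, 0 ≤ S ∧ ∀ r ∈ Ioc 0 R, |u r| ≤ S := by
  have hev : ∀ᶠ r in 𝓝[>] (0 : ℝ), |u r| < |A| + 1 :=
    hA.abs.eventually_lt_const (by linarith)
  obtain ⟨d, hd, hd'⟩ := mem_nhdsGT_iff_exists_Ioo_subset.1 hev
  have hd0 : (0 : ℝ) < d := hd
  obtain ⟨S, hS⟩ := (isCompact_Icc (a := d) (b := R)).exists_bound_of_continuousOn (f := u)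
    (fun r hr => (hu r (hd0.trans_le hr.1)).continuousWithinAt)
  refine ⟨max (|A| + 1) S, by positivity, fun r hr => ?_⟩
  rcases lt_or_ge r d with h | h
  · exact (le_of_lt (hd' ⟨hr.1, h⟩)).trans (le_max_left _ _)
  · exact (hS r ⟨h, hr.2⟩).trans (le_max_right _ _)

/-- The radial system is cooperative: the initial values order the solutions. The positive part of
`u₁ - u₂` is dominated by a Volterra operator applied to itself, and in the weighted norms of
`le_mul_exp_of_flux` that operator is a contraction. -/
theorem RadialSystem.le_of_le {k t : ℝ} (hk : 0 < k) (ht : 0 < t)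
    {u₁ W₁ P₁ Q₁ u₂ W₂ P₂ Q₂ : ℝ → ℝ} {A₁ A₂ B₁ B₂ : ℝ}
    (h₁ : RadialSystem k t u₁ W₁ P₁ Q₁) (h₂ : RadialSystem k t u₂ W₂ P₂ Q₂)
    (hA₁ : Tendsto u₁ (𝓝[>] 0) (𝓝 A₁)) (hA₂ : Tendsto u₂ (𝓝[>] 0) (𝓝 A₂))
    (hB₁ : Tendsto W₁ (𝓝[>] 0) (𝓝 B₁)) (hB₂ : Tendsto W₂ (𝓝[>] 0) (𝓝 B₂))
    (hA : A₁ ≤ A₂) (hB : B₁ ≤ B₂) : ∀ r, 0 < r → u₁ r ≤ u₂ r := by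
  intro R hR
  have hq : 0 < 2 * t / k := by positivity
  set q := 2 * t / k with hqdef
  obtain ⟨S₁, hS₁0, hS₁⟩ := exists_bound_Ioc (R := R)
    (fun r hr => (h₁.deriv_u r hr).continuousAt) hA₁
  obtain ⟨S₂, hS₂0, hS₂⟩ := exists_bound_Ioc (R := R)
    (fun r hr => (h₂.deriv_u r hr).continuousAt) hA₂
  set S := max S₁ S₂ with hS
  have hS0 : 0 ≤ S := hS₁0.trans (le_max_left _ _)
  set K := (q + 1) * S ^ q with hK
  have hK0 : 0 ≤ K := by positivity
  -- The rate `l` makes the two-fold inverse a contraction with constant `1 / 2`.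
  obtain ⟨l, hl, hlK⟩ : ∃ l : ℝ, 0 < l ∧
      K / ((2 * k + 2 * t) * (l * t)) / ((2 * k + 2 * t) * (l * t)) ≤ 1 / 2 := by
    set c := (2 * k + 2 * t) * t with hc
    have hc0 : 0 < c := by positivity
    refine ⟨(2 * K + 1) / c, by positivity, ?_⟩
    have : (2 * k + 2 * t) * ((2 * K + 1) / c * t) = 2 * K + 1 := by
      rw [hc]; field_simp
    rw [this, div_div, div_le_iff₀ (by positivity)]
    nlinarith
  have hstep : ∀ M : ℝ, 0 ≤ M →
      (∀ r ∈ Ioc 0 R, u₁ r - u₂ r ≤ M * Real.exp (l * r ^ t)) →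
      ∀ r ∈ Ioc 0 R, u₁ r - u₂ r ≤ M / 2 * Real.exp (l * r ^ t) := by
    intro M hM hu r hr
    have hf : ∀ r ∈ Ioc 0 R, |u₁ r| ^ q * u₁ r - |u₂ r| ^ q * u₂ r
        ≤ K * M * Real.exp (l * r ^ t) := by
      intro r hr
      rcases le_total (u₁ r) (u₂ r) with h | h
      · have := monotone_abs_rpow_mul_self hq h
        simp only at this
        have h0 : 0 ≤ K * M * Real.exp (l * r ^ t) := by positivity
        linarith
      · refine (abs_rpow_mul_self_sub_le hq ((hS₁ r hr).trans (le_max_left _ _))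
          ((hS₂ r hr).trans (le_max_right _ _)) h).trans ?_
        rw [mul_assoc K]
        exact mul_le_mul_of_nonneg_left (hu r hr) hK0
    have hW := le_mul_exp_of_flux hk ht hl (by positivity : 0 ≤ K * M)
      (F := fun r => W₁ r - W₂ r) (G := fun r => Q₁ r - Q₂ r)
      (fun r hr => ((h₁.deriv_W r hr).sub (h₂.deriv_W r hr)).congr_deriv (mul_sub _ _ _).symm)
      (fun r hr => ((h₁.deriv_Q r hr).sub (h₂.deriv_Q r hr)).congr_deriv (mul_sub _ _ _).symm)
      (by simpa using h₁.tendsto_Q.sub h₂.tendsto_Q) (hB₁.sub hB₂) (by linarith) hf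
    have hu' := le_mul_exp_of_flux hk ht hl (by positivity)
      (F := fun r => u₁ r - u₂ r) (G := fun r => P₁ r - P₂ r)
      (fun r hr => ((h₁.deriv_u r hr).sub (h₂.deriv_u r hr)).congr_deriv (mul_sub _ _ _).symm)
      (fun r hr => ((h₁.deriv_P r hr).sub (h₂.deriv_P r hr)).congr_deriv (mul_sub _ _ _).symm)
      (by simpa using h₁.tendsto_P.sub h₂.tendsto_P) (hA₁.sub hA₂) (by linarith) hW
    refine (hu' r hr).trans (mul_le_mul_of_nonneg_right ?_ (Real.exp_pos _).le)
    calc K * M / ((2 * k + 2 * t) * (l * t)) / ((2 * k + 2 * t) * (l * t))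
        = M * (K / ((2 * k + 2 * t) * (l * t)) / ((2 * k + 2 * t) * (l * t))) := by ring
      _ ≤ M * (1 / 2) := by gcongr
      _ = M / 2 := by ring
  have hiter : ∀ n : ℕ, ∀ r ∈ Ioc 0 R,
      u₁ r - u₂ r ≤ 2 * S / 2 ^ n * Real.exp (l * r ^ t) := by
    intro n
    induction n with
    | zero =>
      intro r hr
      have h1 := (le_abs_self _).trans ((hS₁ r hr).trans (le_max_left _ S₂))
      have h2 := (neg_le_abs _).trans ((hS₂ r hr).trans (le_max_right S₁ _))
      have h3 : 1 ≤ Real.exp (l * r ^ t) :=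
        Real.one_le_exp (mul_nonneg hl.le (Real.rpow_nonneg hr.1.le _))
      simp only [pow_zero, div_one]
      nlinarith
    | succ n ih =>
      intro r hr
      have := hstep _ (by positivity) ih r hr
      rwa [div_div, ← pow_succ] at this
  have hlim : Tendsto (fun n : ℕ => 2 * S / 2 ^ n * Real.exp (l * R ^ t)) atTop (𝓝 0) := by
    have := (tendsto_pow_atTop_nhds_zero_of_lt_one (r := (1 / 2 : ℝ)) (by norm_num)
      (by norm_num)).const_mul (2 * S) |>.mul_const (Real.exp (l * R ^ t))
    simpa [div_eq_mul_inv] using this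
  have := ge_of_tendsto' hlim fun n => hiter n R ⟨hR, le_rfl⟩
  linarith

/-! ### Regularity of the radial system at the origin -/

/-- Two integrations of the radial operator map the weight `r ^ (-j)` to `r ^ (t - j)`, with a
constant controlled by `1 / c`. As `t < j`, the second integration starts at `R`. -/
theorem abs_le_of_flux {k t R D X Y j j' c : ℝ} (hk : 0 < k) (ht : 0 < t) (hD : 0 ≤ D)
    (hX : 0 ≤ X) (hY : 0 ≤ Y) (hj : t < j) (hj2 : j < 2 * k + 2 * t)
    (hj' : t < j') (hj2' : j' < 2 * k + 2 * t) (hc : 0 < c)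
    (hcj : c ≤ (2 * k + 2 * t - j) * (j - t)) (hcj' : c ≤ (2 * k + 2 * t - j') * (j' - t))
    {F G H : ℝ → ℝ} (hF : ∀ r, 0 < r → HasDerivAt F (r ^ (-(2 * k + t + 1)) * G r) r)
    (hG : ∀ r, 0 < r → HasDerivAt G (r ^ (2 * k + 2 * t - 1) * H r) r)
    (hG0 : Tendsto G (𝓝[>] 0) (𝓝 0))
    (hH : ∀ r ∈ Ioc 0 R, |H r| ≤ D + X * r ^ (-j) + Y * r ^ (-j')) :
    ∀ r ∈ Ioc 0 R, |F r| ≤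
      |F R| + D * R ^ t / ((2 * k + 2 * t) * t) + X / c * r ^ (t - j) + Y / c * r ^ (t - j') := by
  have hkt : 0 < 2 * k + 2 * t := by linarith
  have e1 : 0 < 2 * k + 2 * t - j := by linarith
  have e2 : 0 < 2 * k + 2 * t - j' := by linarith
  have hG1 : ∀ r ∈ Ioc 0 R, |G r| ≤ D / (2 * k + 2 * t) * r ^ (2 * k + 2 * t)
      + X / (2 * k + 2 * t - j) * r ^ (2 * k + 2 * t - j)
      + Y / (2 * k + 2 * t - j') * r ^ (2 * k + 2 * t - j') := by
    refine abs_le_of_abs_hasDerivAt_le (fun r hr => hG r hr.1)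
      (fun r hr => ((hasDerivAt_div_mul_rpow hr.1 hkt.ne' D).add
        (hasDerivAt_div_mul_rpow hr.1 e1.ne' X)).add
        (hasDerivAt_div_mul_rpow hr.1 e2.ne' Y)) ?_ hG0 ?_
    · intro r hr
      have hr0 := hr.1
      rw [abs_mul, abs_of_pos (Real.rpow_pos_of_pos hr0 _)]
      calc r ^ (2 * k + 2 * t - 1) * |H r|
          ≤ r ^ (2 * k + 2 * t - 1) * (D + X * r ^ (-j) + Y * r ^ (-j')) := by
            gcongr; exact hH r hr
        _ = _ := by
            rw [show 2 * k + 2 * t - j - 1 = (2 * k + 2 * t - 1) + -j by ring,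
              show 2 * k + 2 * t - j' - 1 = (2 * k + 2 * t - 1) + -j' by ring,
              Real.rpow_add hr0, Real.rpow_add hr0]
            ring
    · simpa using ((tendsto_mul_rpow_nhdsGT_zero hkt _).add
        (tendsto_mul_rpow_nhdsGT_zero e1 _)).add (tendsto_mul_rpow_nhdsGT_zero e2 _)
  intro r hr
  have hR : 0 < R := hr.1.trans_le hr.2
  have hmain := abs_le_add_of_abs_hasDerivAt_le (F := F) (R := R)
      (G := fun r => D / (2 * k + 2 * t) / t * R ^ t + -(D / (2 * k + 2 * t)) / t * r ^ t
        + -(X / (2 * k + 2 * t - j)) / (t - j) * r ^ (t - j)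
        + -(Y / (2 * k + 2 * t - j')) / (t - j') * r ^ (t - j')) (fun r hr => hF r hr.1)
      (fun r hr => (((hasDerivAt_div_mul_rpow hr.1 ht.ne' _).const_add _).add
        (hasDerivAt_div_mul_rpow hr.1 (by linarith) _)).add
        (hasDerivAt_div_mul_rpow hr.1 (by linarith) _)) ?_ ?_ r hr
  · refine hmain.trans ?_
    have hr0 := hr.1
    have i1 : -(X / (2 * k + 2 * t - j)) / (t - j) ≤ X / c := by
      rw [← neg_sub j t, neg_div_neg_eq, div_div]
      gcongr
    have i2 : -(Y / (2 * k + 2 * t - j')) / (t - j') ≤ Y / c := by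
      rw [← neg_sub j' t, neg_div_neg_eq, div_div]
      gcongr
    have i3 : D / (2 * k + 2 * t) / t * R ^ t = D * R ^ t / ((2 * k + 2 * t) * t) := by
      field_simp
    have i4 : -(D / (2 * k + 2 * t)) / t * r ^ t ≤ 0 := by
      rw [neg_div, neg_mul, neg_nonpos]; positivity
    have i5 := mul_le_mul_of_nonneg_right i1 (Real.rpow_pos_of_pos hr0 (t - j)).le
    have i6 := mul_le_mul_of_nonneg_right i2 (Real.rpow_pos_of_pos hr0 (t - j')).le
    linarith
  · intro r hr
    have hr0 := hr.1
    rw [abs_mul, abs_of_pos (Real.rpow_pos_of_pos hr0 _)]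
    calc r ^ (-(2 * k + t + 1)) * |G r|
        ≤ r ^ (-(2 * k + t + 1)) * (D / (2 * k + 2 * t) * r ^ (2 * k + 2 * t)
          + X / (2 * k + 2 * t - j) * r ^ (2 * k + 2 * t - j)
          + Y / (2 * k + 2 * t - j') * r ^ (2 * k + 2 * t - j')) := by
          gcongr; exact hG1 r hr
      _ = _ := by
          rw [show t - 1 = -(2 * k + t + 1) + (2 * k + 2 * t) by ring,
            show t - j - 1 = -(2 * k + t + 1) + (2 * k + 2 * t - j) by ring,
            show t - j' - 1 = -(2 * k + t + 1) + (2 * k + 2 * t - j') by ring,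
            Real.rpow_add hr0 _ (2 * k + 2 * t), Real.rpow_add hr0 _ (2 * k + 2 * t - j),
            Real.rpow_add hr0 _ (2 * k + 2 * t - j')]
          ring
  · have i1 : 0 ≤ -(X / (2 * k + 2 * t - j)) / (t - j) := by
      rw [← neg_sub j t, neg_div_neg_eq]
      exact div_nonneg (div_nonneg hX e1.le) (by linarith)
    have i2 : 0 ≤ -(Y / (2 * k + 2 * t - j')) / (t - j') := by
      rw [← neg_sub j' t, neg_div_neg_eq]
      exact div_nonneg (div_nonneg hY e2.le) (by linarith)
    have i5 := mul_nonneg i1 (Real.rpow_pos_of_pos hR (t - j)).le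
    have i6 := mul_nonneg i2 (Real.rpow_pos_of_pos hR (t - j')).le
    have i7 : -(D / (2 * k + 2 * t)) / t * R ^ t = - (D / (2 * k + 2 * t) / t * R ^ t) := by ring
    simp only [i7]
    linarith

/-- If `H` is at most of order `r ^ (-j)` with `j < t`, two integrations leave `F` with an
integrable derivative at the origin. -/
theorem exists_tendsto_of_flux {k t R C j : ℝ} (hk : 0 < k) (ht : 0 < t) (hR : 0 < R)
    (hjt : j < t) {F G H : ℝ → ℝ}
    (hF : ∀ r, 0 < r → HasDerivAt F (r ^ (-(2 * k + t + 1)) * G r) r)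
    (hG : ∀ r, 0 < r → HasDerivAt G (r ^ (2 * k + 2 * t - 1) * H r) r)
    (hG0 : Tendsto G (𝓝[>] 0) (𝓝 0)) (hH : ∀ r ∈ Ioc 0 R, |H r| ≤ C * r ^ (-j)) :
    ∃ A, Tendsto F (𝓝[>] 0) (𝓝 A) := by
  have e1 : 0 < 2 * k + 2 * t - j := by linarith
  have hG1 : ∀ r ∈ Ioc 0 R, |G r| ≤ C / (2 * k + 2 * t - j) * r ^ (2 * k + 2 * t - j) := by
    refine abs_le_of_abs_hasDerivAt_le (fun r hr => hG r hr.1)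
      (fun r hr => hasDerivAt_div_mul_rpow hr.1 e1.ne' C) ?_ hG0
      (tendsto_mul_rpow_nhdsGT_zero e1 _)
    intro r hr
    have hr0 := hr.1
    rw [abs_mul, abs_of_pos (Real.rpow_pos_of_pos hr0 _)]
    calc r ^ (2 * k + 2 * t - 1) * |H r|
        ≤ r ^ (2 * k + 2 * t - 1) * (C * r ^ (-j)) := by gcongr; exact hH r hr
      _ = _ := by
          rw [show 2 * k + 2 * t - j - 1 = (2 * k + 2 * t - 1) + -j by ring, Real.rpow_add hr0]
          ring
  refine exists_tendsto_of_abs_deriv_le (C := C / (2 * k + 2 * t - j)) (σ := t - j) hR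
    (by linarith) (fun r hr => hF r hr.1) ?_
  intro r hr
  have hr0 := hr.1
  rw [abs_mul, abs_of_pos (Real.rpow_pos_of_pos hr0 _)]
  calc r ^ (-(2 * k + t + 1)) * |G r|
      ≤ r ^ (-(2 * k + t + 1)) * (C / (2 * k + 2 * t - j) * r ^ (2 * k + 2 * t - j)) := by
        gcongr; exact hG1 r hr
    _ = _ := by
        rw [show t - j - 1 = -(2 * k + t + 1) + (2 * k + 2 * t - j) by ring, Real.rpow_add hr0]
        ring

/-- A flux of lower order than the critical one forces `u` below the critical singularity. -/
theorem RadialSystem.eventually_abs_le {k t : ℝ} (hk : 0 < k)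
    {u W P Q : ℝ → ℝ} (h : RadialSystem k t u W P Q)
    (hP : ∀ ε : ℝ, 0 < ε → ∀ᶠ r in 𝓝[>] (0 : ℝ), |P r| ≤ ε * r ^ (k + t)) {ε : ℝ} (hε : 0 < ε) :
    ∀ᶠ r in 𝓝[>] (0 : ℝ), |u r| ≤ ε * r ^ (-k) := by
  obtain ⟨R, hR, hR'⟩ := mem_nhdsGT_iff_exists_Ioc_subset.1 (hP (ε / 2 * k) (by positivity))
  have hR0 : (0 : ℝ) < R := hR
  have hmain : ∀ r ∈ Ioc 0 R, |u r| ≤ |u R| + -(ε / 2 * k) / (-k) * r ^ (-k) := by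
    refine abs_le_add_of_abs_hasDerivAt_le (fun r hr => h.deriv_u r hr.1)
      (fun r hr => hasDerivAt_div_mul_rpow hr.1 (by linarith) _) ?_ ?_
    · intro r hr
      have hr0 := hr.1
      rw [abs_mul, abs_of_pos (Real.rpow_pos_of_pos hr0 _)]
      calc r ^ (-(2 * k + t + 1)) * |P r|
          ≤ r ^ (-(2 * k + t + 1)) * (ε / 2 * k * r ^ (k + t)) := by gcongr; exact hR' hr
        _ = _ := by
            rw [show -k - 1 = -(2 * k + t + 1) + (k + t) by ring, Real.rpow_add hr0 _ (k + t)]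
            ring
    · rw [neg_div_neg_eq, mul_div_cancel_right₀ _ hk.ne']
      positivity
  have hlarge : ∀ᶠ r in 𝓝[>] (0 : ℝ), |u R| ≤ ε / 2 * r ^ (-k) :=
    ((tendsto_rpow_neg_nhdsGT_zero (by linarith)).const_mul_atTop (by positivity :
      0 < ε / 2)).eventually_ge_atTop _
  filter_upwards [hlarge, Ioc_mem_nhdsGT hR0] with r h1 h2
  have h3 := hmain r h2
  rw [neg_div_neg_eq, mul_div_cancel_right₀ _ hk.ne'] at h3
  linarith

/-- Solutions of the radial system with a flux `P` of lower order than the critical one are regular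
at the origin. Near the origin `|u| ^ (2 t / k)` is a small multiple of `r ^ (-2 t)`, so inverting
the equation halves the coefficients in a bound `X r ^ (-m) + Y r ^ (-k)`; iteration removes the
critical power `r ^ (-k)`, and for small `m` the remaining bound makes the derivatives of `W` and
then of `u` integrable. -/
theorem RadialSystem.exists_tendsto {k t : ℝ} (hk : 0 < k) (ht : 0 < t)
    {u W P Q : ℝ → ℝ} (h : RadialSystem k t u W P Q)
    (hP : ∀ ε : ℝ, 0 < ε → ∀ᶠ r in 𝓝[>] (0 : ℝ), |P r| ≤ ε * r ^ (k + t)) :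
    ∃ A B, Tendsto u (𝓝[>] 0) (𝓝 A) ∧ Tendsto W (𝓝[>] 0) (𝓝 B) := by
  have hq : 0 < 2 * t / k := by positivity
  have hkq : k * (2 * t / k) = 2 * t := by field_simp
  set q := 2 * t / k with hqdef
  -- The exponent `m` satisfies `m * (q + 1) < t`, so `|u| ^ (q + 1)` is integrable twice.
  set m := t / (2 * (q + 1)) with hm
  have hm0 : 0 < m := by positivity
  have hmq : m * (q + 1) = t / 2 := by rw [hm]; field_simp
  have hmk : m ≤ k := by
    by_contra hcon
    push Not at hcon
    have : k * (q + 1) < m * (q + 1) := by gcongr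
    nlinarith
  set e := k * t * (k * m) / 2 with he
  have he0 : 0 < e := by positivity
  set ε := min 1 (e ^ (1 / q)) with hε
  have hε0 : 0 < ε := by positivity
  have hεq : ε ^ q ≤ e := by
    calc ε ^ q ≤ (e ^ (1 / q)) ^ q := by gcongr; exact min_le_right _ _
      _ = e := by rw [← Real.rpow_mul he0.le, one_div_mul_cancel hq.ne', Real.rpow_one]
  obtain ⟨R, hR, hR'⟩ := mem_nhdsGT_iff_exists_Ioc_subset.1
    ((h.eventually_abs_le hk hP hε0).and (Ioc_mem_nhdsGT one_pos))
  have hR0 : (0 : ℝ) < R := hR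
  have hu : ∀ r ∈ Ioc 0 R, |u r| ≤ ε * r ^ (-k) := fun r hr => (hR' hr).1
  have hR1 : ∀ r ∈ Ioc 0 R, r ≤ 1 := fun r hr => (hR' hr).2.2
  have hf : ∀ r ∈ Ioc 0 R, |u r| ^ q ≤ e * r ^ (-(2 * t)) := by
    intro r hr
    have hr0 := hr.1
    calc |u r| ^ q ≤ (ε * r ^ (-k)) ^ q := by gcongr; exact hu r hr
      _ = ε ^ q * r ^ (-(2 * t)) := by
        rw [Real.mul_rpow hε0.le (by positivity), ← Real.rpow_mul hr0.le, neg_mul, hkq]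
      _ ≤ e * r ^ (-(2 * t)) := by gcongr
  set C := |u R| + |W R| * R ^ t / ((2 * k + 2 * t) * t) with hC
  have hC0 : 0 ≤ C := by positivity
  have hstep : ∀ X Y : ℝ, 0 ≤ X → 0 ≤ Y →
      (∀ r ∈ Ioc 0 R, |u r| ≤ X * r ^ (-m) + Y * r ^ (-k)) →
      ∀ r ∈ Ioc 0 R, |u r| ≤ (C + X / 2) * r ^ (-m) + Y / 2 * r ^ (-k) := by
    intro X Y hX hY hb r hr
    have hW := abs_le_of_flux (c := k * t) (j := 2 * t + m) (j' := 2 * t + k) (D := 0)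
      (X := e * X) (Y := e * Y) (R := R) hk ht le_rfl (by positivity) (by positivity)
      (by linarith) (by linarith) (by linarith) (by linarith) (by positivity)
      (by gcongr <;> linarith) (by gcongr <;> linarith) h.deriv_W h.deriv_Q h.tendsto_Q (by
        intro r hr
        have hr0 := hr.1
        rw [abs_mul, abs_of_nonneg (by positivity : 0 ≤ |u r| ^ q)]
        calc |u r| ^ q * |u r| ≤ e * r ^ (-(2 * t)) * (X * r ^ (-m) + Y * r ^ (-k)) := by
              gcongr
              · exact hf r hr
              · exact hb r hr
          _ = _ := by
              rw [neg_add, neg_add, Real.rpow_add hr0, Real.rpow_add hr0]; ring)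
    have hU := abs_le_of_flux (c := k * m) (j := t + m) (j' := t + k) (D := |W R|)
      (X := e * X / (k * t)) (Y := e * Y / (k * t)) (R := R) hk ht (abs_nonneg _)
      (by positivity) (by positivity)
      (by linarith) (by linarith) (by linarith) (by linarith) (by positivity)
      (by gcongr <;> linarith) (by gcongr <;> linarith) h.deriv_u h.deriv_P h.tendsto_P (by
        intro r hr
        refine (hW r hr).trans_eq ?_
        rw [show t - (2 * t + m) = -(t + m) by ring, show t - (2 * t + k) = -(t + k) by ring]
        ring) r hr
    refine hU.trans ?_
    have hr0 := hr.1
    have i1 : e * X / (k * t) / (k * m) = X / 2 := by rw [he]; field_simp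
    have i2 : e * Y / (k * t) / (k * m) = Y / 2 := by rw [he]; field_simp
    rw [i1, i2, show t - (t + m) = -m by ring, show t - (t + k) = -k by ring]
    have i3 : 1 ≤ r ^ (-m) :=
      Real.one_le_rpow_of_pos_of_le_one_of_nonpos hr0 (hR1 r hr) (by linarith)
    nlinarith
  have hiter : ∀ n : ℕ, ∀ r ∈ Ioc 0 R,
      |u r| ≤ 2 * C * r ^ (-m) + 1 / 2 ^ n * r ^ (-k) := by
    intro n
    induction n with
    | zero =>
      intro r hr
      have hr0 := hr.1
      refine (hu r hr).trans ?_
      have : ε * r ^ (-k) ≤ 1 * r ^ (-k) := by gcongr; exact min_le_left _ _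
      have : 0 ≤ 2 * C * r ^ (-m) := by positivity
      simp only [pow_zero, div_one]
      linarith
    | succ n ih =>
      intro r hr
      have := hstep _ _ (by positivity) (by positivity) ih r hr
      rw [div_div, ← pow_succ] at this
      convert this using 3
      ring
  have hub : ∀ r ∈ Ioc 0 R, |u r| ≤ 2 * C * r ^ (-m) := by
    intro r hr
    have hlim : Tendsto (fun n : ℕ => 2 * C * r ^ (-m) + 1 / 2 ^ n * r ^ (-k)) atTop
        (𝓝 (2 * C * r ^ (-m) + 0 * r ^ (-k))) := by
      refine Tendsto.const_add _ (Tendsto.mul_const _ ?_)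
      simpa using tendsto_pow_atTop_nhds_zero_of_lt_one (r := (1 / 2 : ℝ)) (by norm_num)
        (by norm_num)
    simpa using ge_of_tendsto' hlim fun n => hiter n r hr
  obtain ⟨B, hB⟩ := exists_tendsto_of_flux (j := t / 2) (R := R) (C := (2 * C) ^ (q + 1)) hk ht hR0
    (by linarith) h.deriv_W h.deriv_Q h.tendsto_Q (by
      intro r hr
      have hr0 := hr.1
      rw [abs_mul, abs_of_nonneg (by positivity : 0 ≤ |u r| ^ q)]
      rw [← Real.rpow_add_one' (abs_nonneg _) (by linarith)]
      calc |u r| ^ (q + 1) ≤ (2 * C * r ^ (-m)) ^ (q + 1) := by gcongr; exact hub r hr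
        _ = _ := by
          rw [Real.mul_rpow (by positivity) (by positivity), ← Real.rpow_mul hr0.le, neg_mul, hmq])
  obtain ⟨S, hS0, hS⟩ := exists_bound_Ioc (R := R) (fun r hr => (h.deriv_W r hr).continuousAt) hB
  obtain ⟨A, hA⟩ := exists_tendsto_of_flux (j := 0) (R := R) (C := S) hk ht hR0
    ht h.deriv_u h.deriv_P h.tendsto_P (by simpa using hS)
  exact ⟨A, B, hA, hB⟩

/-! ### Uniqueness for the radial system -/

/-- If the initial values of `u` agree and those of `W` differ, the solutions drift apart at least
like `r ^ t`, so they cannot both be in the critical Lebesgue space. -/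
theorem RadialSystem.initial_le {k t : ℝ} (hk : 0 < k) (ht : 0 < t)
    {u₁ W₁ P₁ Q₁ u₂ W₂ P₂ Q₂ : ℝ → ℝ} {A B₁ B₂ : ℝ}
    (h₁ : RadialSystem k t u₁ W₁ P₁ Q₁) (h₂ : RadialSystem k t u₂ W₂ P₂ Q₂)
    (hA₁ : Tendsto u₁ (𝓝[>] 0) (𝓝 A)) (hA₂ : Tendsto u₂ (𝓝[>] 0) (𝓝 A))
    (hB₁ : Tendsto W₁ (𝓝[>] 0) (𝓝 B₁)) (hB₂ : Tendsto W₂ (𝓝[>] 0) (𝓝 B₂))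
    (hi₁ : IntegrableOn (fun r => r ^ (2 * k + 2 * t - 1) * |u₁ r| ^ (2 + 2 * t / k)) (Ioi 0))
    (hi₂ : IntegrableOn (fun r => r ^ (2 * k + 2 * t - 1) * |u₂ r| ^ (2 + 2 * t / k)) (Ioi 0)) :
    B₂ ≤ B₁ := by
  by_contra! hB
  have hq : 0 < 2 * t / k := by positivity
  have hkt : 0 < 2 * k + 2 * t := by linarith
  have hu := h₁.le_of_le hk ht h₂ hA₁ hA₂ hB₁ hB₂ le_rfl hB.le
  have hQ : ∀ r, 0 < r → Q₁ r ≤ Q₂ r := fun r hr =>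
    le_of_hasDerivAt_le (R := r) (fun s hs => h₁.deriv_Q s hs.1) (fun s hs => h₂.deriv_Q s hs.1)
      (fun s hs => mul_le_mul_of_nonneg_left (monotone_abs_rpow_mul_self hq (hu s hs.1))
        (Real.rpow_nonneg hs.1.le _)) h₁.tendsto_Q h₂.tendsto_Q le_rfl r ⟨hr, le_rfl⟩
  have hW : ∀ r, 0 < r → (B₂ - B₁) + W₁ r ≤ W₂ r := fun r hr =>
    le_of_hasDerivAt_le (R := r) (fun s hs => (h₁.deriv_W s hs.1).const_add _)
      (fun s hs => h₂.deriv_W s hs.1)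
      (fun s hs => mul_le_mul_of_nonneg_left (hQ s hs.1)
        (Real.rpow_nonneg hs.1.le _)) (hB₁.const_add _) hB₂ (by linarith) r ⟨hr, le_rfl⟩
  set D := B₂ - B₁ with hD
  have hD0 : 0 < D := by linarith
  have hPP : ∀ r, 0 < r → D / (2 * k + 2 * t) * r ^ (2 * k + 2 * t) + P₁ r ≤ P₂ r := fun r hr =>
    le_of_hasDerivAt_le (R := r)
      (fun s hs => (hasDerivAt_div_mul_rpow hs.1 hkt.ne' D).add (h₁.deriv_P s hs.1))
      (fun s hs => h₂.deriv_P s hs.1)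
      (fun s hs => by
        have := mul_le_mul_of_nonneg_left (hW s hs.1)
          (Real.rpow_nonneg hs.1.le (2 * k + 2 * t - 1))
        linarith) ((tendsto_mul_rpow_nhdsGT_zero hkt _).add h₁.tendsto_P) h₂.tendsto_P (by simp)
      r ⟨hr, le_rfl⟩
  have hdiff : ∀ r, 0 < r → D / (2 * k + 2 * t) / t * r ^ t + u₁ r ≤ u₂ r := fun r hr =>
    le_of_hasDerivAt_le (R := r)
      (fun s hs => (hasDerivAt_div_mul_rpow hs.1 ht.ne' (D / (2 * k + 2 * t))).add
        (h₁.deriv_u s hs.1))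
      (fun s hs => h₂.deriv_u s hs.1)
      (fun s hs => by
        have h3 := mul_le_mul_of_nonneg_left (hPP s hs.1)
          (Real.rpow_nonneg hs.1.le (-(2 * k + t + 1)))
        rw [mul_add, mul_left_comm, ← Real.rpow_add hs.1,
          show -(2 * k + t + 1) + (2 * k + 2 * t) = t - 1 by ring] at h3
        exact h3)
      ((tendsto_mul_rpow_nhdsGT_zero ht _).add hA₁) hA₂ (by simp)
      r ⟨hr, le_rfl⟩
  set c := D / (2 * k + 2 * t) / t with hc
  have hc0 : 0 < c := by positivity
  have hbound : ∀ r ∈ Ioi (1 : ℝ), ‖(c / 2) ^ (2 + 2 * t / k) * r ^ (2 * k + 2 * t - 1)‖ ≤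
      r ^ (2 * k + 2 * t - 1) * |u₁ r| ^ (2 + 2 * t / k) +
      r ^ (2 * k + 2 * t - 1) * |u₂ r| ^ (2 + 2 * t / k) := by
    intro r hr
    have hr1 : (1 : ℝ) < r := hr
    have hr0 : 0 < r := by linarith
    have h1 := hdiff r hr0
    have h2 : 1 ≤ r ^ t := Real.one_le_rpow hr1.le ht.le
    have h3 : c ≤ |u₁ r| + |u₂ r| := by
      have := le_abs_self (u₂ r)
      have := neg_le_abs (u₁ r)
      nlinarith
    have h4 : (c / 2) ^ (2 + 2 * t / k) ≤ |u₁ r| ^ (2 + 2 * t / k) + |u₂ r| ^ (2 + 2 * t / k) := by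
      rcases le_total |u₁ r| |u₂ r| with h5 | h5
      · have : (c / 2) ^ (2 + 2 * t / k) ≤ |u₂ r| ^ (2 + 2 * t / k) := by
          gcongr; linarith
        have : 0 ≤ |u₁ r| ^ (2 + 2 * t / k) := by positivity
        linarith
      · have : (c / 2) ^ (2 + 2 * t / k) ≤ |u₁ r| ^ (2 + 2 * t / k) := by
          gcongr; linarith
        have : 0 ≤ |u₂ r| ^ (2 + 2 * t / k) := by positivity
        linarith
    rw [Real.norm_of_nonneg (by positivity)]
    have := mul_le_mul_of_nonneg_left h4 (Real.rpow_nonneg hr0.le (2 * k + 2 * t - 1))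
    linarith
  have hint : IntegrableOn (fun r : ℝ => (c / 2) ^ (2 + 2 * t / k) * r ^ (2 * k + 2 * t - 1))
      (Ioi 1) := by
    refine Integrable.mono' ((hi₁.add hi₂).mono_set (Ioi_subset_Ioi zero_le_one)) ?_ ?_
    · exact (measurable_id.pow_const _ |>.const_mul _).aestronglyMeasurable
    · exact (ae_restrict_mem measurableSet_Ioi).mono fun r hr => hbound r hr
  have hne : (c / 2) ^ (2 + 2 * t / k) ≠ 0 := by positivity
  rw [IntegrableOn, integrable_const_mul_iff (isUnit_iff_ne_zero.2 hne)] at hint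
  have := (integrableOn_Ioi_rpow_iff zero_lt_one).1 hint
  linarith

theorem RadialSystem.eq_of_initial_eq {k t : ℝ} (hk : 0 < k) (ht : 0 < t)
    {u₁ W₁ P₁ Q₁ u₂ W₂ P₂ Q₂ : ℝ → ℝ} {A B₁ B₂ : ℝ}
    (h₁ : RadialSystem k t u₁ W₁ P₁ Q₁) (h₂ : RadialSystem k t u₂ W₂ P₂ Q₂)
    (hA₁ : Tendsto u₁ (𝓝[>] 0) (𝓝 A)) (hA₂ : Tendsto u₂ (𝓝[>] 0) (𝓝 A))
    (hB₁ : Tendsto W₁ (𝓝[>] 0) (𝓝 B₁)) (hB₂ : Tendsto W₂ (𝓝[>] 0) (𝓝 B₂))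
    (hi₁ : IntegrableOn (fun r => r ^ (2 * k + 2 * t - 1) * |u₁ r| ^ (2 + 2 * t / k)) (Ioi 0))
    (hi₂ : IntegrableOn (fun r => r ^ (2 * k + 2 * t - 1) * |u₂ r| ^ (2 + 2 * t / k)) (Ioi 0)) :
    ∀ r, 0 < r → u₁ r = u₂ r := by
  have hB : B₁ = B₂ := le_antisymm (h₂.initial_le hk ht h₁ hA₂ hA₁ hB₂ hB₁ hi₂ hi₁)
    (h₁.initial_le hk ht h₂ hA₁ hA₂ hB₁ hB₂ hi₁ hi₂)
  exact fun r hr => le_antisymm (h₁.le_of_le hk ht h₂ hA₁ hA₂ hB₁ hB₂ le_rfl hB.le r hr)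
    (h₂.le_of_le hk ht h₁ hA₂ hA₁ hB₂ hB₁ le_rfl hB.ge r hr)

/-! ### Divergence and gradient in weighted form -/

theorem hasFDerivAt_norm_of_ne {N : ℕ} {x : EuclideanSpace ℝ (Fin N)} (hx : x ≠ 0) :
    HasFDerivAt (fun y : EuclideanSpace ℝ (Fin N) => ‖y‖) (‖x‖⁻¹ • innerSL ℝ x) x := by
  have h := (hasStrictFDerivAt_norm_sq x).hasFDerivAt.sqrt (by simpa using hx)
  have h2 : (fun y : EuclideanSpace ℝ (Fin N) => √(‖y‖ ^ 2)) = fun y => ‖y‖ := by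
    funext y; exact Real.sqrt_sq (norm_nonneg y)
  rw [h2, Real.sqrt_sq (norm_nonneg x)] at h
  refine h.congr_fderiv ?_
  ext v
  simp
  ring

theorem hasFDerivAt_comp_norm {N : ℕ} {x : EuclideanSpace ℝ (Fin N)} (hx : x ≠ 0) {f : ℝ → ℝ}
    {f' : ℝ} (hf : HasDerivAt f f' ‖x‖) :
    HasFDerivAt (fun y : EuclideanSpace ℝ (Fin N) => f ‖y‖) ((f' * ‖x‖⁻¹) • innerSL ℝ x) x := by
  have := hf.comp_hasFDerivAt x (hasFDerivAt_norm_of_ne hx)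
  rwa [smul_smul] at this

theorem gradient_comp_norm {N : ℕ} {x : EuclideanSpace ℝ (Fin N)} (hx : x ≠ 0) {f : ℝ → ℝ}
    {f' : ℝ} (hf : HasDerivAt f f' ‖x‖) :
    gradient (fun y : EuclideanSpace ℝ (Fin N) => f ‖y‖) x = (f' * ‖x‖⁻¹) • x := by
  refine HasGradientAt.gradient (hasGradientAt_iff_hasFDerivAt.2 ?_)
  refine (hasFDerivAt_comp_norm hx hf).congr_fderiv ?_
  ext v
  simp

theorem sum_apply_single_mul {N : ℕ} (L : EuclideanSpace ℝ (Fin N) →L[ℝ] ℝ)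
    (v : EuclideanSpace ℝ (Fin N)) :
    ∑ i, L (EuclideanSpace.single i 1) * v i = L v := by
  conv_rhs => rw [← (EuclideanSpace.basisFun (Fin N) ℝ).sum_repr v]
  simp [mul_comm]

theorem divergence_smul {N : ℕ} {c : EuclideanSpace ℝ (Fin N) → ℝ}
    {F : EuclideanSpace ℝ (Fin N) → EuclideanSpace ℝ (Fin N)} {x : EuclideanSpace ℝ (Fin N)}
    (hc : DifferentiableAt ℝ c x) (hF : DifferentiableAt ℝ F x) :
    divergence (fun y => c y • F y) x = c x * divergence F x + fderiv ℝ c x (F x) := by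
  rw [divergence, fderiv_fun_smul hc hF, divergence, Finset.mul_sum,
    ← sum_apply_single_mul (fderiv ℝ c x) (F x), ← Finset.sum_add_distrib]
  refine Finset.sum_congr rfl fun i _ => ?_
  simp

theorem divergence_id {N : ℕ} (x : EuclideanSpace ℝ (Fin N)) :
    divergence (fun y : EuclideanSpace ℝ (Fin N) => y) x = N := by
  simp [divergence]

theorem divergence_congr {N : ℕ} {F G : EuclideanSpace ℝ (Fin N) → EuclideanSpace ℝ (Fin N)}
    {x : EuclideanSpace ℝ (Fin N)} (h : F =ᶠ[𝓝 x] G) : divergence F x = divergence G x := by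
  rw [divergence, divergence, h.fderiv_eq]

theorem contDiff_gradient {N : ℕ} {φ : EuclideanSpace ℝ (Fin N) → ℝ} (hφ : ContDiff ℝ ∞ φ) :
    ContDiff ℝ ∞ (gradient φ) :=
  (InnerProductSpace.toDual ℝ (EuclideanSpace ℝ (Fin N))).symm.toContinuousLinearEquiv.contDiff.comp
    (hφ.fderiv_right (m := ∞) (by norm_cast))

theorem contDiffAt_norm_rpow {N : ℕ} {x : EuclideanSpace ℝ (Fin N)} (hx : x ≠ 0) (γ : ℝ) :
    ContDiffAt ℝ ∞ (fun y : EuclideanSpace ℝ (Fin N) => ‖y‖ ^ γ) x :=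
  (contDiffAt_norm ℝ hx).rpow_const_of_ne (norm_ne_zero_iff.2 hx)

theorem contDiffOn_powGrad {N : ℕ} (α : ℝ) {φ : EuclideanSpace ℝ (Fin N) → ℝ}
    (hφ : ContDiff ℝ ∞ φ) :
    ContDiffOn ℝ ∞ (fun y => ‖y‖ ^ α • gradient φ y) {0}ᶜ := fun _ hx =>
  ((contDiffAt_norm_rpow hx α).smul (contDiff_gradient hφ).contDiffAt).contDiffWithinAt

theorem continuousOn_divergence {N : ℕ}
    {F : EuclideanSpace ℝ (Fin N) → EuclideanSpace ℝ (Fin N)} {U : Set (EuclideanSpace ℝ (Fin N))}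
    (hU : IsOpen U) (hF : ContDiffOn ℝ ∞ F U) : ContinuousOn (divergence F) U := by
  have h := hF.continuousOn_fderiv_of_isOpen hU (by norm_cast)
  refine continuousOn_finsetSum _ fun i _ => ?_
  exact (EuclideanSpace.proj (𝕜 := ℝ) i).continuous.comp_continuousOn
    (h.clm_apply continuousOn_const)

theorem continuousOn_divPowGrad {N : ℕ} (α : ℝ) {φ : EuclideanSpace ℝ (Fin N) → ℝ}
    (hφ : ContDiff ℝ ∞ φ) : ContinuousOn (divPowGrad α φ) {0}ᶜ :=
  continuousOn_divergence isOpen_compl_singleton (contDiffOn_powGrad α hφ)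

theorem aestronglyMeasurable_of_continuousOn_compl {N : ℕ} (hN : N ≠ 0)
    {f : EuclideanSpace ℝ (Fin N) → ℝ} (hf : ContinuousOn f {0}ᶜ) :
    AEStronglyMeasurable f volume := by
  have : Nonempty (Fin N) := ⟨⟨0, Nat.pos_of_ne_zero hN⟩⟩
  rw [← restrict_compl_singleton (μ := (volume : Measure (EuclideanSpace ℝ (Fin N)))) 0]
  exact hf.aestronglyMeasurable (measurableSet_singleton _).compl

theorem divPowGrad_eq {N : ℕ} (α : ℝ) {φ : EuclideanSpace ℝ (Fin N) → ℝ} (hφ : ContDiff ℝ ∞ φ)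
    {x : EuclideanSpace ℝ (Fin N)} (hx : x ≠ 0) :
    divPowGrad α φ x = ‖x‖ ^ α * divergence (gradient φ) x +
      α * ‖x‖ ^ (α - 1) * ‖x‖⁻¹ * inner ℝ x (gradient φ x) := by
  have h1 := hasFDerivAt_comp_norm hx (f := fun r => r ^ α)
    (Real.hasDerivAt_rpow_const (p := α) (Or.inl (norm_ne_zero_iff.2 hx)))
  rw [divPowGrad, divergence_smul h1.differentiableAt
    ((contDiff_gradient hφ).differentiable (by simp)).differentiableAt, h1.fderiv]
  simp

theorem gradient_eq_zero_of_notMem_tsupport {N : ℕ} {φ : EuclideanSpace ℝ (Fin N) → ℝ}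
    {x : EuclideanSpace ℝ (Fin N)} (hx : x ∉ tsupport φ) : gradient φ x = 0 := by
  have : fderiv ℝ φ x = 0 :=
    image_eq_zero_of_notMem_tsupport fun h => hx (tsupport_fderiv_subset ℝ h)
  simp [gradient, this]

theorem divPowGrad_eq_zero_of_notMem_tsupport {N : ℕ} (α : ℝ) {φ : EuclideanSpace ℝ (Fin N) → ℝ}
    {x : EuclideanSpace ℝ (Fin N)} (hx : x ∉ tsupport φ) : divPowGrad α φ x = 0 := by
  have h : (fun y => ‖y‖ ^ α • gradient φ y) =ᶠ[𝓝 x] fun _ => 0 := by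
    filter_upwards [(isClosed_tsupport φ).isOpen_compl.mem_nhds hx] with y hy
    rw [gradient_eq_zero_of_notMem_tsupport hy, smul_zero]
  rw [divPowGrad, divergence_congr h]
  simp [divergence]

/-- The only singularity of `div (|x|^α ∇ φ)` at the origin is of order `|x|^(α - 1)`. -/
theorem exists_abs_divPowGrad_le {N : ℕ} (α : ℝ) {φ : EuclideanSpace ℝ (Fin N) → ℝ}
    (hφ : IsTest φ) : ∃ C R : ℝ, 0 ≤ C ∧ 0 < R ∧
      (∀ x, x ≠ 0 → ‖x‖ ^ α * ‖gradient φ x‖ ≤ C * ‖x‖ ^ α) ∧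
      (∀ x, x ≠ 0 → |divPowGrad α φ x| ≤ C * ‖x‖ ^ (α - 1)) ∧
      (∀ x, R ≤ ‖x‖ → φ x = 0 ∧ gradient φ x = 0 ∧ divPowGrad α φ x = 0) := by
  obtain ⟨R, hR0, hR⟩ := hφ.2.isCompact.isBounded.subset_ball_lt 0 0
  have hg := contDiff_gradient hφ.1
  have hgc : HasCompactSupport (gradient φ) := HasCompactSupport.intro hφ.2.isCompact
    fun x hx => gradient_eq_zero_of_notMem_tsupport hx
  obtain ⟨C₁, hC₁⟩ := hgc.exists_bound_of_continuous hg.continuous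
  have hdc : Continuous (divergence (gradient φ)) := by
    rw [← continuousOn_univ]
    exact continuousOn_divergence isOpen_univ hg.contDiffOn
  have hds : HasCompactSupport (divergence (gradient φ)) := by
    refine HasCompactSupport.intro hφ.2.isCompact fun x hx => ?_
    have h : gradient φ =ᶠ[𝓝 x] fun _ => 0 := by
      filter_upwards [(isClosed_tsupport φ).isOpen_compl.mem_nhds hx] with y hy
      rw [gradient_eq_zero_of_notMem_tsupport hy]
    rw [divergence_congr h]
    simp [divergence]
  obtain ⟨C₂, hC₂⟩ := hds.exists_bound_of_continuous hdc
  have hC₁0 : 0 ≤ C₁ := (norm_nonneg _).trans (hC₁ 0)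
  have hC₂0 : 0 ≤ C₂ := (norm_nonneg _).trans (hC₂ 0)
  have hout : ∀ x, R ≤ ‖x‖ → x ∉ tsupport φ := fun x hx h => by
    have := hR h
    rw [mem_ball_zero_iff] at this
    linarith
  refine ⟨R * C₂ + |α| * C₁ + C₁, R, by positivity, hR0, fun x hx => ?_, fun x hx => ?_,
    fun x hx => ⟨image_eq_zero_of_notMem_tsupport (hout x hx),
      gradient_eq_zero_of_notMem_tsupport (hout x hx),
      divPowGrad_eq_zero_of_notMem_tsupport α (hout x hx)⟩⟩
  · rw [mul_comm]
    have : 0 ≤ R * C₂ + |α| * C₁ := by positivity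
    gcongr
    linarith [hC₁ x]
  · have hx0 : 0 < ‖x‖ := norm_pos_iff.2 hx
    rcases le_or_gt R ‖x‖ with h | h
    · rw [divPowGrad_eq_zero_of_notMem_tsupport α (hout x h), abs_zero]
      positivity
    rw [divPowGrad_eq α hφ.1 hx]
    have h1 : |‖x‖ ^ α * divergence (gradient φ) x| ≤ R * C₂ * ‖x‖ ^ (α - 1) := by
      rw [abs_mul, abs_of_nonneg (by positivity)]
      have h2 := hC₂ x
      rw [Real.norm_eq_abs] at h2
      have h3 : ‖x‖ ^ α = ‖x‖ * ‖x‖ ^ (α - 1) := by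
        rw [mul_comm, ← Real.rpow_add_one hx0.ne']; simp
      calc ‖x‖ ^ α * |divergence (gradient φ) x| ≤ (R * ‖x‖ ^ (α - 1)) * C₂ := by
            rw [h3]; gcongr
        _ = _ := by ring
    have h4 : |α * ‖x‖ ^ (α - 1) * ‖x‖⁻¹ * inner ℝ x (gradient φ x)|
        ≤ |α| * C₁ * ‖x‖ ^ (α - 1) := by
      rw [abs_mul, abs_mul, abs_mul, abs_of_nonneg (by positivity : 0 ≤ ‖x‖ ^ (α - 1)),
        abs_of_nonneg (by positivity : 0 ≤ ‖x‖⁻¹)]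
      calc |α| * ‖x‖ ^ (α - 1) * ‖x‖⁻¹ * |inner ℝ x (gradient φ x)|
          ≤ |α| * ‖x‖ ^ (α - 1) * ‖x‖⁻¹ * (‖x‖ * C₁) := by
            gcongr
            exact (abs_real_inner_le_norm _ _).trans (by gcongr; exact hC₁ x)
        _ = _ := by field_simp
    refine (abs_add_le _ _).trans ?_
    have : 0 ≤ C₁ * ‖x‖ ^ (α - 1) := by positivity
    linarith

/-! ### Integration by parts -/

theorem integrable_mul_of_continuousOn_tsupport {N : ℕ} {η g : EuclideanSpace ℝ (Fin N) → ℝ}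
    {U : Set (EuclideanSpace ℝ (Fin N))} (hU : IsOpen U) (hη : Continuous η)
    (hηc : HasCompactSupport η) (hηU : tsupport η ⊆ U) (hg : ContinuousOn g U) :
    Integrable (fun x => η x * g x) :=
  ((hη.continuousOn.mul hg).continuous_of_tsupport_subset hU
    ((tsupport_mul_subset_left).trans hηU)).integrable_of_hasCompactSupport hηc.mul_right

theorem integral_mul_divergence {N : ℕ} {η : EuclideanSpace ℝ (Fin N) → ℝ}
    {F : EuclideanSpace ℝ (Fin N) → EuclideanSpace ℝ (Fin N)}
    {U : Set (EuclideanSpace ℝ (Fin N))} (hU : IsOpen U) (hη : ContDiff ℝ ∞ η)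
    (hηc : HasCompactSupport η) (hηU : tsupport η ⊆ U) (hF : ContDiffOn ℝ ∞ F U) :
    ∫ x, η x * divergence F x = -∫ x, fderiv ℝ η x (F x) := by
  have hFd : ∀ x ∈ U, DifferentiableAt ℝ F x := fun x hx =>
    (hF.contDiffAt (hU.mem_nhds hx)).differentiableAt (by simp)
  have hcomp : ∀ (i : Fin N) (x), x ∈ U → ∀ v, (fderiv ℝ F x v) i =
      fderiv ℝ (fun y => F y i) x v := by
    intro i x hx v
    have h := (EuclideanSpace.proj (𝕜 := ℝ) i).hasFDerivAt.comp x (hFd x hx).hasFDerivAt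
    have h' : HasFDerivAt (fun y => F y i)
        ((EuclideanSpace.proj (𝕜 := ℝ) i).comp (fderiv ℝ F x)) x := h
    rw [h'.fderiv]
    simp
  have hFi : ∀ i : Fin N, ContDiffOn ℝ ∞ (fun y => F y i) U := fun i =>
    (EuclideanSpace.proj (𝕜 := ℝ) i).contDiff.comp_contDiffOn hF
  have hdη : ∀ v, Continuous fun x => fderiv ℝ η x v := fun v =>
    (hη.continuous_fderiv (by simp)).clm_apply continuous_const
  have hdηs : ∀ v, tsupport (fun x => fderiv ℝ η x v) ⊆ tsupport η := fun v =>
    (closure_mono fun x hx => by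
      simp only [Function.mem_support] at hx ⊢
      intro h0; exact hx (by simp [h0])).trans (tsupport_fderiv_subset ℝ)
  have hdηc : ∀ v, HasCompactSupport fun x => fderiv ℝ η x v := fun v =>
    hηc.of_isClosed_subset (isClosed_tsupport _) (hdηs v)
  have hi1 : ∀ i : Fin N, Integrable fun x =>
      η x * fderiv ℝ (fun y => F y i) x (EuclideanSpace.single i 1) := fun i =>
    integrable_mul_of_continuousOn_tsupport hU hη.continuous hηc hηU
      (((hFi i).continuousOn_fderiv_of_isOpen hU (by norm_cast)).clm_apply continuousOn_const)
  have hi2 : ∀ i : Fin N, Integrable fun x =>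
      fderiv ℝ η x (EuclideanSpace.single i 1) * F x i := fun i =>
    integrable_mul_of_continuousOn_tsupport hU (hdη _) (hdηc _) ((hdηs _).trans hηU)
      (hFi i).continuousOn
  have hkey : ∀ i : Fin N,
      ∫ x, η x * fderiv ℝ (fun y => F y i) x (EuclideanSpace.single i 1) =
        -∫ x, fderiv ℝ η x (EuclideanSpace.single i 1) * F x i := fun i =>
    integral_mul_fderiv_eq_neg_fderiv_mul_of_integrable (hi2 i) (hi1 i)
      (integrable_mul_of_continuousOn_tsupport hU hη.continuous hηc hηU (hFi i).continuousOn)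
      (fun x _ => (hη.differentiable (by simp)).differentiableAt)
      (fun x hx => ((hFi i).contDiffAt (hU.mem_nhds (hηU hx))).differentiableAt (by simp))
  have e1 : (fun x => η x * divergence F x) = fun x =>
      ∑ i : Fin N, η x * fderiv ℝ (fun y => F y i) x (EuclideanSpace.single i 1) := by
    funext x
    by_cases hx : x ∈ tsupport η
    · rw [divergence, Finset.mul_sum]
      exact Finset.sum_congr rfl fun i _ => by rw [hcomp i x (hηU hx)]
    · simp [image_eq_zero_of_notMem_tsupport hx]
  have e2 : (fun x => fderiv ℝ η x (F x)) = fun x =>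
      ∑ i : Fin N, fderiv ℝ η x (EuclideanSpace.single i 1) * F x i := by
    funext x
    rw [sum_apply_single_mul]
  rw [e1, e2, integral_finsetSum _ fun i _ => hi1 i, integral_finsetSum _ fun i _ => hi2 i,
    ← Finset.sum_neg_distrib]
  exact Finset.sum_congr rfl fun i _ => hkey i

/-! ### Integrals of radial functions -/

/-- The surface area of the unit sphere of `ℝ^N`. -/
noncomputable def sphereArea (N : ℕ) : ℝ :=
  N * volume.real (Metric.ball (0 : EuclideanSpace ℝ (Fin N)) 1)

theorem sphereArea_pos {N : ℕ} (hN : N ≠ 0) : 0 < sphereArea N := by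
  have : 0 < volume.real (Metric.ball (0 : EuclideanSpace ℝ (Fin N)) 1) :=
    ENNReal.toReal_pos (Metric.measure_ball_pos volume 0 one_pos).ne' measure_ball_lt_top.ne
  have : (0 : ℝ) < N := by exact_mod_cast Nat.pos_of_ne_zero hN
  unfold sphereArea
  positivity

theorem nontrivial_euclideanSpace {N : ℕ} (hN : N ≠ 0) :
    Nontrivial (EuclideanSpace ℝ (Fin N)) := by
  have : Nonempty (Fin N) := ⟨⟨0, Nat.pos_of_ne_zero hN⟩⟩
  infer_instance

theorem pow_pred_eq_rpow {N : ℕ} (hN : N ≠ 0) (r : ℝ) : r ^ (N - 1) = r ^ ((N : ℝ) - 1) := by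
  rw [← Real.rpow_natCast, Nat.cast_pred (Nat.pos_of_ne_zero hN)]

theorem integral_comp_norm {N : ℕ} (hN : N ≠ 0) (f : ℝ → ℝ) :
    ∫ x : EuclideanSpace ℝ (Fin N), f ‖x‖ =
      sphereArea N * ∫ r in Ioi (0 : ℝ), r ^ ((N : ℝ) - 1) * f r := by
  have := nontrivial_euclideanSpace hN
  rw [integral_fun_norm_addHaar, finrank_euclideanSpace_fin]
  simp only [nsmul_eq_mul, smul_eq_mul, pow_pred_eq_rpow hN]
  rw [sphereArea, mul_assoc]

theorem integrable_comp_norm {N : ℕ} (hN : N ≠ 0) {f : ℝ → ℝ} :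
    Integrable (fun x : EuclideanSpace ℝ (Fin N) => f ‖x‖) ↔
      IntegrableOn (fun r => r ^ ((N : ℝ) - 1) * f r) (Ioi 0) := by
  have := nontrivial_euclideanSpace hN
  rw [integrable_fun_norm_addHaar, finrank_euclideanSpace_fin]
  simp only [smul_eq_mul, pow_pred_eq_rpow hN]

theorem integrableOn_ball_norm_rpow {N : ℕ} (hN : N ≠ 0) {γ : ℝ} (hγ : -(N : ℝ) < γ) (R : ℝ) :
    IntegrableOn (fun x : EuclideanSpace ℝ (Fin N) => ‖x‖ ^ γ) (Metric.ball 0 R) := by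
  have := nontrivial_euclideanSpace hN
  rcases le_or_gt R 0 with hR | hR
  · simp [Metric.ball_eq_empty.2 hR]
  rw [integrableOn_fun_norm_addHaar (volume : Measure (EuclideanSpace ℝ (Fin N)))
    (f := fun r => r ^ γ), finrank_euclideanSpace_fin]
  have h := (intervalIntegral.integrableOn_Ioo_rpow_iff (s := (N : ℝ) - 1 + γ) hR).2 (by linarith)
  refine h.congr_fun (fun r hr => ?_) measurableSet_Ioo
  simp only [smul_eq_mul, pow_pred_eq_rpow hN]
  rw [← Real.rpow_add hr.1]

theorem integral_ball_norm_rpow {N : ℕ} (hN : N ≠ 0) {γ R : ℝ} (hγ : -(N : ℝ) < γ) (hR : 0 < R) :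
    ∫ x in Metric.ball (0 : EuclideanSpace ℝ (Fin N)) R, ‖x‖ ^ γ =
      sphereArea N * (R ^ (N + γ) / (N + γ)) := by
  have h1 : ∀ x : EuclideanSpace ℝ (Fin N), (Metric.ball (0 : EuclideanSpace ℝ (Fin N)) R).indicator
      (fun x => ‖x‖ ^ γ) x = (Iio R).indicator (fun r => r ^ γ) ‖x‖ := by
    intro x; simp [indicator]
  rw [← integral_indicator measurableSet_ball]
  simp_rw [h1]
  rw [integral_comp_norm hN]
  congr 1
  have h2 : ∀ r : ℝ, r ^ ((N : ℝ) - 1) * (Iio R).indicator (fun r => r ^ γ) r =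
      (Iio R).indicator (fun r => r ^ ((N : ℝ) - 1) * r ^ γ) r := by
    intro r; by_cases hr : r < R <;> simp [hr]
  simp_rw [h2]
  rw [setIntegral_indicator measurableSet_Iio, Ioi_inter_Iio, ← integral_Ioc_eq_integral_Ioo,
    ← intervalIntegral.integral_of_le hR.le]
  have h3 : ∫ r in (0 : ℝ)..R, r ^ ((N : ℝ) - 1) * r ^ γ = ∫ r in (0 : ℝ)..R, r ^ (N - 1 + γ) := by
    refine intervalIntegral.integral_congr_uIoo fun r hr => ?_
    rw [uIoo_of_le hR.le] at hr
    rw [← Real.rpow_add hr.1]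
  rw [h3, integral_rpow (Or.inl (by linarith))]
  have : (N : ℝ) - 1 + γ + 1 = N + γ := by ring
  rw [this, Real.zero_rpow (by linarith), sub_zero]

/-! ### Symmetry of the weighted operator on test functions -/

theorem integral_mul_divPowGrad_of_tsupport {N : ℕ} (α : ℝ)
    {η φ : EuclideanSpace ℝ (Fin N) → ℝ} (hη : IsTest η) (hη0 : tsupport η ⊆ {0}ᶜ)
    (hφ : ContDiff ℝ ∞ φ) :
    ∫ x, η x * divPowGrad α φ x = -∫ x, fderiv ℝ η x (‖x‖ ^ α • gradient φ x) :=
  integral_mul_divergence isOpen_compl_singleton hη.1 hη.2 hη0 (contDiffOn_powGrad α hφ)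

theorem fderiv_apply_powGrad {N : ℕ} (α : ℝ) (η φ : EuclideanSpace ℝ (Fin N) → ℝ)
    (x : EuclideanSpace ℝ (Fin N)) :
    fderiv ℝ η x (‖x‖ ^ α • gradient φ x) = ‖x‖ ^ α * inner ℝ (gradient η x) (gradient φ x) := by
  rw [map_smul, smul_eq_mul, inner_gradient_left]

/-- Test functions that are constant near the origin may be moved across the operator
`div (|x|^α ∇ ·)`: the singularity of order `|x|^(α - 1)` is integrable, so cutting off a
neighbourhood of the origin leaves nothing in the limit. -/
theorem integral_mul_divPowGrad_comm {N : ℕ} (hN : N ≠ 0) {α : ℝ} (hα : 1 - (N : ℝ) < α)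
    {η φ : EuclideanSpace ℝ (Fin N) → ℝ} (hη : IsTest η) (hη0 : ∀ᶠ y in 𝓝 0, η y = η 0)
    (hφ : IsTest φ) :
    ∫ x, η x * divPowGrad α φ x = ∫ x, φ x * divPowGrad α η x := by
  have hnt := nontrivial_euclideanSpace hN
  -- The right side equals the weighted Dirichlet form, the field `|x|^α ∇ η` being smooth.
  have hgη0 : ∀ᶠ y in 𝓝 (0 : EuclideanSpace ℝ (Fin N)), gradient η y = 0 := by
    filter_upwards [hη0.eventually_nhds] with y hy
    have : fderiv ℝ η y = 0 := by
      have h : η =ᶠ[𝓝 y] fun _ => η 0 := hy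
      rw [h.fderiv_eq]; simp
    simp [gradient, this]
  have hright : ∫ x, φ x * divPowGrad α η x = -∫ x, fderiv ℝ φ x (‖x‖ ^ α • gradient η x) := by
    refine integral_mul_divergence isOpen_univ hφ.1 hφ.2 (subset_univ _) ?_
    rw [contDiffOn_univ, contDiff_iff_contDiffAt]
    intro x
    rcases eq_or_ne x 0 with rfl | hx
    · refine (contDiffAt_const (c := (0 : EuclideanSpace ℝ (Fin N)))).congr_of_eventuallyEq ?_
      filter_upwards [hgη0] with y hy
      rw [hy, smul_zero]
    · exact (contDiffAt_norm_rpow hx α).smul (contDiff_gradient hη.1).contDiffAt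
  have hright' : ∫ x, φ x * divPowGrad α η x =
      -∫ x, fderiv ℝ η x (‖x‖ ^ α • gradient φ x) := by
    rw [hright]
    congr 2 with x
    rw [fderiv_apply_powGrad, fderiv_apply_powGrad, real_inner_comm]
  rw [hright']
  -- The cut-off functions `ζ n` vanish on the ball of radius `1 / (n + 1)`.
  let b : ContDiffBump (0 : EuclideanSpace ℝ (Fin N)) := ⟨1, 2, one_pos, one_lt_two⟩
  let ζ : ℕ → EuclideanSpace ℝ (Fin N) → ℝ := fun n x => 1 - b (((n : ℝ) + 1) • x)
  have hb : ContDiff ℝ ∞ b := b.contDiff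
  have hζ : ∀ n, ContDiff ℝ ∞ (ζ n) := fun n =>
    contDiff_const.sub (hb.comp (contDiff_id.const_smul _))
  have hζ01 : ∀ n x, |ζ n x| ≤ 1 := fun n x => by
    have h1 := b.nonneg (x := ((n : ℝ) + 1) • x)
    have h2 := b.le_one (x := ((n : ℝ) + 1) • x)
    rw [abs_le]; constructor <;> simp only [ζ] <;> linarith
  have hζ0 : ∀ n, ∀ᶠ y in 𝓝 0, ζ n y = 0 := by
    intro n
    have : Tendsto (fun y : EuclideanSpace ℝ (Fin N) => ((n : ℝ) + 1) • y) (𝓝 0) (𝓝 0) := by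
      have : Continuous fun y : EuclideanSpace ℝ (Fin N) => ((n : ℝ) + 1) • y := by fun_prop
      simpa using this.tendsto 0
    filter_upwards [this.eventually (b.eventuallyEq_one)] with y hy
    simp only [ζ]
    rw [hy]; simp
  have hζd : ∀ n x v, fderiv ℝ (ζ n) x v =
      -(((n : ℝ) + 1) * fderiv ℝ b (((n : ℝ) + 1) • x) v) := by
    intro n x v
    have h1 : HasFDerivAt (fun y : EuclideanSpace ℝ (Fin N) => ((n : ℝ) + 1) • y)
        (((n : ℝ) + 1) • ContinuousLinearMap.id ℝ _) x :=
      (hasFDerivAt_id x).const_smul ((n : ℝ) + 1)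
    have h2 := ((hb.differentiable (by simp)).differentiableAt
      (x := ((n : ℝ) + 1) • x)).hasFDerivAt.comp x h1
    have h3 : HasFDerivAt (ζ n) _ x := h2.const_sub 1
    rw [h3.fderiv]
    simp
  obtain ⟨Cb, hCb⟩ : ∃ C, ∀ y, ‖fderiv ℝ b y‖ ≤ C :=
    (b.hasCompactSupport.fderiv ℝ).exists_bound_of_continuous (hb.continuous_fderiv (by simp))
  have hfar : ∀ (n : ℕ) (x : EuclideanSpace ℝ (Fin N)), 2 < ((n : ℝ) + 1) * ‖x‖ →
      ζ n x = 1 ∧ ∀ v, fderiv ℝ (ζ n) x v = 0 := by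
    intro n x hx
    have hx' : ((n : ℝ) + 1) • x ∉ tsupport b := by
      rw [b.tsupport_eq, Metric.mem_closedBall, dist_zero_right, norm_smul,
        Real.norm_of_nonneg (by positivity)]
      exact not_le.2 hx
    refine ⟨?_, fun v => ?_⟩
    · simp [ζ, image_eq_zero_of_notMem_tsupport hx']
    · rw [hζd, image_eq_zero_of_notMem_tsupport fun h => hx' (tsupport_fderiv_subset ℝ h)]
      simp
  have hCb0 : 0 ≤ Cb := (norm_nonneg _).trans (hCb 0)
  have hζbound : ∀ n (x v : EuclideanSpace ℝ (Fin N)), x ≠ 0 →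
      |fderiv ℝ (ζ n) x v| ≤ 2 * Cb * ‖x‖⁻¹ * ‖v‖ := by
    intro n x v hx
    have hx0 : 0 < ‖x‖ := norm_pos_iff.2 hx
    rcases lt_or_ge 2 (((n : ℝ) + 1) * ‖x‖) with h | h
    · rw [(hfar n x h).2, abs_zero]; positivity
    · rw [hζd, abs_neg, abs_mul, abs_of_nonneg (by positivity : (0 : ℝ) ≤ n + 1)]
      have h1 : |fderiv ℝ b (((n : ℝ) + 1) • x) v| ≤ Cb * ‖v‖ :=
        ContinuousLinearMap.le_of_opNorm_le _ (hCb _) v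
      have h2 : (n : ℝ) + 1 ≤ 2 * ‖x‖⁻¹ := by
        rw [← div_eq_mul_inv, le_div_iff₀ hx0]; exact h
      calc ((n : ℝ) + 1) * |fderiv ℝ b (((n : ℝ) + 1) • x) v| ≤ 2 * ‖x‖⁻¹ * (Cb * ‖v‖) := by
            gcongr
        _ = _ := by ring
  have hlim1 : ∀ x : EuclideanSpace ℝ (Fin N), x ≠ 0 →
      ∀ᶠ n : ℕ in atTop, 2 < ((n : ℝ) + 1) * ‖x‖ := by
    intro x hx
    have : Tendsto (fun n : ℕ => ((n : ℝ) + 1) * ‖x‖) atTop atTop :=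
      (tendsto_atTop_add_const_right _ _ tendsto_natCast_atTop_atTop).atTop_mul_const
        (norm_pos_iff.2 hx)
    exact this.eventually_gt_atTop 2
  obtain ⟨C, R, hC0, hR0, hC1, hC2, hC3⟩ := exists_abs_divPowGrad_le α hφ
  obtain ⟨M, hM⟩ := hη.2.exists_bound_of_continuous hη.1.continuous
  obtain ⟨M', hM'⟩ := (hη.2.fderiv ℝ).exists_bound_of_continuous
    (hη.1.continuous_fderiv (by simp))
  have hM0 : 0 ≤ M := (norm_nonneg _).trans (hM 0)
  have hM'0 : 0 ≤ M' := (norm_nonneg _).trans (hM' 0)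
  have hpow : ∀ x : EuclideanSpace ℝ (Fin N), x ≠ 0 → ‖x‖ ^ α = ‖x‖ * ‖x‖ ^ (α - 1) := by
    intro x hx
    rw [mul_comm, ← Real.rpow_add_one (norm_ne_zero_iff.2 hx)]; simp
  set K := M * C + M' * (C * R) + M * (2 * Cb * C) with hK
  have hK0 : 0 ≤ K := by positivity
  have hint : Integrable ((Metric.ball (0 : EuclideanSpace ℝ (Fin N)) R).indicator
      fun x => K * ‖x‖ ^ (α - 1)) :=
    IntegrableOn.integrable_indicator
      ((integrableOn_ball_norm_rpow hN (γ := α - 1) (by linarith) R).const_mul K)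
      measurableSet_ball
  have hne : ∀ᵐ x : EuclideanSpace ℝ (Fin N), x ≠ 0 := by
    simp [ae_iff]
  have hmF : AEStronglyMeasurable (fun x => ‖x‖ ^ α • gradient φ x) volume := by
    exact AEStronglyMeasurable.smul (f := fun x : EuclideanSpace ℝ (Fin N) => ‖x‖ ^ α)
      (measurable_norm.pow_const α).aestronglyMeasurable
      (contDiff_gradient hφ.1).continuous.aestronglyMeasurable
  have hmf : ∀ f : EuclideanSpace ℝ (Fin N) → ℝ, ContDiff ℝ ∞ f →
      AEStronglyMeasurable (fun x => fderiv ℝ f x (‖x‖ ^ α • gradient φ x)) volume := fun f hf =>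
    ((ContinuousLinearMap.id ℝ _).aestronglyMeasurable_comp₂
      (hf.continuous_fderiv (by simp)).aestronglyMeasurable hmF)
  have hF : ∀ x, x ≠ 0 → ‖(‖x‖ ^ α • gradient φ x)‖ ≤ C * ‖x‖ ^ α := fun x hx => by
    rw [norm_smul, Real.norm_of_nonneg (by positivity)]; exact hC1 x hx
  have hL : Tendsto (fun n => ∫ x, (ζ n x * η x) * divPowGrad α φ x) atTop
      (𝓝 (∫ x, η x * divPowGrad α φ x)) := by
    refine tendsto_integral_of_dominated_convergence _ (fun n => ?_) hint (fun n => ?_) ?_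
    · exact (((hζ n).continuous.mul hη.1.continuous).aestronglyMeasurable).mul
        (aestronglyMeasurable_of_continuousOn_compl hN (continuousOn_divPowGrad α hφ.1))
    · filter_upwards [hne] with x hx
      rcases le_or_gt R ‖x‖ with h | h
      · rw [(hC3 x h).2.2]
        simp [not_lt.2 h]
      · rw [indicator_of_mem (by simpa using h), norm_mul, norm_mul]
        calc ‖ζ n x‖ * ‖η x‖ * ‖divPowGrad α φ x‖ ≤ 1 * M * (C * ‖x‖ ^ (α - 1)) := by
              gcongr
              · exact hζ01 n x
              · exact hM x
              · exact hC2 x hx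
          _ ≤ K * ‖x‖ ^ (α - 1) := by
            rw [one_mul, ← mul_assoc]
            have : 0 ≤ M' * (C * R) + M * (2 * Cb * C) := by positivity
            gcongr
            linarith
    · filter_upwards [hne] with x hx
      refine tendsto_const_nhds.congr' ?_
      filter_upwards [hlim1 x hx] with n hn
      rw [(hfar n x hn).1, one_mul]
  have hL2 : Tendsto (fun n => ∫ x, fderiv ℝ (fun y => ζ n y * η y) x (‖x‖ ^ α • gradient φ x))
      atTop (𝓝 (∫ x, fderiv ℝ η x (‖x‖ ^ α • gradient φ x))) := by
    have hprod : ∀ n x v, fderiv ℝ (fun y => ζ n y * η y) x v =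
        ζ n x * fderiv ℝ η x v + η x * fderiv ℝ (ζ n) x v := by
      intro n x v
      rw [fderiv_fun_mul ((hζ n).differentiable (by simp)).differentiableAt
        (hη.1.differentiable (by simp)).differentiableAt]
      simp
    refine tendsto_integral_of_dominated_convergence _ (fun n => ?_) hint (fun n => ?_) ?_
    · exact hmf _ ((hζ n).mul hη.1)
    · filter_upwards [hne] with x hx
      rcases le_or_gt R ‖x‖ with h | h
      · rw [(hC3 x h).2.1]
        simp [not_lt.2 h]
      · have hx0 : 0 < ‖x‖ := norm_pos_iff.2 hx
        rw [indicator_of_mem (by simpa using h), hprod]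
        set v := ‖x‖ ^ α • gradient φ x with hv
        have hv1 : ‖v‖ ≤ C * (‖x‖ * ‖x‖ ^ (α - 1)) := by rw [← hpow x hx]; exact hF x hx
        have h1 : ‖ζ n x * fderiv ℝ η x v‖ ≤ M' * (C * R) * ‖x‖ ^ (α - 1) := by
          rw [norm_mul]
          calc ‖ζ n x‖ * ‖fderiv ℝ η x v‖ ≤ 1 * (M' * (C * (R * ‖x‖ ^ (α - 1)))) := by
                gcongr
                · exact hζ01 n x
                · refine (ContinuousLinearMap.le_opNorm _ v).trans ?_
                  gcongr
                  · exact hM' x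
                  · exact hv1.trans (by gcongr)
            _ = _ := by ring
        have h2 : ‖η x * fderiv ℝ (ζ n) x v‖ ≤ M * (2 * Cb * C) * ‖x‖ ^ (α - 1) := by
          rw [norm_mul]
          calc ‖η x‖ * ‖fderiv ℝ (ζ n) x v‖
              ≤ M * (2 * Cb * ‖x‖⁻¹ * (C * (‖x‖ * ‖x‖ ^ (α - 1)))) := by
                gcongr
                · exact hM x
                · exact (hζbound n x v hx).trans (by gcongr)
            _ = _ := by field_simp
        refine (norm_add_le _ _).trans ?_
        have : 0 ≤ M * C * ‖x‖ ^ (α - 1) := by positivity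
        simp only [hK]
        linarith
    · filter_upwards [hne] with x hx
      refine tendsto_const_nhds.congr' ?_
      filter_upwards [hlim1 x hx] with n hn
      rw [hprod, (hfar n x hn).1, (hfar n x hn).2]
      simp
  refine tendsto_nhds_unique hL ?_
  refine hL2.neg.congr fun n => ?_
  refine (integral_mul_divPowGrad_of_tsupport α (η := fun x => ζ n x * η x)
    ⟨(hζ n).mul hη.1, hη.2.mul_left⟩ ?_ hφ.1).symm
  intro x hx h0
  rw [mem_singleton_iff] at h0
  subst h0
  refine (notMem_tsupport_iff_eventuallyEq.2 ?_) hx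
  filter_upwards [hζ0 n] with y hy
  simp [hy]

/-! ### Radial test functions -/

/-- Smooth functions with compact support in the open half line `(0, ∞)`. -/
def IsHalfLineTest (h : ℝ → ℝ) : Prop :=
  ContDiff ℝ ∞ h ∧ HasCompactSupport h ∧ tsupport h ⊆ Ioi 0

theorem IsHalfLineTest.exists_bounds {h : ℝ → ℝ} (hh : IsHalfLineTest h) :
    ∃ d R : ℝ, 0 < d ∧ d < R ∧ (∀ r ≤ d, h r = 0) ∧ (∀ r, R ≤ r → h r = 0) := by
  rcases (tsupport h).eq_empty_or_nonempty with he | hne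
  · have h0 : ∀ r, h r = 0 := fun r => image_eq_zero_of_notMem_tsupport (by simp [he])
    exact ⟨1, 2, one_pos, one_lt_two, fun r _ => h0 r, fun r _ => h0 r⟩
  obtain ⟨a, ha, ha'⟩ := hh.2.1.isCompact.exists_isLeast hne
  obtain ⟨b, hb, hb'⟩ := hh.2.1.isCompact.exists_isGreatest hne
  have ha0 : 0 < a := hh.2.2 ha
  have hab : a ≤ b := ha' hb
  refine ⟨a / 2, b + 1, by linarith, by linarith, fun r hr => ?_, fun r hr => ?_⟩
  · exact image_eq_zero_of_notMem_tsupport fun h' => by linarith [ha' h']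
  · exact image_eq_zero_of_notMem_tsupport fun h' => by linarith [hb' h']

theorem IsHalfLineTest.mul {v h : ℝ → ℝ} (hv : ContDiffOn ℝ ∞ v (Ioi 0)) (hh : IsHalfLineTest h) :
    IsHalfLineTest fun r => v r * h r := by
  have hsub : tsupport (fun r => v r * h r) ⊆ tsupport h := tsupport_mul_subset_right
  refine ⟨contDiff_iff_contDiffAt.2 fun r => ?_, hh.2.1.mul_left, hsub.trans hh.2.2⟩
  rcases lt_or_ge 0 r with hr | hr
  · exact (hv.contDiffAt (Ioi_mem_nhds hr)).mul hh.1.contDiffAt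
  · have : r ∉ tsupport (fun r => v r * h r) := fun hr' => not_lt.2 hr (hh.2.2 (hsub hr'))
    exact contDiffAt_const.congr_of_eventuallyEq (notMem_tsupport_iff_eventuallyEq.1 this)

theorem contDiffOn_rpow_Ioi (γ : ℝ) : ContDiffOn ℝ ∞ (fun r : ℝ => r ^ γ) (Ioi 0) := fun _ hr =>
  (Real.contDiffAt_rpow_const_of_ne (ne_of_gt hr)).contDiffWithinAt

theorem IsHalfLineTest.deriv {h : ℝ → ℝ} (hh : IsHalfLineTest h) : IsHalfLineTest (deriv h) :=
  ⟨(contDiff_infty_iff_deriv.1 hh.1).2, hh.2.1.deriv, tsupport_deriv_subset.trans hh.2.2⟩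

theorem IsHalfLineTest.integrable {h : ℝ → ℝ} (hh : IsHalfLineTest h) : Integrable h :=
  hh.1.continuous.integrable_of_hasCompactSupport hh.2.1

theorem IsHalfLineTest.hasDerivAt {h : ℝ → ℝ} (hh : IsHalfLineTest h) (r : ℝ) :
    HasDerivAt h (_root_.deriv h r) r :=
  ((hh.1.differentiable (by simp)).differentiableAt).hasDerivAt

/-- The primitive `∫_r^∞ g` that vanishes at infinity. -/
noncomputable def tailIntegral (g : ℝ → ℝ) (r : ℝ) : ℝ := ∫ s in Ioi r, g s

theorem hasDerivAt_tailIntegral {g : ℝ → ℝ} (hg : IsHalfLineTest g) (r : ℝ) :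
    HasDerivAt (tailIntegral g) (-g r) r := by
  have h : tailIntegral g = fun r => (∫ s, g s) - ((∫ s in Iic (0 : ℝ), g s) + ∫ s in 0..r, g s) := by
    funext r
    have h1 := intervalIntegral.integral_Iic_add_Ioi (hg.integrable.integrableOn (s := Iic r))
      (hg.integrable.integrableOn (s := Ioi r))
    have h2 := intervalIntegral.integral_Iic_sub_Iic (hg.integrable.integrableOn (s := Iic 0))
      (hg.integrable.integrableOn (s := Iic r))
    rw [tailIntegral]
    linarith
  rw [h]
  exact ((intervalIntegral.integral_hasDerivAt_right (hg.integrable.intervalIntegrable)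
    (hg.1.continuous.stronglyMeasurableAtFilter _ _) hg.1.continuous.continuousAt).const_add
      _).const_sub _

theorem contDiff_tailIntegral {g : ℝ → ℝ} (hg : IsHalfLineTest g) :
    ContDiff ℝ ∞ (tailIntegral g) := by
  refine contDiff_infty_iff_deriv.2
    ⟨fun r => (hasDerivAt_tailIntegral hg r).differentiableAt, ?_⟩
  have : deriv (tailIntegral g) = fun r => -g r := funext fun r => (hasDerivAt_tailIntegral hg r).deriv
  rw [this]
  exact hg.1.neg

theorem tailIntegral_eq_zero {g : ℝ → ℝ} {R : ℝ} (hR : ∀ r, R ≤ r → g r = 0) {r : ℝ} (hr : R ≤ r) :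
    tailIntegral g r = 0 :=
  setIntegral_eq_zero_of_forall_eq_zero fun s hs => hR s (hr.trans (le_of_lt hs))

theorem tailIntegral_eq_of_le {g : ℝ → ℝ} (hg : IsHalfLineTest g) {d : ℝ}
    (hd : ∀ r ≤ d, g r = 0) {r : ℝ} (hr : r ≤ d) : tailIntegral g r = tailIntegral g d := by
  have h1 := intervalIntegral.integral_Ioi_sub_Ioi (hg.integrable.integrableOn (s := Ioi r)) hr
  have h2 : ∫ s in Ioc r d, g s = 0 := setIntegral_eq_zero_of_forall_eq_zero fun s hs => hd s hs.2
  rw [intervalIntegral.integral_of_le hr, h2] at h1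
  rw [tailIntegral, tailIntegral]
  linarith

/-- The radial test function with radial derivative `-g`. -/
noncomputable def radialTest {N : ℕ} (g : ℝ → ℝ) (x : EuclideanSpace ℝ (Fin N)) : ℝ :=
  tailIntegral g ‖x‖

theorem eventually_radialTest_eq {N : ℕ} {g : ℝ → ℝ} (hg : IsHalfLineTest g) :
    ∀ᶠ x : EuclideanSpace ℝ (Fin N) in 𝓝 0,
      radialTest g x = radialTest g (0 : EuclideanSpace ℝ (Fin N)) := by
  obtain ⟨d, R, hd, -, hgd, -⟩ := hg.exists_bounds
  filter_upwards [Metric.ball_mem_nhds (0 : EuclideanSpace ℝ (Fin N)) hd] with x hx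
  rw [radialTest, radialTest, tailIntegral_eq_of_le hg hgd (mem_ball_zero_iff.1 hx).le,
    tailIntegral_eq_of_le hg hgd (norm_zero.trans_le hd.le)]

theorem isTest_radialTest {N : ℕ} {g : ℝ → ℝ} (hg : IsHalfLineTest g) :
    IsTest (radialTest g : EuclideanSpace ℝ (Fin N) → ℝ) := by
  obtain ⟨d, R, hd, -, hgd, hgR⟩ := hg.exists_bounds
  refine ⟨contDiff_iff_contDiffAt.2 fun x => ?_, ?_⟩
  · rcases eq_or_ne x 0 with rfl | hx
    · exact contDiffAt_const.congr_of_eventuallyEq (eventually_radialTest_eq hg)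
    · exact (contDiff_tailIntegral hg).contDiffAt.comp x (contDiffAt_norm ℝ hx)
  · refine HasCompactSupport.intro (isCompact_closedBall 0 R) fun x hx => ?_
    rw [mem_closedBall_zero_iff, not_le] at hx
    exact tailIntegral_eq_zero hgR hx.le

/-- The weight in the radial derivative is chosen so that the operator becomes `-r ^ (1 - N) h'`. -/
theorem divPowGrad_radialTest {N : ℕ} (α : ℝ) {h : ℝ → ℝ} (hh : IsHalfLineTest h)
    {x : EuclideanSpace ℝ (Fin N)} (hx : x ≠ 0) :
    divPowGrad α (radialTest fun r => r ^ (-((N : ℝ) - 1 + α)) * h r) x =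
      -(‖x‖ ^ (1 - (N : ℝ)) * deriv h ‖x‖) := by
  have hg : IsHalfLineTest fun r => r ^ (-((N : ℝ) - 1 + α)) * h r :=
    hh.mul (contDiffOn_rpow_Ioi _)
  have hx0 : 0 < ‖x‖ := norm_pos_iff.2 hx
  have hfield : (fun y : EuclideanSpace ℝ (Fin N) => ‖y‖ ^ α •
      gradient (radialTest fun r => r ^ (-((N : ℝ) - 1 + α)) * h r) y) =ᶠ[𝓝 x]
      fun y => (-(‖y‖ ^ (-(N : ℝ)) * h ‖y‖)) • y := by
    filter_upwards [isOpen_compl_singleton.mem_nhds hx] with y hy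
    have hy0 : 0 < ‖y‖ := norm_pos_iff.2 hy
    have h1 : gradient (radialTest fun r => r ^ (-((N : ℝ) - 1 + α)) * h r) y = _ :=
      gradient_comp_norm hy (hasDerivAt_tailIntegral hg ‖y‖)
    rw [h1, smul_smul]
    congr 1
    have h2 : ‖y‖ ^ (-(N : ℝ)) = ‖y‖ ^ α * ‖y‖ ^ (-((N : ℝ) - 1 + α)) * ‖y‖⁻¹ := by
      rw [← Real.rpow_neg_one ‖y‖, ← Real.rpow_add hy0, ← Real.rpow_add hy0]
      ring_nf
    rw [h2]
    ring
  have hder : HasDerivAt (fun r : ℝ => -(r ^ (-(N : ℝ)) * h r)) _ ‖x‖ :=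
    (((Real.hasDerivAt_rpow_const (p := -(N : ℝ)) (Or.inl hx0.ne')).mul
      (hh.hasDerivAt ‖x‖)).neg)
  have hc := hasFDerivAt_comp_norm hx hder
  rw [divPowGrad, divergence_congr hfield, divergence_smul hc.differentiableAt differentiableAt_fun_id,
    divergence_id, hc.fderiv]
  simp only [smul_apply, innerSL_apply_apply, real_inner_self_eq_norm_sq,
    smul_eq_mul]
  have e1 : ‖x‖ ^ (1 - (N : ℝ)) = ‖x‖ ^ (-(N : ℝ)) * ‖x‖ := by
    rw [← Real.rpow_add_one hx0.ne']; ring_nf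
  have e2 : ‖x‖ ^ (-(N : ℝ) - 1) = ‖x‖ ^ (-(N : ℝ)) * ‖x‖⁻¹ := by
    rw [← Real.rpow_neg_one ‖x‖, ← Real.rpow_add hx0]; ring_nf
  rw [e1, e2]
  field_simp
  ring

/-! ### Integrals over balls -/

theorem continuous_integral_ball {N : ℕ} (hN : N ≠ 0) {w : EuclideanSpace ℝ (Fin N) → ℝ}
    (hw : ∀ R, IntegrableOn w (Metric.ball 0 R)) :
    Continuous fun R : ℝ => ∫ x in Metric.ball (0 : EuclideanSpace ℝ (Fin N)) R, w x := by
  have hnt := nontrivial_euclideanSpace hN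
  rw [continuous_iff_continuousAt]
  intro R
  simp_rw [← integral_indicator measurableSet_ball]
  refine continuousAt_of_dominated
    (bound := (Metric.ball (0 : EuclideanSpace ℝ (Fin N)) (R + 1)).indicator fun x => ‖w x‖)
    ?_ ?_ ?_ ?_
  · exact Eventually.of_forall fun s =>
      ((hw s).integrable_indicator measurableSet_ball).aestronglyMeasurable
  · filter_upwards [Iio_mem_nhds (lt_add_one R)] with s hs
    refine Eventually.of_forall fun x => ?_
    rw [norm_indicator_eq_indicator_norm]
    exact indicator_le_indicator_of_subset (Metric.ball_subset_ball (le_of_lt hs))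
      (fun _ => norm_nonneg _) x
  · exact IntegrableOn.integrable_indicator (hw (R + 1)).norm measurableSet_ball
  · have hs : ∀ᵐ x : EuclideanSpace ℝ (Fin N), x ∉ Metric.sphere (0 : EuclideanSpace ℝ (Fin N)) R :=
      measure_eq_zero_iff_ae_notMem.1 (Measure.addHaar_sphere volume 0 R)
    filter_upwards [hs] with x hx
    have hx' : ‖x‖ ≠ R := fun h => hx (by simp [h])
    rcases lt_or_gt_of_ne hx' with h | h
    · refine continuousAt_const.congr (f := fun _ => w x) ?_
      filter_upwards [Ioi_mem_nhds h] with s hs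
      rw [indicator_of_mem (by simpa using hs)]
    · refine continuousAt_const.congr (f := fun _ => 0) ?_
      filter_upwards [Iio_mem_nhds h] with s hs
      rw [indicator_of_notMem (by simpa using (le_of_lt hs))]

/-- By Fubini's theorem, pairing with a radial test function only involves the integrals over
balls. -/
theorem integral_mul_radialTest {N : ℕ} {w : EuclideanSpace ℝ (Fin N) → ℝ}
    (hw : ∀ R, IntegrableOn w (Metric.ball 0 R)) {g : ℝ → ℝ} (hg : IsHalfLineTest g) :
    ∫ x, w x * radialTest g x =
      ∫ r, g r * ∫ x in Metric.ball (0 : EuclideanSpace ℝ (Fin N)) r, w x := by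
  obtain ⟨d, R, hd, -, hgd, hgR⟩ := hg.exists_bounds
  set S : Set (EuclideanSpace ℝ (Fin N) × ℝ) := {z | ‖z.1‖ < z.2} with hS
  have hSm : MeasurableSet S := measurableSet_lt (measurable_norm.comp measurable_fst) measurable_snd
  have h1 : ∀ x : EuclideanSpace ℝ (Fin N), w x * radialTest g x =
      ∫ r, S.indicator (fun z => w z.1 * g z.2) (x, r) := by
    intro x
    rw [radialTest, tailIntegral, ← integral_const_mul, ← integral_indicator measurableSet_Ioi]
    rfl
  have h2 : ∀ r : ℝ, g r * ∫ x in Metric.ball (0 : EuclideanSpace ℝ (Fin N)) r, w x =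
      ∫ x, S.indicator (fun z => w z.1 * g z.2) (x, r) := by
    intro r
    rw [← integral_const_mul, ← integral_indicator measurableSet_ball]
    congr 1 with x
    simp [hS, indicator, mul_comm]
  simp_rw [h1, h2]
  refine integral_integral_swap ?_
  have hprod : Integrable (fun z : EuclideanSpace ℝ (Fin N) × ℝ =>
      (Metric.ball (0 : EuclideanSpace ℝ (Fin N)) R).indicator w z.1 * g z.2)
      (volume.prod volume) :=
    ((hw R).integrable_indicator measurableSet_ball).mul_prod hg.integrable
  refine (hprod.indicator hSm).congr (Eventually.of_forall fun z => ?_)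
  rcases z with ⟨x, r⟩
  simp only [Function.uncurry, indicator]
  by_cases hz : (x, r) ∈ S
  · rw [if_pos hz, if_pos hz]
    by_cases hxR : x ∈ Metric.ball (0 : EuclideanSpace ℝ (Fin N)) R
    · rw [if_pos hxR]
    · have h3 : ‖x‖ < r := hz
      have h4 : R ≤ ‖x‖ := by simpa using hxR
      rw [hgR r (h4.trans h3.le)]
      simp
  · rw [if_neg hz, if_neg hz]

/-! ### Weak derivatives on the half line -/

theorem IsHalfLineTest.eq_zero_of_nonpos {h : ℝ → ℝ} (hh : IsHalfLineTest h) {r : ℝ} (hr : r ≤ 0) :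
    h r = 0 :=
  image_eq_zero_of_notMem_tsupport fun h' => not_lt.2 hr (hh.2.2 h')

theorem isHalfLineTest_of_forall {h : ℝ → ℝ} (hh : ContDiff ℝ ∞ h) {d R : ℝ} (hd : 0 < d)
    (hle : ∀ r ≤ d, h r = 0) (hge : ∀ r, R ≤ r → h r = 0) : IsHalfLineTest h := by
  have hs : tsupport h ⊆ Icc d R := by
    refine closure_minimal (fun r hr => ?_) isClosed_Icc
    by_contra hcon
    rw [mem_Icc, not_and_or, not_le, not_le] at hcon
    exact hr (hcon.elim (fun h' => hle r h'.le) fun h' => hge r h'.le)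
  exact ⟨hh, isCompact_Icc.of_isClosed_subset (isClosed_tsupport _) hs,
    hs.trans fun r hr => hd.trans_le hr.1⟩

theorem IsHalfLineTest.sub_const_mul {h k : ℝ → ℝ} (hh : IsHalfLineTest h) (hk : IsHalfLineTest k)
    (c : ℝ) : IsHalfLineTest fun r => h r - c * k r := by
  obtain ⟨d, R, hd, -, h1, h2⟩ := hh.exists_bounds
  obtain ⟨d', R', hd', -, h1', h2'⟩ := hk.exists_bounds
  refine isHalfLineTest_of_forall (d := min d d') (R := max R R')
    (hh.1.sub (contDiff_const.mul hk.1)) (lt_min hd hd') (fun r hr => ?_) (fun r hr => ?_)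
  · rw [h1 r (hr.trans (min_le_left _ _)), h1' r (hr.trans (min_le_right _ _))]; simp
  · rw [h2 r ((le_max_left _ _).trans hr), h2' r ((le_max_right _ _).trans hr)]; simp

theorem IsHalfLineTest.exists_primitive {h : ℝ → ℝ} (hh : IsHalfLineTest h) (h0 : ∫ r, h r = 0) :
    ∃ H, IsHalfLineTest H ∧ _root_.deriv H = h := by
  obtain ⟨d, R, hd, hdR, h1, h2⟩ := hh.exists_bounds
  refine ⟨fun r => -tailIntegral h r, ?_, ?_⟩
  · refine isHalfLineTest_of_forall (R := R) (contDiff_tailIntegral hh).neg hd (fun r hr => ?_)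
      (fun r hr => by rw [tailIntegral_eq_zero h2 hr, neg_zero])
    have h3 := intervalIntegral.integral_Iic_add_Ioi (hh.integrable.integrableOn (s := Iic r))
      (hh.integrable.integrableOn (s := Ioi r))
    have h4 : ∫ s in Iic r, h s = 0 :=
      setIntegral_eq_zero_of_forall_eq_zero fun s hs => h1 s (le_trans hs hr)
    rw [tailIntegral]
    linarith
  · funext r
    simpa using (hasDerivAt_tailIntegral hh r).neg.deriv

theorem exists_isHalfLineTest_integral_eq_one : ∃ k, IsHalfLineTest k ∧ ∫ r, k r = 1 := by
  let b : ContDiffBump (2 : ℝ) := ⟨1 / 2, 1, by norm_num, by norm_num⟩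
  refine ⟨b.normed volume, ⟨b.contDiff_normed, b.hasCompactSupport_normed, ?_⟩, b.integral_normed⟩
  rw [b.tsupport_normed_eq]
  intro r hr
  rw [Real.closedBall_eq_Icc] at hr
  have : (2 : ℝ) - 1 ≤ r := hr.1
  exact mem_Ioi.2 (by linarith)

/-- The lemma of du Bois-Reymond: a linear functional on test functions of the half line that
vanishes on derivatives is a multiple of the integral. -/
theorem exists_eq_const_mul_integral (T : (ℝ → ℝ) → ℝ)
    (hT : ∀ h k, IsHalfLineTest h → IsHalfLineTest k → ∀ c : ℝ,
      T (fun r => h r - c * k r) = T h - c * T k)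
    (hT0 : ∀ h, IsHalfLineTest h → T (deriv h) = 0) :
    ∃ c, ∀ h, IsHalfLineTest h → T h = c * ∫ r, h r := by
  obtain ⟨k, hk, hk1⟩ := exists_isHalfLineTest_integral_eq_one
  refine ⟨T k, fun h hh => ?_⟩
  have h0 : ∫ r, (h r - (∫ s, h s) * k r) = 0 := by
    rw [integral_sub hh.integrable (hk.integrable.const_mul _), integral_const_mul, hk1]
    ring
  obtain ⟨H, hH, hH'⟩ := (hh.sub_const_mul hk (∫ s, h s)).exists_primitive h0
  have h1 := hT0 H hH
  rw [hH', hT h k hh hk] at h1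
  linarith

theorem IsHalfLineTest.integrable_mul {h F : ℝ → ℝ} (hh : IsHalfLineTest h)
    (hF : LocallyIntegrableOn F (Ioi 0)) : Integrable fun r => F r * h r := by
  have h1 : IntegrableOn F (tsupport h) := hF.integrableOn_compact_subset hh.2.2 hh.2.1.isCompact
  have h2 : IntegrableOn (fun r => F r * h r) (tsupport h) :=
    h1.mul_continuousOn hh.1.continuous.continuousOn hh.2.1.isCompact
  refine (integrableOn_iff_integrable_of_support_subset ?_).1 h2
  exact (Function.support_mul_subset_right _ _).trans (subset_tsupport h)

theorem locallyIntegrableOn_of_continuousOn {F : ℝ → ℝ} (hF : ContinuousOn F (Ioi 0)) :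
    LocallyIntegrableOn F (Ioi 0) :=
  hF.locallyIntegrableOn measurableSet_Ioi

theorem IsHalfLineTest.integral_mul_deriv {h G g : ℝ → ℝ} (hh : IsHalfLineTest h)
    (hG : ∀ r, 0 < r → HasDerivAt G (g r) r) (hg : ContinuousOn g (Ioi 0)) :
    ∫ r, G r * _root_.deriv h r = -∫ r, h r * g r := by
  have hGc : ContinuousOn G (Ioi 0) := fun r hr => (hG r hr).continuousAt.continuousWithinAt
  have e : (fun r => fderiv ℝ G r 1 * h r) = fun r => g r * h r := by
    funext r
    by_cases hr : r ∈ tsupport h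
    · rw [fderiv_apply_one_eq_deriv, (hG r (hh.2.2 hr)).deriv]
    · simp [image_eq_zero_of_notMem_tsupport hr]
  have key := integral_mul_fderiv_eq_neg_fderiv_mul_of_integrable (μ := volume) (f := G) (g := h)
    (v := (1 : ℝ)) (by rw [e]; exact hh.integrable_mul (locallyIntegrableOn_of_continuousOn hg))
    (by simpa using hh.deriv.integrable_mul (locallyIntegrableOn_of_continuousOn hGc))
    (hh.integrable_mul (locallyIntegrableOn_of_continuousOn hGc))
    (fun r hr => (hG r (hh.2.2 hr)).differentiableAt)
    (fun r _ => (hh.hasDerivAt r).differentiableAt)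
  rw [e] at key
  simpa [mul_comm] using key

theorem exists_hasDerivAt_of_continuousOn {g : ℝ → ℝ} (hg : ContinuousOn g (Ioi 0)) :
    ∃ G : ℝ → ℝ, ∀ r, 0 < r → HasDerivAt G (g r) r := by
  refine ⟨fun r => ∫ s in (1 : ℝ)..r, g s, fun r hr => ?_⟩
  refine intervalIntegral.integral_hasDerivAt_right ?_ ?_ (hg.continuousAt (Ioi_mem_nhds hr))
  · refine (hg.mono fun s hs => ?_).intervalIntegrable
    exact (lt_min one_pos hr).trans_le hs.1
  · exact hg.stronglyMeasurableAtFilter isOpen_Ioi r hr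

/-- A function with continuous weak derivative `g` on the half line has a classically
differentiable representative. -/
theorem exists_hasDerivAt_ae_eq {F g : ℝ → ℝ} (hF : LocallyIntegrableOn F (Ioi 0))
    (hg : ContinuousOn g (Ioi 0))
    (hw : ∀ h, IsHalfLineTest h → ∫ r, F r * deriv h r = -∫ r, h r * g r) :
    ∃ G : ℝ → ℝ, (∀ r, 0 < r → HasDerivAt G (g r) r) ∧ ∀ᵐ r, 0 < r → F r = G r := by
  obtain ⟨G, hG⟩ := exists_hasDerivAt_of_continuousOn hg
  have hGc : ContinuousOn G (Ioi 0) := fun r hr => (hG r hr).continuousAt.continuousWithinAt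
  have hGi := locallyIntegrableOn_of_continuousOn hGc
  obtain ⟨c, hc⟩ := exists_eq_const_mul_integral
    (fun h => (∫ r, F r * h r) - ∫ r, G r * h r)
    (fun h k hh hk c => by
      have e : ∀ F : ℝ → ℝ, LocallyIntegrableOn F (Ioi 0) →
          ∫ r, F r * (h r - c * k r) = (∫ r, F r * h r) - c * ∫ r, F r * k r := by
        intro F hF
        rw [← integral_const_mul, ← integral_sub (hh.integrable_mul hF)
          ((hk.integrable_mul hF).const_mul c)]
        congr 1 with r
        ring
      simp only
      rw [e F hF, e G hGi]
      ring)
    (fun h hh => by rw [hw h hh, hh.integral_mul_deriv hG hg]; ring)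
  refine ⟨fun r => G r + c, fun r hr => (hG r hr).add_const c, ?_⟩
  have hloc : LocallyIntegrableOn (fun r => F r - (G r + c)) (Ioi 0) :=
    hF.sub (locallyIntegrableOn_of_continuousOn (hGc.add continuousOn_const))
  have h0 := isOpen_Ioi.ae_eq_zero_of_integral_contDiff_smul_eq_zero hloc
    (fun h h1 h2 h3 => by
      have hh : IsHalfLineTest h := ⟨h1, h2, h3⟩
      have e : (fun r => h r • (F r - (G r + c))) = fun r => F r * h r - G r * h r - c * h r := by
        funext r; simp only [smul_eq_mul]; ring
      have hFh := hh.integrable_mul hF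
      have hGh := hh.integrable_mul hGi
      have hFG : Integrable fun r => F r * h r - G r * h r := hFh.sub hGh
      rw [e, integral_sub hFG (hh.integrable.const_mul c),
        integral_sub hFh hGh, integral_const_mul, hc h hh, sub_self])
  filter_upwards [h0] with r hr hr0
  linarith [hr hr0]

theorem hasDerivAt_of_weak {F g : ℝ → ℝ} (hF : ContinuousOn F (Ioi 0))
    (hg : ContinuousOn g (Ioi 0))
    (hw : ∀ h, IsHalfLineTest h → ∫ r, F r * deriv h r = -∫ r, h r * g r) :
    ∀ r, 0 < r → HasDerivAt F (g r) r := by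
  obtain ⟨G, hG, hGF⟩ := exists_hasDerivAt_ae_eq (locallyIntegrableOn_of_continuousOn hF) hg hw
  have hEq : EqOn F G (Ioi 0) :=
    Measure.eqOn_open_of_ae_eq (μ := volume) ((ae_restrict_iff' measurableSet_Ioi).2 hGF) isOpen_Ioi
      hF fun r hr => (hG r hr).continuousAt.continuousWithinAt
  intro r hr
  exact (hG r hr).congr_of_eventuallyEq (hEq.eventuallyEq_of_mem (Ioi_mem_nhds hr))

/-! ### Weighted Lebesgue spaces -/

theorem integrable_powMeasure_iff {N : ℕ} {γ : ℝ} {g : EuclideanSpace ℝ (Fin N) → ℝ} :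
    Integrable g (powMeasure N γ) ↔ Integrable fun x => ‖x‖ ^ γ * g x := by
  rw [powMeasure, integrable_withDensity_iff_integrable_smul'
    ((measurable_norm.pow_const γ).ennreal_ofReal) (by simp)]
  refine integrable_congr (Eventually.of_forall fun x => ?_)
  simp only [smul_eq_mul]
  rw [ENNReal.toReal_ofReal (by positivity)]

theorem integral_powMeasure {N : ℕ} {γ : ℝ} (g : EuclideanSpace ℝ (Fin N) → ℝ) :
    ∫ x, g x ∂powMeasure N γ = ∫ x, ‖x‖ ^ γ * g x := by
  rw [powMeasure, integral_withDensity_eq_integral_toReal_smul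
    ((measurable_norm.pow_const γ).ennreal_ofReal) (by simp)]
  congr 1 with x
  rw [smul_eq_mul, ENNReal.toReal_ofReal (by positivity)]

theorem ae_ne_zero {N : ℕ} (hN : N ≠ 0) : ∀ᵐ x : EuclideanSpace ℝ (Fin N), x ≠ 0 := by
  have := nontrivial_euclideanSpace hN
  simp [ae_iff]

theorem volume_absolutelyContinuous_powMeasure {N : ℕ} (hN : N ≠ 0) (γ : ℝ) :
    (volume : Measure (EuclideanSpace ℝ (Fin N))) ≪ powMeasure N γ := by
  refine withDensity_absolutelyContinuous'
    ((measurable_norm.pow_const γ).ennreal_ofReal).aemeasurable ?_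
  filter_upwards [ae_ne_zero hN] with x hx
  have : 0 < ‖x‖ := norm_pos_iff.2 hx
  rw [Ne, ENNReal.ofReal_eq_zero, not_le]
  positivity

theorem powMeasure_absolutelyContinuous_volume (N : ℕ) (γ : ℝ) :
    powMeasure N γ ≪ (volume : Measure (EuclideanSpace ℝ (Fin N))) :=
  withDensity_absolutelyContinuous _ _

theorem isLocallyFiniteMeasure_powMeasure {N : ℕ} (hN : N ≠ 0) {γ : ℝ} (hγ : -(N : ℝ) < γ) :
    IsLocallyFiniteMeasure (powMeasure N γ) := by
  refine ⟨fun x => ⟨Metric.ball 0 (‖x‖ + 1), Metric.isOpen_ball.mem_nhds (by simp), ?_⟩⟩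
  rw [powMeasure, withDensity_apply _ measurableSet_ball]
  exact (integrableOn_ball_norm_rpow hN hγ (‖x‖ + 1)).lintegral_lt_top

/-- Convergence in `L^p` gives convergence of the pairings with a fixed function in the dual
Lebesgue space. -/
theorem tendsto_integral_mul_of_eLpNorm {X : Type*} [MeasurableSpace X] {μ : Measure X}
    {p q : ENNReal} [ENNReal.HolderConjugate p q] {f : ℕ → X → ℝ} {F g : X → ℝ}
    (hf : ∀ n, AEStronglyMeasurable (f n) μ) (hF : MemLp F p μ) (hg : MemLp g q μ)
    (hlim : Tendsto (fun n => eLpNorm (fun x => f n x - F x) p μ) atTop (𝓝 0)) :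
    Tendsto (fun n => ∫ x, f n x * g x ∂μ) atTop (𝓝 (∫ x, F x * g x ∂μ)) := by
  have hFg : Integrable (fun x => F x * g x) μ := hF.integrable_mul hg
  have hm : ∀ n, AEStronglyMeasurable (fun x => f n x - F x) μ := fun n => (hf n).sub hF.1
  refine tendsto_integral_of_L1' _ hFg.1 ?_ ?_
  · filter_upwards [hlim.eventually_lt_const (by simp : (0 : ENNReal) < ⊤)] with n hn
    have h1 : Integrable (fun x => (f n x - F x) * g x) μ :=
      MemLp.integrable_mul (f := fun x => f n x - F x) ⟨hm n, hn⟩ hg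
    refine (h1.add hFg).congr (Eventually.of_forall fun x => ?_)
    simp only [Pi.add_apply]
    ring
  · have hle : ∀ n, eLpNorm ((fun x => f n x * g x) - fun x => F x * g x) 1 μ ≤
        eLpNorm (fun x => f n x - F x) p μ * eLpNorm g q μ := by
      intro n
      have e : ((fun x => f n x * g x) - fun x => F x * g x) =
          (fun x => f n x - F x) • g := by
        funext x
        simp only [Pi.sub_apply, Pi.smul_apply', smul_eq_mul]
        ring
      rw [e]
      exact eLpNorm_smul_le_mul_eLpNorm hg.1 (hm n)
    refine tendsto_of_tendsto_of_tendsto_of_le_of_le tendsto_const_nhds ?_ (fun _ => bot_le) hle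
    have := ENNReal.Tendsto.mul_const hlim (Or.inr hg.2.ne)
    simpa using this

theorem aestronglyMeasurable_of_memLp_powMeasure {N : ℕ} (hN : N ≠ 0) {γ : ℝ} {p : ENNReal}
    {f : EuclideanSpace ℝ (Fin N) → ℝ} (hf : MemLp f p (powMeasure N γ)) :
    AEStronglyMeasurable f volume :=
  hf.1.mono_ac (volume_absolutelyContinuous_powMeasure hN γ)

theorem integrable_rpow_of_memLp_powMeasure {N : ℕ} {γ p : ℝ} (hp : 0 < p)
    {f : EuclideanSpace ℝ (Fin N) → ℝ} (hf : MemLp f (ENNReal.ofReal p) (powMeasure N γ)) :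
    Integrable fun x => ‖x‖ ^ γ * |f x| ^ p := by
  have h := hf.integrable_norm_rpow (by simpa using hp) (by simp)
  rw [ENNReal.toReal_ofReal hp.le, integrable_powMeasure_iff] at h
  exact h

theorem integrableOn_ball_rpow_sub_two_mul {N : ℕ} (hN : N ≠ 0) {γ p : ℝ} (hp : 2 ≤ p)
    (hγ : -(N : ℝ) < γ) {f : EuclideanSpace ℝ (Fin N) → ℝ}
    (hf : MemLp f (ENNReal.ofReal p) (powMeasure N γ)) (R : ℝ) :
    IntegrableOn (fun x => ‖x‖ ^ γ * (|f x| ^ (p - 2) * f x)) (Metric.ball 0 R) := by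
  have h1 := integrable_rpow_of_memLp_powMeasure (by linarith) hf
  have hfm := (aestronglyMeasurable_of_memLp_powMeasure hN hf).aemeasurable
  refine Integrable.mono' ((integrableOn_ball_norm_rpow hN hγ R).add h1.integrableOn) ?_ ?_
  · refine AEMeasurable.aestronglyMeasurable (AEMeasurable.restrict ?_)
    have : Measurable fun x : EuclideanSpace ℝ (Fin N) => ‖x‖ ^ γ := measurable_norm.pow_const γ
    have h2 : AEMeasurable (fun x => |f x|) volume := hfm.norm
    exact this.aemeasurable.mul ((h2.pow_const _).mul hfm)
  · refine Eventually.of_forall fun x => ?_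
    rw [norm_mul, norm_mul, Real.norm_of_nonneg (by positivity),
      Real.norm_of_nonneg (by positivity), Real.norm_eq_abs]
    simp only [Pi.add_apply]
    have h3 : |f x| ^ (p - 2) * |f x| ≤ 1 + |f x| ^ p := by
      rcases le_total |f x| 1 with h | h
      · have h4 : |f x| ^ (p - 2) ≤ 1 := Real.rpow_le_one (abs_nonneg _) h (by linarith)
        have h5 : 0 ≤ |f x| ^ p := by positivity
        nlinarith [abs_nonneg (f x), Real.rpow_nonneg (abs_nonneg (f x)) (p - 2)]
      · rw [← Real.rpow_add_one (by linarith)]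
        have : |f x| ^ (p - 2 + 1) ≤ |f x| ^ p := Real.rpow_le_rpow_of_exponent_le h (by linarith)
        linarith
    have h6 : 0 ≤ ‖x‖ ^ γ := by positivity
    nlinarith

theorem abs_le_weighted_young {a A s : ℝ} (hA : 0 < A) (hs : 0 < s) :
    |a| ≤ s / 2 * (A⁻¹ * a ^ 2) + A / (2 * s) := by
  have h : s / 2 * (A⁻¹ * a ^ 2) + A / (2 * s) - |a| = (s * |a| - A) ^ 2 / (2 * s * A) := by
    rw [← sq_abs a]
    field_simp
    ring
  have : 0 ≤ (s * |a| - A) ^ 2 / (2 * s * A) := by positivity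
  linarith

theorem integrable_sq_of_memLp_powMeasure {N : ℕ} {γ : ℝ}
    {w : EuclideanSpace ℝ (Fin N) → ℝ} (hw : MemLp w 2 (powMeasure N γ)) :
    Integrable fun x => ‖x‖ ^ γ * w x ^ 2 :=
  integrable_powMeasure_iff.1 ((memLp_two_iff_integrable_sq hw.1).1 hw)

theorem integrableOn_ball_of_memLp_two {N : ℕ} (hN : N ≠ 0) {γ : ℝ} (hγ : -(N : ℝ) < γ)
    {w : EuclideanSpace ℝ (Fin N) → ℝ} (hw : MemLp w 2 (powMeasure N (-γ))) (R : ℝ) :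
    IntegrableOn w (Metric.ball 0 R) := by
  have h1 := integrable_sq_of_memLp_powMeasure hw
  refine Integrable.mono' ((h1.const_mul (1 / 2)).integrableOn.add
    ((integrableOn_ball_norm_rpow hN hγ R).div_const (2 * 1)))
    (aestronglyMeasurable_of_memLp_powMeasure hN hw).restrict ?_
  refine ae_restrict_of_ae ?_
  filter_upwards [ae_ne_zero hN] with x hx
  have hx0 : 0 < ‖x‖ := norm_pos_iff.2 hx
  have := abs_le_weighted_young (a := w x) (A := ‖x‖ ^ γ) (s := 1) (by positivity) one_pos
  rwa [← Real.rpow_neg hx0.le] at this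

/-- Integrals over small balls of a function in `L^2(|x|^(-γ))` are of lower order than the bound
given by the Cauchy–Schwarz inequality. -/
theorem eventually_abs_integral_ball_le {N : ℕ} (hN : N ≠ 0) {γ : ℝ} (hγ : -(N : ℝ) < γ)
    {w : EuclideanSpace ℝ (Fin N) → ℝ} (hw : MemLp w 2 (powMeasure N (-γ))) {ε : ℝ} (hε : 0 < ε) :
    ∀ᶠ R in 𝓝[>] (0 : ℝ), |∫ x in Metric.ball (0 : EuclideanSpace ℝ (Fin N)) R, w x| ≤
      ε * R ^ (((N : ℝ) + γ) / 2) := by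
  have hsq := integrable_sq_of_memLp_powMeasure hw
  have hA := sphereArea_pos hN
  have hNγ : 0 < (N : ℝ) + γ := by linarith
  set δ := ε * (N + γ) / sphereArea N with hδ
  have hδ0 : 0 < δ := by positivity
  have hE : ∀ᶠ R in 𝓝[>] (0 : ℝ),
      ∫ x in Metric.ball (0 : EuclideanSpace ℝ (Fin N)) R, ‖x‖ ^ (-γ) * w x ^ 2 < ε * δ := by
    have hc := (continuous_integral_ball hN fun R => hsq.integrableOn (s := Metric.ball 0 R)).tendsto 0
    rw [Metric.ball_zero, Measure.restrict_empty, integral_zero_measure] at hc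
    exact (hc.mono_left nhdsWithin_le_nhds).eventually_lt_const (by positivity)
  filter_upwards [hE, self_mem_nhdsWithin] with R hR hR0
  have hR0' : (0 : ℝ) < R := hR0
  set s := R ^ (((N : ℝ) + γ) / 2) / δ with hs
  have hs0 : 0 < s := by positivity
  have hint1 : IntegrableOn (fun x => s / 2 * (‖x‖ ^ (-γ) * w x ^ 2))
      (Metric.ball (0 : EuclideanSpace ℝ (Fin N)) R) := (hsq.const_mul _).integrableOn
  have hint2 : IntegrableOn (fun x : EuclideanSpace ℝ (Fin N) => ‖x‖ ^ γ / (2 * s))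
      (Metric.ball (0 : EuclideanSpace ℝ (Fin N)) R) :=
    (integrableOn_ball_norm_rpow hN hγ R).div_const _
  calc |∫ x in Metric.ball (0 : EuclideanSpace ℝ (Fin N)) R, w x|
      ≤ ∫ x in Metric.ball (0 : EuclideanSpace ℝ (Fin N)) R, |w x| :=
        abs_integral_le_integral_abs
    _ ≤ ∫ x in Metric.ball (0 : EuclideanSpace ℝ (Fin N)) R,
          (s / 2 * (‖x‖ ^ (-γ) * w x ^ 2) + ‖x‖ ^ γ / (2 * s)) := by
        refine integral_mono_ae (integrableOn_ball_of_memLp_two hN hγ hw R).norm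
          (hint1.add hint2) (ae_restrict_of_ae ?_)
        filter_upwards [ae_ne_zero hN] with x hx
        have hx0 : 0 < ‖x‖ := norm_pos_iff.2 hx
        have := abs_le_weighted_young (a := w x) (A := ‖x‖ ^ γ) (s := s) (by positivity) hs0
        rwa [← Real.rpow_neg hx0.le] at this
    _ = s / 2 * (∫ x in Metric.ball (0 : EuclideanSpace ℝ (Fin N)) R, ‖x‖ ^ (-γ) * w x ^ 2) +
          sphereArea N * (R ^ (N + γ) / (N + γ)) / (2 * s) := by
        rw [integral_add hint1 hint2, integral_const_mul, integral_div,
          integral_ball_norm_rpow hN hγ hR0']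
    _ ≤ s / 2 * (ε * δ) + sphereArea N * (R ^ (N + γ) / (N + γ)) / (2 * s) := by
        gcongr
    _ = ε * R ^ (((N : ℝ) + γ) / 2) := by
        have h2 : R ^ ((N : ℝ) + γ) = R ^ (((N : ℝ) + γ) / 2) * R ^ (((N : ℝ) + γ) / 2) := by
          rw [← Real.rpow_add hR0', add_halves]
        have h3 : 0 < R ^ (((N : ℝ) + γ) / 2) := by positivity
        rw [h2, hs, hδ]
        field_simp
        norm_num

/-- Null sets of radii give null sets of points. -/
theorem ae_comp_norm {N : ℕ} (hN : N ≠ 0) {q : ℝ → Prop} (hq : ∀ᵐ r : ℝ, 0 < r → q r) :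
    ∀ᵐ x : EuclideanSpace ℝ (Fin N), q ‖x‖ := by
  obtain ⟨T, hT, hTm, hT0⟩ := exists_measurable_superset_of_null (ae_iff.1 hq)
  have hz : ∀ᵐ r : ℝ, r ∉ T := measure_eq_zero_iff_ae_notMem.1 hT0
  have he : (fun r : ℝ => r ^ ((N : ℝ) - 1) * T.indicator (fun _ => (1 : ℝ)) r)
      =ᵐ[volume.restrict (Ioi 0)] fun _ => 0 := by
    refine ae_restrict_of_ae ?_
    filter_upwards [hz] with r hr
    simp [hr]
  have hint : Integrable fun x : EuclideanSpace ℝ (Fin N) => T.indicator (fun _ => (1 : ℝ)) ‖x‖ :=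
    (integrable_comp_norm hN).2 ((integrable_zero _ _ _).congr he.symm)
  have h0 : ∫ x : EuclideanSpace ℝ (Fin N), T.indicator (fun _ => (1 : ℝ)) ‖x‖ = 0 := by
    rw [integral_comp_norm hN, integral_congr_ae he]
    simp
  rw [integral_eq_zero_iff_of_nonneg (fun x => indicator_nonneg (fun _ _ => zero_le_one) _) hint]
    at h0
  filter_upwards [h0, ae_ne_zero hN] with x hx hx0
  by_contra hcon
  have hmem : ‖x‖ ∈ T := hT (by
    simp only [mem_ofPred_eq, Classical.not_imp]
    exact ⟨norm_pos_iff.2 hx0, hcon⟩)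
  simp [hmem] at hx

/-! ### Passing to the limit in the weak formulation -/

theorem critExp_eq {N : ℕ} {α β k t : ℝ} (hk0 : 0 < k) (hk : 2 * k = N - 4 + 2 * α - β)
    (ht : t = 2 + β - α) : critExp N α β = 2 + 2 * t / k := by
  rw [critExp, ← hk, show 2 * ((N : ℝ) + β) = 2 * (2 * k + 2 * t) by rw [hk, ht]; ring]
  field_simp

/-- The limit `w` in the definition of the space is `div (|x|^α ∇ u)` in the sense of
distributions, also when tested with functions that are constant near the origin. -/
theorem InD22.integral_mul_divPowGrad {N : ℕ} (hN : N ≠ 0) {α β : ℝ} (hα : 1 - (N : ℝ) < α)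
    (hβ : -(N : ℝ) < β) (hp : 1 < critExp N α β) {u w : EuclideanSpace ℝ (Fin N) → ℝ}
    (h : InD22 α β u w) {g : ℝ → ℝ} (hg : IsHalfLineTest g)
    (η : EuclideanSpace ℝ (Fin N) → ℝ)
    (hη : η = radialTest fun r => r ^ (-((N : ℝ) - 1 + α)) * g r) :
    ∫ x, u x * divPowGrad α η x = ∫ x, w x * η x := by
  obtain ⟨hu, hw, φ, hφ, hφu, hφw⟩ := h
  have hloc := isLocallyFiniteMeasure_powMeasure hN hβ
  have hg' : IsHalfLineTest fun r => r ^ (-((N : ℝ) - 1 + α)) * g r :=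
    hg.mul (contDiffOn_rpow_Ioi _)
  have hηt : IsTest η := hη ▸ isTest_radialTest hg'
  have hη0 : ∀ᶠ y in 𝓝 0, η y = η 0 := hη ▸ eventually_radialTest_eq hg'
  have hηd : ∀ x, x ≠ 0 → divPowGrad α η x = -(‖x‖ ^ (1 - (N : ℝ)) * deriv g ‖x‖) :=
    fun x hx => by rw [hη]; exact divPowGrad_radialTest α hg hx
  -- The first pairing, in the duality of `L^p` and `L^p'` for the measure `|x|^β dx`.
  have hG : IsHalfLineTest fun r => -r ^ (-β + (1 - (N : ℝ))) * deriv g r :=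
    hg.deriv.mul (contDiffOn_rpow_Ioi _).neg
  have hGe : ∀ x : EuclideanSpace ℝ (Fin N), x ≠ 0 →
      ‖x‖ ^ β * (-‖x‖ ^ (-β + (1 - (N : ℝ))) * deriv g ‖x‖) = divPowGrad α η x := by
    intro x hx
    have hx0 : 0 < ‖x‖ := norm_pos_iff.2 hx
    rw [hηd x hx, Real.rpow_add hx0, Real.rpow_neg hx0.le]
    field_simp
  have hGmem : MemLp (fun x : EuclideanSpace ℝ (Fin N) =>
      -‖x‖ ^ (-β + (1 - (N : ℝ))) * deriv g ‖x‖)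
      (ENNReal.ofReal (Real.conjExponent (critExp N α β))) (powMeasure N β) := by
    obtain ⟨d, R, hd, -, hd', hR'⟩ := hG.exists_bounds
    refine Continuous.memLp_of_hasCompactSupport (hG.1.continuous.comp continuous_norm) ?_
    refine HasCompactSupport.intro (isCompact_closedBall 0 R) fun x hx => ?_
    rw [mem_closedBall_zero_iff, not_le] at hx
    exact hR' ‖x‖ hx.le
  have hconj : ENNReal.HolderConjugate (ENNReal.ofReal (critExp N α β))
      (ENNReal.ofReal (Real.conjExponent (critExp N α β))) :=
    (Real.HolderConjugate.conjExponent hp).ennrealOfReal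
  have hφm : ∀ n γ, AEStronglyMeasurable (φ n) (powMeasure N γ) := fun n γ =>
    (hφ n).1.continuous.aestronglyMeasurable
  have h1 := tendsto_integral_mul_of_eLpNorm (fun n => hφm n β) hu hGmem hφu
  simp only [integral_powMeasure] at h1
  have e1 : ∀ v : EuclideanSpace ℝ (Fin N) → ℝ,
      ∫ x, ‖x‖ ^ β * (v x * (-‖x‖ ^ (-β + (1 - (N : ℝ))) * deriv g ‖x‖)) =
        ∫ x, v x * divPowGrad α η x := by
    intro v
    refine integral_congr_ae ?_
    filter_upwards [ae_ne_zero hN] with x hx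
    rw [← hGe x hx]
    ring
  simp only [e1] at h1
  -- The second pairing, in `L^2` for the measure `|x|^(-β) dx`.
  have hβm : Measurable fun x : EuclideanSpace ℝ (Fin N) => ‖x‖ ^ β := measurable_norm.pow_const β
  have hHm : AEStronglyMeasurable (fun x => ‖x‖ ^ β * η x) (powMeasure N (-β)) :=
    (hβm.mul hηt.1.continuous.measurable).aestronglyMeasurable
  have hHmem : MemLp (fun x => ‖x‖ ^ β * η x) 2 (powMeasure N (-β)) := by
    rw [memLp_two_iff_integrable_sq hHm, integrable_powMeasure_iff]
    have h2 : Integrable (fun x => η x * η x) (powMeasure N β) :=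
      (hηt.1.continuous.mul hηt.1.continuous).integrable_of_hasCompactSupport hηt.2.mul_right
    rw [integrable_powMeasure_iff] at h2
    refine h2.congr ?_
    filter_upwards [ae_ne_zero hN] with x hx
    have hx0 : 0 < ‖x‖ := norm_pos_iff.2 hx
    rw [Real.rpow_neg hx0.le]
    field_simp
  have hdm : ∀ n, AEStronglyMeasurable (divPowGrad α (φ n)) (powMeasure N (-β)) := fun n =>
    (aestronglyMeasurable_of_continuousOn_compl hN
      (continuousOn_divPowGrad α (hφ n).1)).mono_ac (powMeasure_absolutelyContinuous_volume N _)
  have h3 := tendsto_integral_mul_of_eLpNorm (q := 2) hdm hw hHmem hφw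
  simp only [integral_powMeasure] at h3
  have e2 : ∀ v : EuclideanSpace ℝ (Fin N) → ℝ,
      ∫ x, ‖x‖ ^ (-β) * (v x * (‖x‖ ^ β * η x)) = ∫ x, v x * η x := by
    intro v
    refine integral_congr_ae ?_
    filter_upwards [ae_ne_zero hN] with x hx
    have hx0 : 0 < ‖x‖ := norm_pos_iff.2 hx
    rw [Real.rpow_neg hx0.le]
    field_simp
  simp only [e2] at h3
  refine tendsto_nhds_unique h1 (h3.congr fun n => ?_)
  rw [← integral_mul_divPowGrad_comm hN hα hηt hη0 (hφ n)]
  congr 1 with x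
  ring

/-! ### From radial weak solutions to the radial system -/

theorem integral_mul_comp_norm_eq {N : ℕ} {w : EuclideanSpace ℝ (Fin N) → ℝ}
    (hw : ∀ R, IntegrableOn w (Metric.ball 0 R)) {h : ℝ → ℝ} (hh : IsHalfLineTest h) :
    ∫ x, w x * h ‖x‖ =
      -∫ r, deriv h r * ∫ x in Metric.ball (0 : EuclideanSpace ℝ (Fin N)) r, w x := by
  have hn : IsHalfLineTest fun r => (-1) * deriv h r :=
    hh.deriv.mul (v := fun _ => (-1 : ℝ)) contDiffOn_const
  have htail : ∀ r, tailIntegral (fun r => (-1) * deriv h r) r = h r := by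
    intro r
    have hlim : Tendsto h atTop (𝓝 0) := by
      obtain ⟨d, R, -, -, -, hR⟩ := hh.exists_bounds
      refine tendsto_const_nhds.congr' ?_
      filter_upwards [eventually_ge_atTop R] with s hs
      rw [hR s hs]
    have := integral_Ioi_of_hasDerivAt_of_tendsto' (a := r) (fun s _ => hh.hasDerivAt s)
      hh.deriv.integrable.integrableOn hlim
    rw [tailIntegral, integral_const_mul, this]
    ring
  have key := integral_mul_radialTest hw hn
  simp only [radialTest, htail] at key
  rw [key, ← integral_neg]
  congr 1 with r
  ring

theorem setIntegral_Ioi_eq {F : ℝ → ℝ} (hF : ∀ r ≤ 0, F r = 0) : ∫ r in Ioi (0 : ℝ), F r = ∫ r, F r := by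
  refine setIntegral_eq_integral_of_forall_compl_eq_zero fun r hr => hF r ?_
  simpa using hr

theorem integral_comp_norm_mul {N : ℕ} (hN : N ≠ 0) (F : ℝ → ℝ) {h : ℝ → ℝ}
    (hh : IsHalfLineTest h) (γ : ℝ) :
    ∫ x : EuclideanSpace ℝ (Fin N), F ‖x‖ * (‖x‖ ^ γ * h ‖x‖) =
      sphereArea N * ∫ r, F r * (r ^ ((N : ℝ) - 1 + γ) * h r) := by
  rw [integral_comp_norm hN (fun r => F r * (r ^ γ * h r)), ← setIntegral_Ioi_eq (F := fun r =>
    F r * (r ^ ((N : ℝ) - 1 + γ) * h r)) (fun r hr => by simp [hh.eq_zero_of_nonpos hr])]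
  congr 1
  refine setIntegral_congr_fun measurableSet_Ioi fun r hr => ?_
  rw [Real.rpow_add hr]
  ring

theorem locallyIntegrableOn_of_memLp {N : ℕ} (hN : N ≠ 0) {γ p : ℝ} (hp : 1 ≤ p)
    {u : EuclideanSpace ℝ (Fin N) → ℝ} (hu : MemLp u (ENNReal.ofReal p) (powMeasure N γ))
    {f : ℝ → ℝ} (hf : u =ᵐ[volume] fun x => f ‖x‖) : LocallyIntegrableOn f (Ioi 0) := by
  have key : ∀ a b : ℝ, 0 < a → IntegrableOn f (Ioo a b) := by
    intro a b ha
    have hum := aestronglyMeasurable_of_memLp_powMeasure hN hu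
    have hup := integrable_rpow_of_memLp_powMeasure (by linarith) hu
    obtain ⟨C, hC0, hC⟩ : ∃ C, 0 ≤ C ∧ ∀ r ∈ Ioo a b, r ^ (-γ) ≤ C := by
      obtain ⟨C, hC⟩ := (isCompact_Icc (a := a) (b := b)).exists_bound_of_continuousOn
        (f := fun r : ℝ => r ^ (-γ)) ((contDiffOn_rpow_Ioi (-γ)).continuousOn.mono
          fun r hr => ha.trans_le hr.1)
      exact ⟨max C 0, le_max_right _ _, fun r hr =>
        (le_abs_self _).trans ((hC r (Ioo_subset_Icc_self hr)).trans (le_max_left _ _))⟩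
    set A : Set (EuclideanSpace ℝ (Fin N)) := (fun x => ‖x‖) ⁻¹' Ioo a b with hA
    have hAm : MeasurableSet A := measurable_norm measurableSet_Ioo
    have hu1 : IntegrableOn u A := by
      have hAb : A ⊆ Metric.ball 0 b := fun x hx => mem_ball_zero_iff.2 hx.2
      have hfin : IntegrableOn (fun _ => (1 : ℝ)) A :=
        integrableOn_const (ne_top_of_le_ne_top measure_ball_lt_top.ne (measure_mono hAb))
      refine Integrable.mono' (hfin.add (hup.const_mul C).integrableOn) hum.restrict ?_
      refine (ae_restrict_iff' hAm).2 (Eventually.of_forall fun x hx => ?_)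
      have hx0 : 0 < ‖x‖ := ha.trans hx.1
      have h1 : 1 ≤ C * ‖x‖ ^ γ := by
        have := mul_le_mul_of_nonneg_right (hC ‖x‖ hx) (by positivity : 0 ≤ ‖x‖ ^ γ)
        rwa [← Real.rpow_add hx0, neg_add_cancel, Real.rpow_zero] at this
      have h2 : |u x| ≤ 1 + |u x| ^ p := by
        rcases le_total |u x| 1 with h | h
        · have : 0 ≤ |u x| ^ p := by positivity
          linarith
        · have := Real.rpow_le_rpow_of_exponent_le h hp
          rw [Real.rpow_one] at this
          linarith
      have h3 : 0 ≤ |u x| ^ p := by positivity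
      simp only [Pi.add_apply, Real.norm_eq_abs]
      nlinarith
    have hu2 : Integrable fun x : EuclideanSpace ℝ (Fin N) => (Ioo a b).indicator f ‖x‖ := by
      refine (hu1.integrable_indicator hAm).congr ?_
      filter_upwards [hf] with x hx
      by_cases h : ‖x‖ ∈ Ioo a b
      · rw [indicator_of_mem h, indicator_of_mem (show x ∈ A from h), hx]
      · rw [indicator_of_notMem h, indicator_of_notMem (show x ∉ A from h)]
    rw [integrable_comp_norm hN] at hu2
    have hu3 : IntegrableOn (fun r => r ^ ((N : ℝ) - 1) * f r) (Ioo a b) := by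
      refine (hu2.mono_set fun r hr => ha.trans hr.1).congr_fun (fun r hr => ?_) measurableSet_Ioo
      simp [indicator_of_mem hr]
    have hu4 : IntegrableOn (fun r => (r ^ ((N : ℝ) - 1) * f r) * r ^ (-((N : ℝ) - 1))) (Ioo a b) := by
      refine hu3.mul_continuousOn_of_subset ((contDiffOn_rpow_Ioi _).continuousOn.mono
        fun r hr => ha.trans_le hr.1) measurableSet_Ioo isCompact_Icc Ioo_subset_Icc_self
    refine hu4.congr_fun (fun r hr => ?_) measurableSet_Ioo
    have hr0 : 0 < r := ha.trans hr.1
    simp only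
    rw [Real.rpow_neg hr0.le]
    field_simp
  intro r hr
  have hr0 : (0 : ℝ) < r := hr
  exact ⟨Ioo (r / 2) (r + 1), mem_nhdsWithin_of_mem_nhds (Ioo_mem_nhds (by linarith) (by linarith)),
    key _ _ (by linarith)⟩

/-- A radial weak solution agrees almost everywhere with the profile of a solution of the radial
system. Tested with radial functions, the weak formulation only sees the integrals of `w` and of
`|x|^β |u|^(p-2) u` over balls; these are the fluxes `P` and `Q`. -/
theorem exists_radialSystem {N : ℕ} (hN : N ≠ 0) {α β k t : ℝ} (hk0 : 0 < k) (ht0 : 0 < t)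
    (hk : 2 * k = N - 4 + 2 * α - β) (ht : t = 2 + β - α)
    {u : EuclideanSpace ℝ (Fin N) → ℝ} (hu : IsSolution α β u) (hr : IsRadial u) :
    ∃ v W P Q : ℝ → ℝ, RadialSystem k t v W P Q ∧
      (∀ ε : ℝ, 0 < ε → ∀ᶠ r in 𝓝[>] (0 : ℝ), |P r| ≤ ε * r ^ (k + t)) ∧
      (∀ᵐ x, u x = v ‖x‖) ∧
      IntegrableOn (fun r => r ^ (2 * k + 2 * t - 1) * |v r| ^ (2 + 2 * t / k)) (Ioi 0) := by
  obtain ⟨w, hD, hweak⟩ := hu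
  obtain ⟨f, hf⟩ := hr
  have hp := critExp_eq hk0 hk ht
  have hβ : -(N : ℝ) < β := by linarith
  have ha : (N : ℝ) - 1 + α = 2 * k + t + 1 := by rw [hk, ht]; ring
  have hb : (N : ℝ) - 1 + β = 2 * k + 2 * t - 1 := by rw [hk, ht]; ring
  have htk : 0 < 2 * t / k := by positivity
  have hp2 : 2 ≤ critExp N α β := by rw [hp]; linarith
  have hκ := sphereArea_pos hN
  set κ := sphereArea N with hκdef
  have huL := hD.1
  have hwL := hD.2.1
  have hwb := integrableOn_ball_of_memLp_two hN hβ hwL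
  have hFb := integrableOn_ball_rpow_sub_two_mul hN hp2 hβ huL
  have hfloc := locallyIntegrableOn_of_memLp hN (by linarith) huL hf
  set P : ℝ → ℝ := fun r => (∫ x in Metric.ball (0 : EuclideanSpace ℝ (Fin N)) r, w x) / κ with hP
  set Q : ℝ → ℝ := fun r => (∫ x in Metric.ball (0 : EuclideanSpace ℝ (Fin N)) r,
    ‖x‖ ^ β * (|u x| ^ (critExp N α β - 2) * u x)) / κ with hQ
  have hPc : Continuous P := (continuous_integral_ball hN hwb).div_const κ
  have hQc : Continuous Q := (continuous_integral_ball hN hFb).div_const κ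
  have hP0 : Tendsto P (𝓝[>] 0) (𝓝 0) := by
    have := (hPc.tendsto 0).mono_left (nhdsWithin_le_nhds (s := Ioi 0))
    simpa [hP] using this
  have hQ0 : Tendsto Q (𝓝[>] 0) (𝓝 0) := by
    have := (hQc.tendsto 0).mono_left (nhdsWithin_le_nhds (s := Ioi 0))
    simpa [hQ] using this
  have hrpowc : ∀ γ : ℝ, ContinuousOn (fun r : ℝ => r ^ γ) (Ioi 0) := fun γ =>
    (contDiffOn_rpow_Ioi γ).continuousOn
  -- The weak equation for `u`, in polar coordinates.
  have hweak_u : ∀ h, IsHalfLineTest h →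
      ∫ r, f r * deriv h r = -∫ r, h r * (r ^ (-(2 * k + t + 1)) * P r) := by
    intro h hh
    have hg := hh.mul (contDiffOn_rpow_Ioi (-((N : ℝ) - 1 + α)))
    have h1 := hD.integral_mul_divPowGrad hN (by linarith) hβ (by linarith) hh _ rfl
    rw [integral_mul_radialTest hwb hg] at h1
    have h2 : ∫ x, u x * divPowGrad α (radialTest fun r => r ^ (-((N : ℝ) - 1 + α)) * h r) x =
        -(κ * ∫ r, f r * deriv h r) := by
      have h3 := integral_comp_norm_mul hN f hh.deriv (1 - (N : ℝ))
      have h4 : ∀ r : ℝ, r ^ ((N : ℝ) - 1 + (1 - (N : ℝ))) = 1 := fun r => by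
        rw [show (N : ℝ) - 1 + (1 - (N : ℝ)) = 0 by ring, Real.rpow_zero]
      simp only [h4, one_mul] at h3
      rw [← h3, ← integral_neg]
      refine integral_congr_ae ?_
      filter_upwards [ae_ne_zero hN, hf] with x hx hfx
      rw [divPowGrad_radialTest α hh hx, hfx]
      ring
    have h5 : ∫ r, r ^ (-((N : ℝ) - 1 + α)) * h r *
        (∫ x in Metric.ball (0 : EuclideanSpace ℝ (Fin N)) r, w x) =
        κ * ∫ r, h r * (r ^ (-(2 * k + t + 1)) * P r) := by
      rw [← integral_const_mul]
      congr 1 with r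
      rw [ha]
      simp only [hP]
      field_simp
    rw [h2, h5] at h1
    exact mul_left_cancel₀ hκ.ne' (by linarith)
  obtain ⟨v, hv, hfv⟩ := exists_hasDerivAt_ae_eq hfloc
    ((hrpowc (-(2 * k + t + 1))).mul hPc.continuousOn) hweak_u
  have huv : ∀ᵐ x, u x = v ‖x‖ := by
    filter_upwards [hf, ae_comp_norm hN hfv] with x h1 h2
    rw [h1, h2]
  have hvc : ContinuousOn v (Ioi 0) := fun r hr => (hv r hr).continuousAt.continuousWithinAt
  -- The weak equation for `w` determines its radial averages up to a constant.
  obtain ⟨W₀, hW₀⟩ : ∃ W₀ : ℝ → ℝ, ∀ r, 0 < r →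
      HasDerivAt W₀ (r ^ (-(2 * k + t + 1)) * Q r) r := exists_hasDerivAt_of_continuousOn
    ((hrpowc (-(2 * k + t + 1))).mul hQc.continuousOn)
  have hW₀c : ContinuousOn W₀ (Ioi 0) := fun r hr => (hW₀ r hr).continuousAt.continuousWithinAt
  have hwint : ∀ h : ℝ → ℝ, IsHalfLineTest h → Integrable fun x => w x * h ‖x‖ := by
    intro h hh
    obtain ⟨d, R, hd, hdR, h1, h2⟩ := hh.exists_bounds
    obtain ⟨C, hC⟩ := hh.2.1.exists_bound_of_continuous hh.1.continuous
    have h3 : IntegrableOn (fun x => w x * h ‖x‖) (Metric.ball 0 R) :=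
      (hwb R).mul_bdd (c := C) ((hh.1.continuous.comp continuous_norm).aestronglyMeasurable)
        (Eventually.of_forall fun x => hC ‖x‖)
    refine (integrableOn_iff_integrable_of_support_subset fun x hx => ?_).1 h3
    rw [mem_ball_zero_iff]
    by_contra hcon
    exact hx (by simp [h2 ‖x‖ (not_lt.1 hcon)])
  have hbw : ∀ h, IsHalfLineTest h →
      IsHalfLineTest fun r => r ^ (-(2 * k + 2 * t - 1)) * h r := fun h hh =>
    hh.mul (contDiffOn_rpow_Ioi _)
  obtain ⟨c, hc⟩ := exists_eq_const_mul_integral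
    (fun h => (∫ x, w x * (‖x‖ ^ (-(2 * k + 2 * t - 1)) * h ‖x‖)) - κ * ∫ r, W₀ r * h r)
    (fun h g hh hg c => by
      have e1 : ∫ x, w x * (‖x‖ ^ (-(2 * k + 2 * t - 1)) * (h ‖x‖ - c * g ‖x‖)) =
          (∫ x, w x * (‖x‖ ^ (-(2 * k + 2 * t - 1)) * h ‖x‖)) -
            c * ∫ x, w x * (‖x‖ ^ (-(2 * k + 2 * t - 1)) * g ‖x‖) := by
        rw [← integral_const_mul, ← integral_sub (hwint _ (hbw h hh))
          ((hwint _ (hbw g hg)).const_mul c)]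
        congr 1 with x
        ring
      have e2 : ∫ r, W₀ r * (h r - c * g r) = (∫ r, W₀ r * h r) - c * ∫ r, W₀ r * g r := by
        rw [← integral_const_mul, ← integral_sub
          (hh.integrable_mul (locallyIntegrableOn_of_continuousOn hW₀c))
          ((hg.integrable_mul (locallyIntegrableOn_of_continuousOn hW₀c)).const_mul c)]
        congr 1 with r
        ring
      simp only [e1, e2]
      ring)
    (fun h hh => by
      have hg := hh.mul (contDiffOn_rpow_Ioi (-((N : ℝ) - 1 + α)))
      have h1 := hweak _ (isTest_radialTest hg)
      rw [integral_mul_radialTest hFb hg] at h1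
      have h2 : ∫ x, ‖x‖ ^ (-β) * w x *
          divPowGrad α (radialTest fun r => r ^ (-((N : ℝ) - 1 + α)) * h r) x =
          -∫ x, w x * (‖x‖ ^ (-(2 * k + 2 * t - 1)) * deriv h ‖x‖) := by
        rw [← integral_neg]
        refine integral_congr_ae ?_
        filter_upwards [ae_ne_zero hN] with x hx
        rw [divPowGrad_radialTest α hh hx, ← hb, show -((N : ℝ) - 1 + β) = -β + (1 - N) by ring,
          Real.rpow_add (norm_pos_iff.2 hx)]
        ring
      have h5 : ∫ r, r ^ (-((N : ℝ) - 1 + α)) * h r *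
          (∫ x in Metric.ball (0 : EuclideanSpace ℝ (Fin N)) r,
            ‖x‖ ^ β * (|u x| ^ (critExp N α β - 2) * u x)) =
          κ * ∫ r, h r * (r ^ (-(2 * k + t + 1)) * Q r) := by
        rw [← integral_const_mul]
        congr 1 with r
        rw [ha]
        simp only [hQ]
        field_simp
      rw [h2, h5] at h1
      rw [hh.integral_mul_deriv hW₀ ((hrpowc (-(2 * k + t + 1))).mul hQc.continuousOn)]
      linarith)
  set W : ℝ → ℝ := fun r => W₀ r + c / κ with hW
  have hWd : ∀ r, 0 < r → HasDerivAt W (r ^ (-(2 * k + t + 1)) * Q r) r := fun r hr =>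
    (hW₀ r hr).add_const _
  have hWc : ContinuousOn W (Ioi 0) := fun r hr => (hWd r hr).continuousAt.continuousWithinAt
  have hwW : ∀ h, IsHalfLineTest h →
      ∫ x, w x * (‖x‖ ^ (-(2 * k + 2 * t - 1)) * h ‖x‖) = κ * ∫ r, W r * h r := by
    intro h hh
    have h1 := hc h hh
    have h2 : ∫ r, W r * h r = (∫ r, W₀ r * h r) + c / κ * ∫ r, h r := by
      rw [← integral_const_mul, ← integral_add
        (hh.integrable_mul (locallyIntegrableOn_of_continuousOn hW₀c))
        (hh.integrable.const_mul _)]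
      congr 1 with r
      simp only [hW]
      ring
    rw [h2, mul_add, ← mul_assoc, mul_div_cancel₀ _ hκ.ne']
    linarith
  have hPd : ∀ r, 0 < r → HasDerivAt P (r ^ (2 * k + 2 * t - 1) * W r) r := by
    refine hasDerivAt_of_weak hPc.continuousOn ((hrpowc _).mul hWc) fun h hh => ?_
    have h1 := hwW _ (hh.mul (contDiffOn_rpow_Ioi (2 * k + 2 * t - 1)))
    have h2 : ∫ x, w x * (‖x‖ ^ (-(2 * k + 2 * t - 1)) * (‖x‖ ^ (2 * k + 2 * t - 1) * h ‖x‖)) =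
        ∫ x, w x * h ‖x‖ := by
      refine integral_congr_ae ?_
      filter_upwards [ae_ne_zero hN] with x hx
      rw [← mul_assoc (‖x‖ ^ _), ← Real.rpow_add (norm_pos_iff.2 hx), neg_add_cancel,
        Real.rpow_zero, one_mul]
    rw [h2, integral_mul_comp_norm_eq hwb hh] at h1
    have h3 : ∫ r, deriv h r * (∫ x in Metric.ball (0 : EuclideanSpace ℝ (Fin N)) r, w x) =
        κ * ∫ r, P r * deriv h r := by
      rw [← integral_const_mul]
      congr 1 with r
      simp only [hP]
      field_simp
    have h4 : ∫ r, W r * (r ^ (2 * k + 2 * t - 1) * h r) =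
        ∫ r, h r * (r ^ (2 * k + 2 * t - 1) * W r) := by
      congr 1 with r
      ring
    rw [h3, h4] at h1
    exact mul_left_cancel₀ hκ.ne' (by linarith)
  have hQd : ∀ r, 0 < r →
      HasDerivAt Q (r ^ (2 * k + 2 * t - 1) * (|v r| ^ (2 * t / k) * v r)) r := by
    refine hasDerivAt_of_weak hQc.continuousOn ((hrpowc _).mul ?_) fun h hh => ?_
    · exact (hvc.abs.rpow_const fun r _ => Or.inr htk.le).mul hvc
    have h1 := integral_mul_comp_norm_eq hFb hh
    have h2 := integral_comp_norm_mul hN (fun r => |v r| ^ (2 * t / k) * v r) hh β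
    have h3 : ∫ x, ‖x‖ ^ β * (|u x| ^ (critExp N α β - 2) * u x) * h ‖x‖ =
        ∫ x : EuclideanSpace ℝ (Fin N),
          |v ‖x‖| ^ (2 * t / k) * v ‖x‖ * (‖x‖ ^ β * h ‖x‖) := by
      refine integral_congr_ae ?_
      filter_upwards [huv] with x hx
      rw [hx, hp, add_sub_cancel_left]
      ring
    have h4 : ∫ r, deriv h r * (∫ x in Metric.ball (0 : EuclideanSpace ℝ (Fin N)) r,
        ‖x‖ ^ β * (|u x| ^ (critExp N α β - 2) * u x)) = κ * ∫ r, Q r * deriv h r := by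
      rw [← integral_const_mul]
      congr 1 with r
      simp only [hQ]
      field_simp
    have h5 : ∫ r, |v r| ^ (2 * t / k) * v r * (r ^ (2 * k + 2 * t - 1) * h r) =
        ∫ r, h r * (r ^ (2 * k + 2 * t - 1) * (|v r| ^ (2 * t / k) * v r)) := by
      congr 1 with r
      ring
    rw [h4, h3, h2, hb, h5] at h1
    exact mul_left_cancel₀ hκ.ne' (by linarith)
  refine ⟨v, W, P, Q, ⟨hv, hPd, hWd, hQd, hP0, hQ0⟩, fun ε hε => ?_, huv, ?_⟩
  · filter_upwards [eventually_abs_integral_ball_le hN hβ hwL (mul_pos hε hκ)] with r hr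
    rw [show ((N : ℝ) + β) / 2 = k + t by linarith] at hr
    simp only [hP]
    rw [abs_div, abs_of_pos hκ, div_le_iff₀ hκ]
    linarith
  · have h1 := integrable_rpow_of_memLp_powMeasure (by linarith) huL
    have h2 : Integrable fun x : EuclideanSpace ℝ (Fin N) =>
        ‖x‖ ^ β * |v ‖x‖| ^ (critExp N α β) := by
      refine h1.congr ?_
      filter_upwards [huv] with x hx
      rw [hx]
    rw [integrable_comp_norm hN (f := fun r => r ^ β * |v r| ^ (critExp N α β))] at h2
    refine h2.congr_fun (fun r hr => ?_) measurableSet_Ioi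
    simp only
    rw [← mul_assoc, ← Real.rpow_add hr, hb, hp]

/-! ### Approximation of decreasing radial profiles by test functions -/

/-- Cut-off functions on the half line, at logarithmic scale: they equal `1` on
`[exp (-(n + 1)), exp (n + 1)]` and the size of `r * χ'` tends to zero. -/
theorem exists_cutoff : ∃ (χ : ℕ → ℝ → ℝ) (M : ℝ), (∀ n, IsHalfLineTest (χ n)) ∧
    (∀ n r, 0 ≤ χ n r ∧ χ n r ≤ 1) ∧ (∀ r, 0 < r → ∀ᶠ n in atTop, χ n r = 1) ∧ 0 ≤ M ∧
    (∀ n r, 0 < r → |deriv (χ n) r| ≤ M * r⁻¹ / (n + 1)) := by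
  let θ : ContDiffBump (0 : ℝ) := ⟨1, 2, one_pos, one_lt_two⟩
  have hθ : ContDiff ℝ ∞ θ := θ.contDiff
  have hθ0 : ∀ y : ℝ, 2 ≤ |y| → θ y = 0 := fun y hy =>
    θ.zero_of_le_dist (by simpa [Real.dist_eq] using hy)
  have hθ1 : ∀ y : ℝ, |y| ≤ 1 → θ y = 1 := fun y hy =>
    θ.one_of_mem_closedBall (by simpa [Real.dist_eq] using hy)
  obtain ⟨M, hM⟩ : ∃ C, ∀ y, ‖deriv θ y‖ ≤ C :=
    (θ.hasCompactSupport.deriv).exists_bound_of_continuous (hθ.continuous_deriv (by simp))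
  have hM0 : 0 ≤ M := (norm_nonneg _).trans (hM 0)
  let χ : ℕ → ℝ → ℝ := fun n r => if 0 < r then θ (Real.log r / (n + 1)) else 0
  have hpos : ∀ n : ℕ, (0 : ℝ) < n + 1 := fun n => by positivity
  have hle : ∀ (n : ℕ) (r : ℝ), r ≤ Real.exp (-(2 * (n + 1))) → χ n r = 0 := by
    intro n r hr
    by_cases h : 0 < r
    · simp only [χ, if_pos h]
      refine hθ0 _ ?_
      have h1 : Real.log r ≤ -(2 * (n + 1)) := (Real.log_le_iff_le_exp h).2 hr
      rw [abs_div, abs_of_pos (hpos n), le_div_iff₀ (hpos n), abs_of_nonpos (by linarith [hpos n])]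
      linarith
    · simp only [χ, if_neg h]
  have hge : ∀ (n : ℕ) (r : ℝ), Real.exp (2 * (n + 1)) ≤ r → χ n r = 0 := by
    intro n r hr
    have h : 0 < r := (Real.exp_pos _).trans_le hr
    simp only [χ, if_pos h]
    refine hθ0 _ ?_
    have h1 : 2 * ((n : ℝ) + 1) ≤ Real.log r := (Real.le_log_iff_exp_le h).2 hr
    rw [abs_div, abs_of_pos (hpos n), le_div_iff₀ (hpos n), abs_of_nonneg (by linarith [hpos n])]
    linarith
  have heq : ∀ n r, 0 < r → χ n =ᶠ[𝓝 r] fun r => θ (Real.log r / (n + 1)) := by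
    intro n r hr
    filter_upwards [Ioi_mem_nhds hr] with s hs
    have : 0 < s := hs
    simp only [χ, if_pos this]
  have hsmooth : ∀ n, ContDiff ℝ ∞ (χ n) := by
    refine fun n => contDiff_iff_contDiffAt.2 fun r => ?_
    by_cases hr : 0 < r
    · refine ContDiffAt.congr_of_eventuallyEq ?_ (heq n r hr)
      exact hθ.contDiffAt.comp r ((Real.contDiffAt_log.2 hr.ne').div_const _)
    · refine contDiffAt_const.congr_of_eventuallyEq (f := fun _ => (0 : ℝ)) ?_
      have : r < Real.exp (-(2 * ((n : ℝ) + 1))) := (not_lt.1 hr).trans_lt (Real.exp_pos _)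
      filter_upwards [Iio_mem_nhds this] with s hs
      exact hle n s (le_of_lt hs)
  refine ⟨χ, M, fun n => isHalfLineTest_of_forall (hsmooth n) (Real.exp_pos _) (hle n) (hge n),
    fun n r => ?_, fun r hr => ?_, hM0, fun n r hr => ?_⟩
  · by_cases h : 0 < r
    · simp only [χ, if_pos h]; exact ⟨θ.nonneg, θ.le_one⟩
    · simp only [χ, if_neg h]; exact ⟨le_rfl, zero_le_one⟩
  · filter_upwards [tendsto_natCast_atTop_atTop.eventually_ge_atTop |Real.log r|] with n hn
    simp only [χ, if_pos hr]
    refine hθ1 _ ?_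
    rw [abs_div, abs_of_pos (hpos n), div_le_one (hpos n)]
    linarith
  · have h1 : HasDerivAt (fun r => θ (Real.log r / (n + 1)))
        (deriv θ (Real.log r / (n + 1)) * (r⁻¹ / (n + 1))) r :=
      HasDerivAt.comp (h₂ := fun y => θ y) r ((hθ.differentiable (by simp)).differentiableAt).hasDerivAt
        ((Real.hasDerivAt_log hr.ne').div_const _)
    rw [(heq n r hr).deriv_eq, h1.deriv, abs_mul, abs_of_nonneg (by positivity : 0 ≤ r⁻¹ / ((n : ℝ) + 1)),
      mul_div_assoc]
    have := hpos n
    gcongr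
    exact hM _

/-- A nonincreasing radial profile `v` vanishing at infinity with flux `F = r ^ a * v'` and
`F' = r ^ b * L`. -/
structure DecreasingProfile (a b : ℝ) (v F L : ℝ → ℝ) : Prop where
  contDiffOn_F : ContDiffOn ℝ ∞ F (Ioi 0)
  deriv_v : ∀ r, 0 < r → HasDerivAt v (r ^ (-a) * F r) r
  deriv_F : ∀ r, 0 < r → HasDerivAt F (r ^ b * L r) r
  F_nonpos : ∀ r, 0 < r → F r ≤ 0
  tendsto_atTop : Tendsto v atTop (𝓝 0)

theorem DecreasingProfile.const_mul {a b c : ℝ} {v F L : ℝ → ℝ} (h : DecreasingProfile a b v F L)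
    (hc : 0 ≤ c) :
    DecreasingProfile a b (fun r => c * v r) (fun r => c * F r) (fun r => c * L r) where
  contDiffOn_F := contDiffOn_const.mul h.contDiffOn_F
  deriv_v r hr := ((h.deriv_v r hr).const_mul c).congr_deriv (by ring)
  deriv_F r hr := ((h.deriv_F r hr).const_mul c).congr_deriv (by ring)
  F_nonpos r hr := mul_nonpos_of_nonneg_of_nonpos hc (h.F_nonpos r hr)
  tendsto_atTop := by simpa using h.tendsto_atTop.const_mul c

theorem DecreasingProfile.add {a b : ℝ} {v F L v' F' L' : ℝ → ℝ} (h : DecreasingProfile a b v F L)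
    (h' : DecreasingProfile a b v' F' L') :
    DecreasingProfile a b (fun r => v r + v' r) (fun r => F r + F' r) (fun r => L r + L' r) where
  contDiffOn_F := h.contDiffOn_F.add h'.contDiffOn_F
  deriv_v r hr := ((h.deriv_v r hr).add (h'.deriv_v r hr)).congr_deriv (by ring)
  deriv_F r hr := ((h.deriv_F r hr).add (h'.deriv_F r hr)).congr_deriv (by ring)
  F_nonpos r hr := add_nonpos (h.F_nonpos r hr) (h'.F_nonpos r hr)
  tendsto_atTop := by simpa using h.tendsto_atTop.add h'.tendsto_atTop

/-- Cutting off the derivative of a decreasing profile, rather than the profile itself, gives test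
functions that are constant near the origin and lie below the profile. -/
theorem DecreasingProfile.exists_approx {N : ℕ} {α β : ℝ} {v F L : ℝ → ℝ}
    (h : DecreasingProfile ((N : ℝ) - 1 + α) ((N : ℝ) - 1 + β) v F L) :
    ∃ (η : ℕ → EuclideanSpace ℝ (Fin N) → ℝ) (C : ℝ), (∀ n, IsTest (η n)) ∧
      (∀ n, ∀ᶠ y in 𝓝 0, η n y = η n 0) ∧
      (∀ n x, x ≠ 0 → 0 ≤ η n x ∧ η n x ≤ v ‖x‖) ∧
      (∀ x, x ≠ 0 → Tendsto (fun n => η n x) atTop (𝓝 (v ‖x‖))) ∧ 0 ≤ C ∧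
      (∀ n x, x ≠ 0 → |divPowGrad α (η n) x| ≤
        C * (‖x‖ ^ β * (|L ‖x‖| + ‖x‖ ^ (-((N : ℝ) + β)) * |F ‖x‖|))) ∧
      (∀ x, x ≠ 0 → Tendsto (fun n => divPowGrad α (η n) x) atTop
        (𝓝 (‖x‖ ^ β * L ‖x‖))) := by
  obtain ⟨χ, M, hχ, hχ01, hχ1, hM0, hχd⟩ := exists_cutoff
  have hh : ∀ n, IsHalfLineTest fun r => -F r * χ n r := fun n =>
    (hχ n).mul h.contDiffOn_F.neg
  have hg : ∀ n, IsHalfLineTest fun r => r ^ (-((N : ℝ) - 1 + α)) * (-F r * χ n r) := fun n =>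
    (hh n).mul (contDiffOn_rpow_Ioi _)
  have hvint : ∀ r, 0 < r →
      IntegrableOn (fun s => s ^ (-((N : ℝ) - 1 + α)) * F s) (Ioi r) ∧
      ∫ s in Ioi r, s ^ (-((N : ℝ) - 1 + α)) * F s = -v r := by
    intro r hr
    have h1 : ∀ s ∈ Ici r, HasDerivAt v (s ^ (-((N : ℝ) - 1 + α)) * F s) s := fun s hs =>
      h.deriv_v s (hr.trans_le hs)
    have h2 : ∀ s ∈ Ioi r, s ^ (-((N : ℝ) - 1 + α)) * F s ≤ 0 := fun s hs =>
      mul_nonpos_of_nonneg_of_nonpos (Real.rpow_nonneg (hr.trans hs).le _)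
        (h.F_nonpos s (hr.trans hs))
    refine ⟨integrableOn_Ioi_deriv_of_nonpos' h1 h2 h.tendsto_atTop, ?_⟩
    rw [integral_Ioi_of_hasDerivAt_of_nonpos' h1 h2 h.tendsto_atTop, zero_sub]
  have hnn : ∀ s, 0 < s → 0 ≤ s ^ (-((N : ℝ) - 1 + α)) * (-F s) := fun s hs =>
    mul_nonneg (Real.rpow_nonneg hs.le _) (neg_nonneg.2 (h.F_nonpos s hs))
  have hneg : ∀ r, 0 < r → IntegrableOn (fun s => s ^ (-((N : ℝ) - 1 + α)) * (-F s)) (Ioi r) ∧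
      ∫ s in Ioi r, s ^ (-((N : ℝ) - 1 + α)) * (-F s) = v r := by
    intro r hr
    have e : (fun s => s ^ (-((N : ℝ) - 1 + α)) * (-F s)) =
        fun s => -(s ^ (-((N : ℝ) - 1 + α)) * F s) := by funext s; ring
    rw [e]
    refine ⟨(hvint r hr).1.neg, ?_⟩
    rw [integral_neg, (hvint r hr).2, neg_neg]
  have hdiv : ∀ n x, x ≠ 0 → divPowGrad α (radialTest fun r =>
      r ^ (-((N : ℝ) - 1 + α)) * (-F r * χ n r)) (x : EuclideanSpace ℝ (Fin N)) =
      ‖x‖ ^ β * (L ‖x‖ * χ n ‖x‖) + ‖x‖ ^ (1 - (N : ℝ)) * (F ‖x‖ * deriv (χ n) ‖x‖) := by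
    intro n x hx
    have hx0 : 0 < ‖x‖ := norm_pos_iff.2 hx
    have h1 := ((h.deriv_F ‖x‖ hx0).neg).mul ((hχ n).hasDerivAt ‖x‖)
    have h2 : deriv (fun r => -F r * χ n r) ‖x‖ = _ := h1.deriv
    rw [divPowGrad_radialTest α (hh n) hx, h2]
    have h3 : ‖x‖ ^ β = ‖x‖ ^ (1 - (N : ℝ)) * ‖x‖ ^ ((N : ℝ) - 1 + β) := by
      rw [← Real.rpow_add hx0]; ring_nf
    rw [h3]
    simp only [Pi.neg_apply]
    ring
  have hE : ∀ n (x : EuclideanSpace ℝ (Fin N)), x ≠ 0 →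
      |‖x‖ ^ (1 - (N : ℝ)) * (F ‖x‖ * deriv (χ n) ‖x‖)| ≤
        M * (‖x‖ ^ β * (‖x‖ ^ (-((N : ℝ) + β)) * |F ‖x‖|)) * (1 / ((n : ℝ) + 1)) := by
    intro n x hx
    have hx0 : 0 < ‖x‖ := norm_pos_iff.2 hx
    rw [abs_mul, abs_mul, abs_of_nonneg (by positivity : 0 ≤ ‖x‖ ^ (1 - (N : ℝ)))]
    calc ‖x‖ ^ (1 - (N : ℝ)) * (|F ‖x‖| * |deriv (χ n) ‖x‖|)
        ≤ ‖x‖ ^ (1 - (N : ℝ)) * (|F ‖x‖| * (M * ‖x‖⁻¹ / (n + 1))) := by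
          gcongr; exact hχd n _ hx0
      _ = M * ((‖x‖ ^ (1 - (N : ℝ)) * ‖x‖⁻¹) * |F ‖x‖|) * (1 / ((n : ℝ) + 1)) := by ring
      _ = _ := by
          rw [← Real.rpow_neg_one ‖x‖, ← Real.rpow_add hx0, ← mul_assoc (‖x‖ ^ β),
            ← Real.rpow_add hx0]
          ring_nf
  refine ⟨fun n => radialTest fun r => r ^ (-((N : ℝ) - 1 + α)) * (-F r * χ n r), 1 + M,
    fun n => isTest_radialTest (hg n), fun n => eventually_radialTest_eq (hg n), ?_, ?_,
    by positivity, ?_, ?_⟩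
  · intro n x hx
    have hx0 : 0 < ‖x‖ := norm_pos_iff.2 hx
    have hpt : ∀ s ∈ Ioi ‖x‖, 0 ≤ s ^ (-((N : ℝ) - 1 + α)) * (-F s * χ n s) ∧
        s ^ (-((N : ℝ) - 1 + α)) * (-F s * χ n s) ≤ s ^ (-((N : ℝ) - 1 + α)) * (-F s) := by
      intro s hs
      have hs' := hnn s (hx0.trans hs)
      rw [← mul_assoc]
      exact ⟨mul_nonneg hs' (hχ01 n s).1, mul_le_of_le_one_right hs' (hχ01 n s).2⟩
    refine ⟨setIntegral_nonneg measurableSet_Ioi fun s hs => (hpt s hs).1, ?_⟩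
    rw [← (hneg _ hx0).2]
    exact setIntegral_mono_on (hg n).integrable.integrableOn (hneg _ hx0).1 measurableSet_Ioi
      fun s hs => (hpt s hs).2
  · intro x hx
    have hx0 : 0 < ‖x‖ := norm_pos_iff.2 hx
    rw [← (hneg _ hx0).2]
    refine tendsto_integral_of_dominated_convergence
      (fun s => s ^ (-((N : ℝ) - 1 + α)) * (-F s))
      (fun n => (hg n).integrable.aestronglyMeasurable.restrict) (hneg _ hx0).1 (fun n => ?_) ?_
    · refine (ae_restrict_iff' measurableSet_Ioi).2 (Eventually.of_forall fun s hs => ?_)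
      have hs' := hnn s (hx0.trans hs)
      rw [← mul_assoc, norm_mul, Real.norm_of_nonneg hs', Real.norm_of_nonneg (hχ01 n s).1]
      exact mul_le_of_le_one_right hs' (hχ01 n s).2
    · refine (ae_restrict_iff' measurableSet_Ioi).2 (Eventually.of_forall fun s hs => ?_)
      refine tendsto_const_nhds.congr' ?_
      filter_upwards [hχ1 s (hx0.trans hs)] with n hn
      rw [hn, mul_one]
  · intro n x hx
    rw [hdiv n x hx]
    refine (abs_add_le _ _).trans ?_
    have h1 : |‖x‖ ^ β * (L ‖x‖ * χ n ‖x‖)| ≤ ‖x‖ ^ β * |L ‖x‖| := by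
      rw [abs_mul, abs_mul, abs_of_nonneg (by positivity : 0 ≤ ‖x‖ ^ β),
        abs_of_nonneg (hχ01 n ‖x‖).1]
      gcongr
      exact mul_le_of_le_one_right (abs_nonneg _) (hχ01 n ‖x‖).2
    have h2 : M * (‖x‖ ^ β * (‖x‖ ^ (-((N : ℝ) + β)) * |F ‖x‖|)) * (1 / ((n : ℝ) + 1)) ≤
        M * (‖x‖ ^ β * (‖x‖ ^ (-((N : ℝ) + β)) * |F ‖x‖|)) := by
      refine mul_le_of_le_one_right (by positivity) ?_
      rw [div_le_one (by positivity)]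
      linarith [(Nat.cast_nonneg n : (0 : ℝ) ≤ n)]
    have h3 : 0 ≤ M * (‖x‖ ^ β * |L ‖x‖|) := by positivity
    have h4 : 0 ≤ ‖x‖ ^ β * (‖x‖ ^ (-((N : ℝ) + β)) * |F ‖x‖|) := by positivity
    linarith [hE n x hx]
  · intro x hx
    have hx0 : 0 < ‖x‖ := norm_pos_iff.2 hx
    have h1 : Tendsto (fun n => ‖x‖ ^ β * (L ‖x‖ * χ n ‖x‖)) atTop (𝓝 (‖x‖ ^ β * L ‖x‖)) := by
      refine tendsto_const_nhds.congr' ?_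
      filter_upwards [hχ1 _ hx0] with n hn
      rw [hn, mul_one]
    have h2 : Tendsto (fun n => ‖x‖ ^ (1 - (N : ℝ)) * (F ‖x‖ * deriv (χ n) ‖x‖)) atTop (𝓝 0) := by
      refine squeeze_zero_norm (hE · x hx) ?_
      simpa using (tendsto_one_div_add_atTop_nhds_zero_nat (𝕜 := ℝ)).const_mul
        (M * (‖x‖ ^ β * (‖x‖ ^ (-((N : ℝ) + β)) * |F ‖x‖|)))
    have h3 := h1.add h2
    rw [add_zero] at h3
    exact h3.congr fun n => (hdiv n x hx).symm

theorem tendsto_eLpNorm_zero_of_dominated {X : Type*} [MeasurableSpace X] {μ : Measure X} {p : ℝ}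
    (hp : 0 < p) {f : ℕ → X → ℝ} {g : X → ℝ} (hf : ∀ n, AEStronglyMeasurable (f n) μ)
    (hg : MemLp g (ENNReal.ofReal p) μ) (hle : ∀ n, ∀ᵐ x ∂μ, ‖f n x‖ ≤ ‖g x‖)
    (hlim : ∀ᵐ x ∂μ, Tendsto (fun n => f n x) atTop (𝓝 0)) :
    Tendsto (fun n => eLpNorm (f n) (ENNReal.ofReal p) μ) atTop (𝓝 0) := by
  have hp0 : ENNReal.ofReal p ≠ 0 := by simpa using hp
  simp_rw [eLpNorm_eq_lintegral_rpow_enorm_toReal hp0 ENNReal.ofReal_ne_top,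
    ENNReal.toReal_ofReal hp.le]
  have h1 : Tendsto (fun n => ∫⁻ x, ‖f n x‖ₑ ^ p ∂μ) atTop (𝓝 (∫⁻ _, 0 ∂μ)) := by
    refine tendsto_lintegral_of_dominated_convergence' (fun x => ‖g x‖ₑ ^ p)
      (fun n => (hf n).enorm.pow_const p) (fun n => ?_) ?_ ?_
    · filter_upwards [hle n] with x hx
      exact ENNReal.rpow_le_rpow (enorm_le_iff_norm_le.2 hx) hp.le
    · have := lintegral_rpow_enorm_lt_top_of_eLpNorm_lt_top hp0 ENNReal.ofReal_ne_top hg.2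
      rw [ENNReal.toReal_ofReal hp.le] at this
      exact this.ne
    · filter_upwards [hlim] with x hx
      have h2 := ((ENNReal.continuous_rpow_const (y := p)).tendsto _).comp hx.enorm
      simpa [ENNReal.zero_rpow_of_pos hp, Function.comp_def] using h2
  rw [lintegral_zero] at h1
  have h3 := ((ENNReal.continuous_rpow_const (y := 1 / p)).tendsto _).comp h1
  simpa [ENNReal.zero_rpow_of_pos (one_div_pos.2 hp), Function.comp_def, hp] using h3

/-! ### Weak solutions built from decreasing profiles -/

theorem DecreasingProfile.continuousOn {a b : ℝ} {v F L : ℝ → ℝ} (h : DecreasingProfile a b v F L) :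
    ContinuousOn v (Ioi 0) := fun r hr => (h.deriv_v r hr).continuousAt.continuousWithinAt

theorem DecreasingProfile.nonneg {a b : ℝ} {v F L : ℝ → ℝ} (h : DecreasingProfile a b v F L)
    {r : ℝ} (hr : 0 < r) : 0 ≤ v r := by
  have hanti : AntitoneOn v (Ioi 0) := by
    refine antitoneOn_of_deriv_nonpos (convex_Ioi 0) h.continuousOn
      (fun s hs => (h.deriv_v s (interior_subset hs)).differentiableAt.differentiableWithinAt) ?_
    intro s hs
    have hs' : 0 < s := interior_subset hs
    rw [(h.deriv_v s hs').deriv]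
    exact mul_nonpos_of_nonneg_of_nonpos (Real.rpow_nonneg hs'.le _) (h.F_nonpos s hs')
  refine le_of_tendsto h.tendsto_atTop ?_
  filter_upwards [eventually_ge_atTop r] with s hs
  exact hanti hr (hr.trans_le hs) hs

theorem continuousOn_comp_norm {N : ℕ} {f : ℝ → ℝ} (hf : ContinuousOn f (Ioi 0)) :
    ContinuousOn (fun x : EuclideanSpace ℝ (Fin N) => f ‖x‖) {0}ᶜ :=
  hf.comp continuous_norm.continuousOn fun _ hx => norm_pos_iff.2 hx

theorem integrable_divPowGrad {N : ℕ} (hN : N ≠ 0) {α : ℝ} (hα : 1 - (N : ℝ) < α)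
    {ψ : EuclideanSpace ℝ (Fin N) → ℝ} (hψ : IsTest ψ) : Integrable (divPowGrad α ψ) := by
  obtain ⟨C, R, hC0, -, -, hC2, hC3⟩ := exists_abs_divPowGrad_le α hψ
  have hint : Integrable ((Metric.ball (0 : EuclideanSpace ℝ (Fin N)) R).indicator
      fun x => C * ‖x‖ ^ (α - 1)) :=
    IntegrableOn.integrable_indicator
      ((integrableOn_ball_norm_rpow hN (γ := α - 1) (by linarith) R).const_mul C)
      measurableSet_ball
  refine hint.mono' (aestronglyMeasurable_of_continuousOn_compl hN
    (continuousOn_divPowGrad α hψ.1)) ?_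
  filter_upwards [ae_ne_zero hN] with x hx
  rcases le_or_gt R ‖x‖ with h | h
  · rw [(hC3 x h).2.2]
    simp [not_lt.2 h]
  · rw [indicator_of_mem (by simpa using h)]
    exact hC2 x hx

/-- If `v` and `z = -L v` are decreasing profiles with `L z = -|v| ^ (p - 2) v` and suitable
integrability, then `x ↦ v |x|` is a weak solution: both memberships and the weak equation are
limits of the corresponding facts for the test functions of `DecreasingProfile.exists_approx`. -/
theorem isSolution_of_profiles {N : ℕ} (hN : N ≠ 0) {α β C : ℝ}
    (hα : 1 - (N : ℝ) < α) (hβ : -(N : ℝ) < β) (hp : 2 < critExp N α β) {v P z S : ℝ → ℝ}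
    (hv : DecreasingProfile ((N : ℝ) - 1 + α) ((N : ℝ) - 1 + β) v P fun r => -z r)
    (hz : DecreasingProfile ((N : ℝ) - 1 + α) ((N : ℝ) - 1 + β) z S
      fun r => -(|v r| ^ (critExp N α β - 2) * v r))
    (hvi : IntegrableOn (fun r => r ^ ((N : ℝ) - 1 + β) * |v r| ^ critExp N α β) (Ioi 0))
    (hzi : IntegrableOn (fun r => r ^ ((N : ℝ) - 1 + β) *
      (|z r| + r ^ (-((N : ℝ) + β)) * |P r|) ^ 2) (Ioi 0))
    (hzb : ∀ r, 0 < r → |z r| ≤ C)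
    (hSb : ∀ r, 0 < r → |(|v r| ^ (critExp N α β - 2) * v r)| + r ^ (-((N : ℝ) + β)) * |S r| ≤ C) :
    IsSolution α β fun x : EuclideanSpace ℝ (Fin N) => v ‖x‖ := by
  have hp0 : 0 < critExp N α β := by linarith
  have hloc := isLocallyFiniteMeasure_powMeasure hN hβ
  have hae : ∀ γ, ∀ᵐ x ∂powMeasure N γ, x ≠ 0 := fun γ =>
    (powMeasure_absolutelyContinuous_volume N γ).ae_le (ae_ne_zero hN)
  have hmeas : ∀ (f : ℝ → ℝ) (γ : ℝ), ContinuousOn f (Ioi 0) →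
      AEStronglyMeasurable (fun x : EuclideanSpace ℝ (Fin N) => f ‖x‖) (powMeasure N γ) :=
    fun f γ hf => (aestronglyMeasurable_of_continuousOn_compl hN
      (continuousOn_comp_norm hf)).mono_ac (powMeasure_absolutelyContinuous_volume N γ)
  have hpowc : ∀ γ : ℝ, ContinuousOn (fun r : ℝ => r ^ γ) (Ioi 0) := fun γ =>
    (contDiffOn_rpow_Ioi γ).continuousOn
  have hPc := hv.contDiffOn_F.continuousOn
  have hvm := hmeas v β hv.continuousOn
  have hvL : MemLp (fun x : EuclideanSpace ℝ (Fin N) => v ‖x‖) (ENNReal.ofReal (critExp N α β))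
      (powMeasure N β) := by
    rw [← integrable_norm_rpow_iff hvm (by simpa using hp0) ENNReal.ofReal_ne_top,
      ENNReal.toReal_ofReal hp0.le, integrable_powMeasure_iff,
      integrable_comp_norm hN (f := fun r => r ^ β * ‖v r‖ ^ critExp N α β)]
    refine hvi.congr_fun (fun r hr => ?_) measurableSet_Ioi
    rw [← mul_assoc, ← Real.rpow_add hr, Real.norm_eq_abs]
  -- `G` dominates `w` and the images of the approximating test functions.
  set G : ℝ → ℝ := fun r => r ^ β * (|z r| + r ^ (-((N : ℝ) + β)) * |P r|) with hG
  have hGm := hmeas G (-β) ((hpowc β).mul (hz.continuousOn.abs.add ((hpowc _).mul hPc.abs)))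
  have hGnn : ∀ x : EuclideanSpace ℝ (Fin N), 0 ≤ G ‖x‖ := fun x => by simp only [hG]; positivity
  have hGL : MemLp (fun x : EuclideanSpace ℝ (Fin N) => G ‖x‖) 2 (powMeasure N (-β)) := by
    rw [memLp_two_iff_integrable_sq hGm, integrable_powMeasure_iff,
      integrable_comp_norm hN (f := fun r => r ^ (-β) * G r ^ 2)]
    refine hzi.congr_fun (fun r hr => ?_) measurableSet_Ioi
    have hr0 : 0 < r := hr
    simp only [hG]
    rw [Real.rpow_add hr0, Real.rpow_neg hr0.le β]
    field_simp
  set w : EuclideanSpace ℝ (Fin N) → ℝ := fun x => ‖x‖ ^ β * -z ‖x‖ with hw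
  have hwm : AEStronglyMeasurable w (powMeasure N (-β)) :=
    hmeas (fun r => r ^ β * -z r) (-β) ((hpowc β).mul hz.continuousOn.neg)
  have hwG : ∀ x, ‖w x‖ ≤ G ‖x‖ := by
    intro x
    simp only [hw, hG]
    rw [norm_mul, norm_neg, Real.norm_of_nonneg (by positivity), Real.norm_eq_abs]
    have : 0 ≤ ‖x‖ ^ (-((N : ℝ) + β)) * |P ‖x‖| := by positivity
    gcongr
    linarith
  have hwL : MemLp w 2 (powMeasure N (-β)) :=
    hGL.mono' hwm (Eventually.of_forall hwG)
  refine ⟨w, ⟨hvL, hwL, ?_⟩, fun ψ hψ => ?_⟩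
  · obtain ⟨φ, C', hφ, -, hφle, hφlim, hC', hφd, hφdlim⟩ := hv.exists_approx
    refine ⟨φ, hφ, ?_, ?_⟩
    · refine tendsto_eLpNorm_zero_of_dominated hp0
        (fun n => ((hφ n).1.continuous.aestronglyMeasurable).sub hvm) hvL (fun n => ?_) ?_
      · filter_upwards [hae β] with x hx
        have h1 := hφle n x hx
        rw [Real.norm_eq_abs, Real.norm_eq_abs, abs_of_nonneg (h1.1.trans h1.2), abs_le]
        constructor <;> linarith
      · filter_upwards [hae β] with x hx
        simpa using (hφlim x hx).sub_const (v ‖x‖)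
    · have hGL' : MemLp (fun x : EuclideanSpace ℝ (Fin N) => (C' + 1) * G ‖x‖)
          (ENNReal.ofReal 2) (powMeasure N (-β)) := by
        rw [ENNReal.ofReal_ofNat]; exact hGL.const_mul _
      have key := tendsto_eLpNorm_zero_of_dominated two_pos
        (f := fun n x => divPowGrad α (φ n) x - w x)
        (fun n => ((aestronglyMeasurable_of_continuousOn_compl hN
          (continuousOn_divPowGrad α (hφ n).1)).mono_ac
            (powMeasure_absolutelyContinuous_volume N _)).sub hwm) hGL' (fun n => ?_) ?_
      · rwa [ENNReal.ofReal_ofNat] at key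
      · filter_upwards [hae (-β)] with x hx
        have h1 := hφd n x hx
        rw [abs_neg] at h1
        have h2 := hwG x
        have h3 := hGnn x
        rw [Real.norm_of_nonneg (mul_nonneg (by linarith) h3)]
        refine (norm_sub_le _ _).trans ?_
        rw [add_mul, one_mul, Real.norm_eq_abs]
        exact add_le_add h1 h2
      · filter_upwards [hae (-β)] with x hx
        simpa [hw] using (hφdlim x hx).sub_const (w x)
  · obtain ⟨η, C', hη, hη0, hηle, hηlim, hC', hηd, hηdlim⟩ := hz.exists_approx
    have hψi := integrable_divPowGrad hN hα hψ
    have h1 : Tendsto (fun n => ∫ x, η n x * divPowGrad α ψ x) atTop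
        (𝓝 (∫ x, z ‖x‖ * divPowGrad α ψ x)) := by
      refine tendsto_integral_of_dominated_convergence (fun x => C * ‖divPowGrad α ψ x‖)
        (fun n => ((hη n).1.continuous.aestronglyMeasurable).mul hψi.1) (hψi.norm.const_mul C)
        (fun n => ?_) ?_
      · filter_upwards [ae_ne_zero hN] with x hx
        have h2 := hηle n x hx
        rw [norm_mul, Real.norm_of_nonneg h2.1]
        gcongr
        exact h2.2.trans ((le_abs_self _).trans (hzb _ (norm_pos_iff.2 hx)))
      · filter_upwards [ae_ne_zero hN] with x hx
        exact (hηlim x hx).mul_const _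
    have hψβ : Integrable fun x => C' * C * (‖x‖ ^ β * |ψ x|) := by
      refine Integrable.const_mul ?_ _
      rw [← integrable_powMeasure_iff (g := fun x => |ψ x|)]
      exact (hψ.1.continuous.integrable_of_hasCompactSupport hψ.2).norm
    have h2 : Tendsto (fun n => ∫ x, ψ x * divPowGrad α (η n) x) atTop
        (𝓝 (∫ x, ψ x * (‖x‖ ^ β * -(|v ‖x‖| ^ (critExp N α β - 2) * v ‖x‖)))) := by
      refine tendsto_integral_of_dominated_convergence _
        (fun n => (hψ.1.continuous.aestronglyMeasurable).mul
          (integrable_divPowGrad hN hα (hη n)).1) hψβ (fun n => ?_) ?_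
      · filter_upwards [ae_ne_zero hN] with x hx
        have h3 := hηd n x hx
        rw [abs_neg] at h3
        rw [norm_mul, Real.norm_eq_abs, Real.norm_eq_abs]
        calc |ψ x| * |divPowGrad α (η n) x| ≤ |ψ x| * (C' * (‖x‖ ^ β * C)) := by
              gcongr
              refine h3.trans ?_
              gcongr
              exact hSb _ (norm_pos_iff.2 hx)
          _ = _ := by ring
      · filter_upwards [ae_ne_zero hN] with x hx
        exact (hηdlim x hx).const_mul _
    have h3 : ∫ x, z ‖x‖ * divPowGrad α ψ x =
        ∫ x, ψ x * (‖x‖ ^ β * -(|v ‖x‖| ^ (critExp N α β - 2) * v ‖x‖)) :=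
      tendsto_nhds_unique h1 (h2.congr fun n =>
        (integral_mul_divPowGrad_comm hN hα (hη n) (hη0 n) hψ).symm)
    have h4 : ∫ x, ‖x‖ ^ (-β) * w x * divPowGrad α ψ x = -∫ x, z ‖x‖ * divPowGrad α ψ x := by
      rw [← integral_neg]
      refine integral_congr_ae ?_
      filter_upwards [ae_ne_zero hN] with x hx
      have hx0 : 0 < ‖x‖ := norm_pos_iff.2 hx
      simp only [hw]
      rw [Real.rpow_neg hx0.le]
      field_simp
    rw [h4, h3, ← integral_neg]
    congr 1 with x
    ring

/-! ### The explicit profile -/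

theorem hasDerivAt_one_add_mul_rpow {c t r s : ℝ} (hc : 0 < c) (hr : 0 < r) :
    HasDerivAt (fun r : ℝ => (1 + c * r ^ t) ^ s)
      (s * c * t * r ^ (t - 1) * (1 + c * r ^ t) ^ (s - 1)) r := by
  have h1 : HasDerivAt (fun r : ℝ => 1 + c * r ^ t) (c * (t * r ^ (t - 1))) r :=
    ((Real.hasDerivAt_rpow_const (p := t) (Or.inl hr.ne')).const_mul c).const_add 1
  have h2 : 0 < 1 + c * r ^ t := by positivity
  exact (h1.rpow_const (p := s) (Or.inl h2.ne')).congr_deriv (by ring)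

/-- The operator `L` acts explicitly on the powers of `1 + c r ^ t`. -/
theorem decreasingProfile_one_add_mul_rpow {k t c s : ℝ} (ht : 0 < t) (hc : 0 < c) (hs : 0 < s) :
    DecreasingProfile (2 * k + t + 1) (2 * k + 2 * t - 1) (fun r => (1 + c * r ^ t) ^ (-s))
      (fun r => -(s * c * t) * (r ^ (2 * k + 2 * t) * (1 + c * r ^ t) ^ (-s - 1)))
      (fun r => -(s * c * t) * ((1 + c * r ^ t) ^ (-s - 2) *
        (2 * k + 2 * t + (2 * k + t - s * t) * (c * r ^ t)))) where
  contDiffOn_F := by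
    intro r hr
    have hr0 : (0 : ℝ) < r := hr
    have h1 : ContDiffAt ℝ ∞ (fun r : ℝ => r ^ t) r := Real.contDiffAt_rpow_const_of_ne hr0.ne'
    have h2 : 0 < 1 + c * r ^ t := by positivity
    exact (contDiffAt_const.mul ((Real.contDiffAt_rpow_const_of_ne hr0.ne').mul
      ((contDiffAt_const.add (contDiffAt_const.mul h1)).rpow_const_of_ne
        h2.ne'))).contDiffWithinAt
  deriv_v := by
    intro r hr
    refine (hasDerivAt_one_add_mul_rpow hc hr).congr_deriv ?_
    rw [show t - 1 = -(2 * k + t + 1) + (2 * k + 2 * t) by ring, Real.rpow_add hr]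
    ring
  deriv_F := by
    intro r hr
    have h1 := ((Real.hasDerivAt_rpow_const (p := 2 * k + 2 * t) (Or.inl hr.ne')).mul
      (hasDerivAt_one_add_mul_rpow (t := t) (s := -s - 1) hc hr)).const_mul (-(s * c * t))
    refine h1.congr_deriv ?_
    have h2 : 0 < 1 + c * r ^ t := by positivity
    have e1 : (1 + c * r ^ t) ^ (-s - 1) = (1 + c * r ^ t) ^ (-s - 2) * (1 + c * r ^ t) := by
      rw [← Real.rpow_add_one h2.ne']; ring_nf
    have e2 : r ^ (2 * k + 2 * t) * r ^ (t - 1) = r ^ (2 * k + 2 * t - 1) * r ^ t := by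
      rw [← Real.rpow_add hr, ← Real.rpow_add hr]; ring_nf
    have e3 : -s - 1 - 1 = -s - 2 := by ring
    rw [e1, e3]
    linear_combination (-(s * c * t) * ((-s - 1) * c * t * (1 + c * r ^ t) ^ (-s - 2))) * e2
  F_nonpos := by
    intro r hr
    have : 0 ≤ s * c * t * (r ^ (2 * k + 2 * t) * (1 + c * r ^ t) ^ (-s - 1)) := by positivity
    linarith
  tendsto_atTop := by
    have h1 : Tendsto (fun r : ℝ => 1 + c * r ^ t) atTop atTop :=
      tendsto_atTop_add_const_left _ _ ((tendsto_rpow_atTop ht).const_mul_atTop hc)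
    exact (tendsto_rpow_neg_atTop hs).comp h1

theorem integrableOn_rpow_mul_one_add {k t c q : ℝ} (hkt : 0 < 2 * k + 2 * t)
    (hc : 0 < c) (hq0 : 0 ≤ q) (hq : 2 * k + 2 * t < t * q) :
    IntegrableOn (fun r : ℝ => r ^ (2 * k + 2 * t - 1) * (1 + c * r ^ t) ^ (-q)) (Ioi 0) := by
  have hm : Measurable fun r : ℝ => r ^ (2 * k + 2 * t - 1) * (1 + c * r ^ t) ^ (-q) :=
    (measurable_id.pow_const _).mul
      (((measurable_id.pow_const t).const_mul c).const_add 1 |>.pow_const _)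
  rw [← Ioc_union_Ioi_eq_Ioi zero_le_one]
  refine IntegrableOn.union ?_ ?_
  · have h1 : IntegrableOn (fun r : ℝ => r ^ (2 * k + 2 * t - 1)) (Ioc 0 1) :=
      (intervalIntegrable_iff_integrableOn_Ioc_of_le zero_le_one).1
        (intervalIntegral.intervalIntegrable_rpow' (by linarith))
    refine h1.mono' hm.aestronglyMeasurable ?_
    refine (ae_restrict_iff' measurableSet_Ioc).2 (Eventually.of_forall fun r hr => ?_)
    have hr0 := hr.1
    rw [Real.norm_of_nonneg (by positivity)]
    refine mul_le_of_le_one_right (by positivity) ?_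
    refine Real.rpow_le_one_of_one_le_of_nonpos ?_ (by linarith)
    have : 0 ≤ c * r ^ t := by positivity
    linarith
  · have h1 : IntegrableOn (fun r : ℝ => c ^ (-q) * r ^ (2 * k + 2 * t - 1 - t * q)) (Ioi 1) :=
      ((integrableOn_Ioi_rpow_iff zero_lt_one).2 (by linarith)).const_mul _
    refine h1.mono' hm.aestronglyMeasurable ?_
    refine (ae_restrict_iff' measurableSet_Ioi).2 (Eventually.of_forall fun r hr => ?_)
    have hr0 : 0 < r := zero_lt_one.trans hr
    rw [Real.norm_of_nonneg (by positivity)]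
    calc r ^ (2 * k + 2 * t - 1) * (1 + c * r ^ t) ^ (-q)
        ≤ r ^ (2 * k + 2 * t - 1) * (c * r ^ t) ^ (-q) := by
          gcongr ?_ * ?_
          exact Real.rpow_le_rpow_of_nonpos (by positivity) (by linarith) (by linarith)
      _ = _ := by
          rw [Real.mul_rpow hc.le (by positivity), ← Real.rpow_mul hr0.le, mul_neg,
            show 2 * k + 2 * t - 1 - t * q = (2 * k + 2 * t - 1) + -(t * q) by ring,
            Real.rpow_add hr0 _ (-(t * q))]
          ring

/-! ### The bubbles are solutions -/

theorem DecreasingProfile.congr {a b : ℝ} {v F L L' : ℝ → ℝ} (h : DecreasingProfile a b v F L)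
    (hL : ∀ r, 0 < r → L r = L' r) : DecreasingProfile a b v F L' where
  contDiffOn_F := h.contDiffOn_F
  deriv_v := h.deriv_v
  deriv_F r hr := (h.deriv_F r hr).congr_deriv (by rw [hL r hr])
  F_nonpos := h.F_nonpos
  tendsto_atTop := h.tendsto_atTop

/-- The family `A (1 + c r ^ t) ^ (-ν)` with `ν = 2 k / t` solves the equation as soon as
`A ^ (2 t / k) = c ^ 2 ν (ν + 1) (ν + 2) (ν + 3) t ^ 4`, since `L` maps it to a combination of the
powers `-ν - 1` and `-ν - 2` of `1 + c r ^ t`, and that combination to a multiple of the power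
`-ν - 4`. -/
theorem isSolution_one_add_mul_rpow {N : ℕ} (hN : N ≠ 0) {α β k t ν c A : ℝ} (hk0 : 0 < k)
    (ht0 : 0 < t) (hk : 2 * k = N - 4 + 2 * α - β) (ht : t = 2 + β - α) (hν : ν * t = 2 * k)
    (hc : 0 < c) (hA : 0 < A)
    (hAc : A ^ (2 * t / k) = c ^ 2 * (ν * (ν + 1) * (ν + 2) * (ν + 3) * t ^ 4)) :
    IsSolution α β fun x : EuclideanSpace ℝ (Fin N) => A * (1 + c * ‖x‖ ^ t) ^ (-ν) := by
  have hν0 : 0 < ν := pos_of_mul_pos_left (by rw [hν]; positivity) ht0.le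
  have ea : (N : ℝ) - 1 + α = 2 * k + t + 1 := by linarith
  have eb : (N : ℝ) - 1 + β = 2 * k + 2 * t - 1 := by linarith
  have ec : (N : ℝ) + β = 2 * k + 2 * t := by linarith
  have ep : critExp N α β = 2 + 2 * t / k := critExp_eq hk0 hk ht
  have e4 : ν * (2 * t / k) = 4 := by
    field_simp
    linarith
  have hB : 0 < A * ν * c * t ^ 2 := by positivity
  have hw : ∀ r : ℝ, 0 < r → 1 < 1 + c * r ^ t := fun r hr => by
    have : 0 < c * r ^ t := by positivity
    linarith
  have hw1 : ∀ r s : ℝ, 0 < r → 0 ≤ s → (1 + c * r ^ t) ^ (-s) ≤ 1 := fun r s hr hs =>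
    Real.rpow_le_one_of_one_le_of_nonpos (hw r hr).le (by linarith)
  have hnl : ∀ r : ℝ, 0 < r → |A * (1 + c * r ^ t) ^ (-ν)| ^ (2 * t / k) *
      (A * (1 + c * r ^ t) ^ (-ν)) = A * ν * c * t ^ 2 *
        ((ν + 1) * (ν + 2) * (ν + 3) * c * t ^ 2) * (1 + c * r ^ t) ^ (-(ν + 4)) := by
    intro r hr
    have h0 : 0 < 1 + c * r ^ t := zero_lt_one.trans (hw r hr)
    rw [abs_of_pos (by positivity), Real.mul_rpow hA.le (by positivity), ← Real.rpow_mul h0.le,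
      hAc, neg_mul, e4, neg_add, Real.rpow_add h0]
    ring
  have hv := ((decreasingProfile_one_add_mul_rpow (k := k) ht0 hc hν0).const_mul hA.le).congr
    (L' := fun r => -(A * ν * c * t ^ 2 * ((1 + c * r ^ t) ^ (-(ν + 1)) +
      (ν + 1) * (1 + c * r ^ t) ^ (-(ν + 2))))) (fun r hr => by
        have h0 : 0 < 1 + c * r ^ t := zero_lt_one.trans (hw r hr)
        rw [show -(ν + 1) = (-ν - 2) + 1 by ring, Real.rpow_add_one h0.ne',
          show -(ν + 2) = -ν - 2 by ring, ← hν]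
        ring)
  have hz := (((decreasingProfile_one_add_mul_rpow (k := k) ht0 hc
    (by linarith : 0 < ν + 1)).add ((decreasingProfile_one_add_mul_rpow (k := k) ht0 hc
      (by linarith : 0 < ν + 2)).const_mul (by linarith : 0 ≤ ν + 1))).const_mul hB.le).congr
    (L' := fun r => -(|A * (1 + c * r ^ t) ^ (-ν)| ^ (2 * t / k) *
      (A * (1 + c * r ^ t) ^ (-ν)))) (fun r hr => by
        have h0 : 0 < 1 + c * r ^ t := zero_lt_one.trans (hw r hr)
        rw [hnl r hr, show -(ν + 1) - 2 = -(ν + 4) + 1 by ring, Real.rpow_add_one h0.ne',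
          show -(ν + 2) - 2 = -(ν + 4) by ring, ← hν]
        ring)
  have hF : ∀ r s : ℝ, 0 < r → r ^ (-(2 * k + 2 * t)) *
      (s * c * t * (r ^ (2 * k + 2 * t) * (1 + c * r ^ t) ^ (-s - 1))) =
        s * c * t * (1 + c * r ^ t) ^ (-(s + 1)) := by
    intro r s hr
    rw [Real.rpow_neg hr.le, show -s - 1 = -(s + 1) by ring]
    field_simp
  have hpos : ∀ r s : ℝ, 0 < r → 0 < (1 + c * r ^ t) ^ s := fun r s hr =>
    Real.rpow_pos_of_pos (zero_lt_one.trans (hw r hr)) s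
  refine isSolution_of_profiles hN (by linarith) (by linarith) (by rw [ep]; simp; positivity)
    (C := A * ν * c * t ^ 2 * (1 + (ν + 1)) + (A * ν * c * t ^ 2 *
      ((ν + 1) * (ν + 2) * (ν + 3) * c * t ^ 2) +
      A * ν * c * t ^ 2 * ((ν + 1) * c * t + (ν + 1) * ((ν + 2) * c * t))))
    (v := fun r => A * (1 + c * r ^ t) ^ (-ν))
    (z := fun r => A * ν * c * t ^ 2 * ((1 + c * r ^ t) ^ (-(ν + 1)) +
      (ν + 1) * (1 + c * r ^ t) ^ (-(ν + 2))))
    (by rw [ea, eb]; exact hv)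
    (by rw [ea, eb, ep, add_sub_cancel_left]; exact hz) ?_ ?_ ?_ ?_
  · rw [eb, ep]
    -- `|v| ^ p` decays like the power `-(2 ν + 4)` of `1 + c r ^ t`, as `ν * (2 t / k) = 4`.
    have hi : IntegrableOn (fun r : ℝ => A ^ (2 + 2 * t / k) * (r ^ (2 * k + 2 * t - 1) *
        (1 + c * r ^ t) ^ (-(2 * ν + 4)))) (Ioi 0) :=
      (integrableOn_rpow_mul_one_add (by positivity) hc (by positivity) (by linarith)).const_mul _
    refine hi.congr_fun (fun r hr => ?_) measurableSet_Ioi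
    have h0 : 0 < 1 + c * r ^ t := zero_lt_one.trans (hw r hr)
    simp only
    rw [abs_of_pos (mul_pos hA (hpos r _ hr)), Real.mul_rpow hA.le (hpos r _ hr).le,
      ← Real.rpow_mul h0.le, show -ν * (2 + 2 * t / k) = -(2 * ν + 4) by linear_combination -e4]
    ring
  · rw [eb, ec]
    -- Both terms of the dominating function decay like the power `-(ν + 1)` of `1 + c r ^ t`.
    refine ((integrableOn_rpow_mul_one_add (k := k) (t := t) (q := 2 * ν + 2) (by positivity) hc
      (by positivity) (by linarith)).const_mul ((A * ν * c * t ^ 2 * (1 + (ν + 1)) + A * (ν * c * t)) ^ 2)).mono'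
      ?_ ?_
    · refine ContinuousOn.aestronglyMeasurable ?_ measurableSet_Ioi
      have hpc : ∀ γ : ℝ, ContinuousOn (fun r : ℝ => r ^ γ) (Ioi 0) := fun γ =>
        (contDiffOn_rpow_Ioi γ).continuousOn
      have hwc : ∀ s : ℝ, ContinuousOn (fun r : ℝ => (1 + c * r ^ t) ^ s) (Ioi 0) := fun s =>
        (continuousOn_const.add (continuousOn_const.mul (hpc t))).rpow_const fun r hr =>
          Or.inl (zero_lt_one.trans (hw r hr)).ne'
      exact (hpc _).mul (((continuousOn_const.mul
        ((hwc _).add (continuousOn_const.mul (hwc _)))).abs.add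
          ((hpc _).mul hv.contDiffOn_F.continuousOn.abs)).pow 2)
    · refine (ae_restrict_iff' measurableSet_Ioi).2 (Eventually.of_forall fun r hr => ?_)
      have hr0 : 0 < r := hr
      have h0 : 0 < 1 + c * r ^ t := zero_lt_one.trans (hw r hr)
      have h1 := hpos r (-(ν + 1)) hr
      have h2 : (1 + c * r ^ t) ^ (-(ν + 2)) ≤ (1 + c * r ^ t) ^ (-(ν + 1)) :=
        Real.rpow_le_rpow_of_exponent_le (hw r hr).le (by linarith)
      have h3 := hpos r (-(ν + 2)) hr
      have h4 : r ^ (-(2 * k + 2 * t)) *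
          |A * (-(ν * c * t) * (r ^ (2 * k + 2 * t) * (1 + c * r ^ t) ^ (-ν - 1)))| =
            A * (ν * c * t) * (1 + c * r ^ t) ^ (-(ν + 1)) := by
        have h5 := hpos r (-ν - 1) hr
        rw [neg_mul, mul_neg, abs_neg, abs_of_pos (by positivity)]
        linear_combination A * hF r ν hr
      rw [h4, abs_of_pos (by positivity), Real.norm_of_nonneg (by positivity),
        show -(2 * ν + 2) = -(ν + 1) + -(ν + 1) by ring, Real.rpow_add h0]
      calc _ ≤ r ^ (2 * k + 2 * t - 1) * (A * ν * c * t ^ 2 * ((1 + c * r ^ t) ^ (-(ν + 1)) +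
            (ν + 1) * (1 + c * r ^ t) ^ (-(ν + 1))) +
              A * (ν * c * t) * (1 + c * r ^ t) ^ (-(ν + 1))) ^ 2 := by gcongr
        _ = _ := by ring
  · intro r hr
    have h1 := hpos r (-(ν + 1)) hr
    have h2 := hpos r (-(ν + 2)) hr
    rw [abs_of_pos (by positivity)]
    have h3 : A * ν * c * t ^ 2 * ((1 + c * r ^ t) ^ (-(ν + 1)) +
        (ν + 1) * (1 + c * r ^ t) ^ (-(ν + 2))) ≤ A * ν * c * t ^ 2 * (1 + (ν + 1) * 1) := by
      gcongr
      · exact hw1 r _ hr (by linarith)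
      · exact hw1 r _ hr (by linarith)
    rw [mul_one] at h3
    exact h3.trans (le_add_of_nonneg_right (by positivity))
  · intro r hr
    have h1 := hpos r (-(ν + 4)) hr
    have h2 := hpos r (-(ν + 1) - 1) hr
    have h3 := hpos r (-(ν + 2) - 1) hr
    have h4 : r ^ (-(2 * k + 2 * t)) *
        |A * ν * c * t ^ 2 * (-((ν + 1) * c * t) * (r ^ (2 * k + 2 * t) *
          (1 + c * r ^ t) ^ (-(ν + 1) - 1)) + (ν + 1) * (-((ν + 2) * c * t) *
            (r ^ (2 * k + 2 * t) * (1 + c * r ^ t) ^ (-(ν + 2) - 1))))| =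
          A * ν * c * t ^ 2 * ((ν + 1) * c * t * (1 + c * r ^ t) ^ (-(ν + 1 + 1)) +
            (ν + 1) * ((ν + 2) * c * t * (1 + c * r ^ t) ^ (-(ν + 2 + 1)))) := by
      rw [← abs_neg, abs_of_pos]
      · linear_combination A * ν * c * t ^ 2 * hF r (ν + 1) hr +
          A * ν * c * t ^ 2 * (ν + 1) * hF r (ν + 2) hr
      · have : 0 < A * ν * c * t ^ 2 * ((ν + 1) * c * t * (r ^ (2 * k + 2 * t) *
          (1 + c * r ^ t) ^ (-(ν + 1) - 1)) + (ν + 1) * ((ν + 2) * c * t *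
            (r ^ (2 * k + 2 * t) * (1 + c * r ^ t) ^ (-(ν + 2) - 1)))) := by positivity
        linarith
    have h5 : 0 ≤ A * ν * c * t ^ 2 * (1 + (ν + 1)) := by positivity
    rw [ep, add_sub_cancel_left, ec, hnl r hr, h4, abs_of_pos (by positivity)]
    refine le_trans (add_le_add ?_ ?_) (le_add_of_nonneg_left h5)
    · exact mul_le_of_le_one_right (by positivity) (hw1 r _ hr (by linarith))
    · refine mul_le_mul_of_nonneg_left (add_le_add ?_ (mul_le_mul_of_nonneg_left ?_ ?_)) hB.le
      · exact mul_le_of_le_one_right (by positivity) (hw1 r _ hr (by linarith))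
      · exact mul_le_of_le_one_right (by positivity) (hw1 r _ hr (by linarith))
      · linarith

theorem bubbleScaled_eq {N : ℕ} {α β k t l : ℝ} (hk : 2 * k = N - 4 + 2 * α - β)
    (ht : t = 2 + β - α) (hl : 0 < l) (x : EuclideanSpace ℝ (Fin N)) :
    bubbleScaled α β l x =
      l ^ k * (2 * k * (2 * k + t) * (2 * k + 2 * t) * (2 * k + 3 * t)) ^ (k / (2 * t)) *
        (1 + l ^ t * ‖x‖ ^ t) ^ (-(2 * k / t)) := by
  have e1 : (N : ℝ) - 2 + α = 2 * k + t := by linarith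
  have e2 : (N : ℝ) + β = 2 * k + 2 * t := by linarith
  have e3 : (N : ℝ) + 2 - α + 2 * β = 2 * k + 3 * t := by linarith
  have e4 : 2 * k / 2 = k := by ring
  have e5 : 2 * k / (4 * t) = k / (2 * t) := by
    rw [show 4 * t = 2 * (2 * t) by ring, mul_div_mul_left _ _ two_ne_zero]
  unfold bubbleScaled bubble bubbleConst
  rw [← hk, ← ht, e1, e2, e3, e4, e5, norm_smul, Real.norm_of_nonneg hl.le,
    Real.mul_rpow hl.le (norm_nonneg x), Real.rpow_neg (by positivity)]
  ring

theorem isSolution_bubbleScaled {N : ℕ} (hN : N ≠ 0) {α β k t l : ℝ} (hk0 : 0 < k) (ht0 : 0 < t)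
    (hk : 2 * k = N - 4 + 2 * α - β) (ht : t = 2 + β - α) (hl : 0 < l) :
    IsSolution α β (bubbleScaled α β l : EuclideanSpace ℝ (Fin N) → ℝ) := by
  have key := isSolution_one_add_mul_rpow hN hk0 ht0 hk ht (ν := 2 * k / t) (c := l ^ t)
    (A := l ^ k * (2 * k * (2 * k + t) * (2 * k + 2 * t) * (2 * k + 3 * t)) ^ (k / (2 * t)))
    (by field_simp) (by positivity) (by positivity) (by
      rw [Real.mul_rpow (by positivity) (by positivity), ← Real.rpow_mul hl.le,
        ← Real.rpow_mul (by positivity), show k * (2 * t / k) = t * (2 : ℕ) by field_simp; norm_num,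
        show k / (2 * t) * (2 * t / k) = 1 by field_simp, Real.rpow_one, Real.rpow_mul hl.le,
        Real.rpow_natCast]
      congr 1
      field_simp)
  convert key using 2 with x
  exact bubbleScaled_eq hk ht hl x

theorem IsSolution.neg {N : ℕ} {α β : ℝ} {u : EuclideanSpace ℝ (Fin N) → ℝ}
    (hu : IsSolution α β u) : IsSolution α β fun x => -u x := by
  obtain ⟨w, ⟨h1, h2, φ, h3, h4, h5⟩, h6⟩ := hu
  have hd : ∀ n x, divPowGrad α (fun y => -φ n y) x = -divPowGrad α (φ n) x := by
    intro n x
    have e : (fun y => ‖y‖ ^ α • gradient (fun y => -φ n y) y) =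
        -fun y => ‖y‖ ^ α • gradient (φ n) y := by
      funext y
      simp [gradient, fderiv_fun_neg]
    unfold divPowGrad divergence
    rw [e, fderiv_neg]
    simp
  refine ⟨fun x => -w x, ⟨h1.neg, h2.neg, fun n x => -φ n x,
    fun n => ⟨(h3 n).1.neg, (h3 n).2.neg⟩, ?_, ?_⟩, fun ψ hψ => ?_⟩
  · refine h4.congr fun n => ?_
    rw [← eLpNorm_neg]
    congr 1 with x
    simp only [Pi.neg_apply]
    ring
  · refine h5.congr fun n => ?_
    rw [← eLpNorm_neg]
    congr 1 with x
    simp only [Pi.neg_apply, hd]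
    ring
  · simpa [integral_neg] using congrArg Neg.neg (h6 ψ hψ)

theorem IsRadial.neg {N : ℕ} {u : EuclideanSpace ℝ (Fin N) → ℝ} (hu : IsRadial u) :
    IsRadial fun x => -u x := by
  obtain ⟨f, hf⟩ := hu
  exact ⟨fun r => -f r, hf.mono fun x hx => congrArg Neg.neg hx⟩

theorem IsNontrivialRadialSolution.neg {N : ℕ} {α β : ℝ} {u : EuclideanSpace ℝ (Fin N) → ℝ}
    (hu : IsNontrivialRadialSolution α β u) :
    IsNontrivialRadialSolution α β fun x => -u x :=
  ⟨hu.1.neg, hu.2.1.neg, fun h => hu.2.2 (h.mono fun x hx => by simpa using hx)⟩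

theorem isNontrivialRadialSolution_bubbleScaled {N : ℕ} (hN : N ≠ 0) {α β k t l : ℝ}
    (hk0 : 0 < k) (ht0 : 0 < t) (hk : 2 * k = N - 4 + 2 * α - β) (ht : t = 2 + β - α)
    (hl : 0 < l) :
    IsNontrivialRadialSolution α β (bubbleScaled α β l : EuclideanSpace ℝ (Fin N) → ℝ) := by
  refine ⟨isSolution_bubbleScaled hN hk0 ht0 hk ht hl,
    ⟨fun r => l ^ k * (2 * k * (2 * k + t) * (2 * k + 2 * t) * (2 * k + 3 * t)) ^ (k / (2 * t)) *
      (1 + l ^ t * r ^ t) ^ (-(2 * k / t)),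
      Eventually.of_forall fun x => bubbleScaled_eq hk ht hl x⟩, fun h => ?_⟩
  obtain ⟨x, hx⟩ := h.exists
  rw [bubbleScaled_eq hk ht hl x, Pi.zero_apply] at hx
  have : 0 < l ^ k * (2 * k * (2 * k + t) * (2 * k + 2 * t) * (2 * k + 3 * t)) ^ (k / (2 * t)) *
        (1 + l ^ t * ‖x‖ ^ t) ^ (-(2 * k / t)) := by positivity
  exact this.ne' hx

/-! ### Uniqueness -/

theorem radialSystem_zero (k t : ℝ) :
    RadialSystem k t (fun _ => 0) (fun _ => 0) (fun _ => 0) fun _ => 0 where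
  deriv_u r _ := (hasDerivAt_const r (0 : ℝ)).congr_deriv (by simp)
  deriv_P r _ := (hasDerivAt_const r (0 : ℝ)).congr_deriv (by simp)
  deriv_W r _ := (hasDerivAt_const r (0 : ℝ)).congr_deriv (by simp)
  deriv_Q r _ := (hasDerivAt_const r (0 : ℝ)).congr_deriv (by simp)
  tendsto_P := tendsto_const_nhds
  tendsto_Q := tendsto_const_nhds

theorem RadialSystem.neg {k t : ℝ} {u W P Q : ℝ → ℝ} (h : RadialSystem k t u W P Q) :
    RadialSystem k t (fun r => -u r) (fun r => -W r) (fun r => -P r) fun r => -Q r where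
  deriv_u r hr := (h.deriv_u r hr).neg.congr_deriv (by ring)
  deriv_P r hr := (h.deriv_P r hr).neg.congr_deriv (by ring)
  deriv_W r hr := (h.deriv_W r hr).neg.congr_deriv (by ring)
  deriv_Q r hr := (h.deriv_Q r hr).neg.congr_deriv (by rw [abs_neg]; ring)
  tendsto_P := by simpa using h.tendsto_P.neg
  tendsto_Q := by simpa using h.tendsto_Q.neg

/-- Functions of `|x|` that agree almost everywhere agree on the half-line, if continuous there. -/
theorem eq_of_ae_comp_norm_eq {N : ℕ} (hN : N ≠ 0) {f g : ℝ → ℝ} (hf : ContinuousOn f (Ioi 0))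
    (hg : ContinuousOn g (Ioi 0)) (h : ∀ᵐ x : EuclideanSpace ℝ (Fin N), f ‖x‖ = g ‖x‖)
    {r : ℝ} (hr : 0 < r) : f r = g r := by
  have key := Measure.eqOn_open_of_ae_eq (μ := volume) (ae_restrict_of_ae h)
    (isOpen_compl_singleton (x := (0 : EuclideanSpace ℝ (Fin N))))
    (continuousOn_comp_norm hf) (continuousOn_comp_norm hg)
  have := nontrivial_euclideanSpace hN
  obtain ⟨x, hx⟩ := exists_norm_eq (EuclideanSpace ℝ (Fin N)) hr.le
  have hx0 : x ≠ 0 := norm_pos_iff.1 (hx ▸ hr)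
  simpa [hx] using key hx0

/-- The radial system of a bubble, with the value of the bubble at the origin. -/
theorem exists_radialSystem_bubbleScaled {N : ℕ} (hN : N ≠ 0) {α β k t l : ℝ} (hk0 : 0 < k)
    (ht0 : 0 < t) (hk : 2 * k = N - 4 + 2 * α - β) (ht : t = 2 + β - α) (hl : 0 < l) :
    ∃ (v W P Q : ℝ → ℝ) (B : ℝ), RadialSystem k t v W P Q ∧
      Tendsto v (𝓝[>] 0) (𝓝 (l ^ k *
        (2 * k * (2 * k + t) * (2 * k + 2 * t) * (2 * k + 3 * t)) ^ (k / (2 * t)))) ∧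
      Tendsto W (𝓝[>] 0) (𝓝 B) ∧
      IntegrableOn (fun r => r ^ (2 * k + 2 * t - 1) * |v r| ^ (2 + 2 * t / k)) (Ioi 0) ∧
      ∀ᵐ x : EuclideanSpace ℝ (Fin N), bubbleScaled α β l x = v ‖x‖ := by
  have hs := isNontrivialRadialSolution_bubbleScaled hN hk0 ht0 hk ht hl
  obtain ⟨v, W, P, Q, hS, hP, hae, hi⟩ := exists_radialSystem hN hk0 ht0 hk ht hs.1 hs.2.1
  obtain ⟨A, B, hA, hB⟩ := hS.exists_tendsto hk0 ht0 hP
  refine ⟨v, W, P, Q, B, hS, ?_, hB, hi, hae⟩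
  set K : ℝ := (2 * k * (2 * k + t) * (2 * k + 2 * t) * (2 * k + 3 * t)) ^ (k / (2 * t))
  set f : ℝ → ℝ := fun r => l ^ k * K * (1 + l ^ t * r ^ t) ^ (-(2 * k / t)) with hf
  have hft : ∀ r : ℝ, 0 ≤ r → ContinuousAt f r := fun r hr => by
    have h0 : 0 < 1 + l ^ t * r ^ t := by positivity
    exact continuousAt_const.mul ((continuousAt_const.add (continuousAt_const.mul
      (Real.continuousAt_rpow_const _ _ (Or.inr ht0.le)))).rpow_const (Or.inl h0.ne'))
  have hfv : ∀ r, 0 < r → f r = v r := fun r hr => by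
    refine eq_of_ae_comp_norm_eq hN
      (fun s (hs : 0 < s) => (hft s hs.le).continuousWithinAt)
      (fun s hs => (hS.deriv_u s hs).continuousAt.continuousWithinAt) ?_ hr
    filter_upwards [hae] with x hx
    rw [← hx, bubbleScaled_eq hk ht hl x]
  have hf0 : Tendsto f (𝓝[>] 0) (𝓝 (l ^ k * K)) := by
    have h := (hft 0 le_rfl).tendsto.mono_left (nhdsWithin_le_nhds (s := Ioi 0))
    simpa [hf, Real.zero_rpow ht0.ne'] using h
  exact hf0.congr' (eventually_mem_nhdsWithin.mono hfv)

/-- A radial solution that is positive near the origin is a bubble: the dilation parameter adjusts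
the value of the bubble at the origin, and the value at the origin determines the solution. -/
theorem exists_bubbleScaled_ae_eq {N : ℕ} (hN : N ≠ 0) {α β k t : ℝ} (hk0 : 0 < k)
    (ht0 : 0 < t) (hk : 2 * k = N - 4 + 2 * α - β) (ht : t = 2 + β - α)
    {u : EuclideanSpace ℝ (Fin N) → ℝ} {v W P Q : ℝ → ℝ} {A B : ℝ} (hS : RadialSystem k t v W P Q)
    (hA : Tendsto v (𝓝[>] 0) (𝓝 A)) (hB : Tendsto W (𝓝[>] 0) (𝓝 B))
    (hi : IntegrableOn (fun r => r ^ (2 * k + 2 * t - 1) * |v r| ^ (2 + 2 * t / k)) (Ioi 0))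
    (hae : ∀ᵐ x, u x = v ‖x‖) (hA0 : 0 < A) :
    ∃ l : ℝ, 0 < l ∧ ∀ᵐ x, u x = bubbleScaled α β l x := by
  set K : ℝ := (2 * k * (2 * k + t) * (2 * k + 2 * t) * (2 * k + 3 * t)) ^ (k / (2 * t)) with hK
  have hK0 : 0 < K := by positivity
  -- The parameter `l` solves `l ^ k * K = A`.
  have hl : 0 < (A / K) ^ k⁻¹ := by positivity
  obtain ⟨v', W', P', Q', B', hS', hA', hB', hi', hae'⟩ :=
    exists_radialSystem_bubbleScaled hN hk0 ht0 hk ht hl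
  rw [← Real.rpow_mul (by positivity), inv_mul_cancel₀ hk0.ne', Real.rpow_one, ← hK,
    div_mul_cancel₀ _ hK0.ne'] at hA'
  refine ⟨_, hl, ?_⟩
  filter_upwards [hae, hae', ae_ne_zero hN] with x h1 h2 hx
  rw [h1, h2]
  exact hS.eq_of_initial_eq hk0 ht0 hS' hA hA' hB hB' hi hi' _ (norm_pos_iff.2 hx)

theorem IsNontrivialRadialSolution.exists_bubbleScaled {N : ℕ} (hN : N ≠ 0) {α β k t : ℝ}
    (hk0 : 0 < k) (ht0 : 0 < t) (hk : 2 * k = N - 4 + 2 * α - β) (ht : t = 2 + β - α)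
    {u : EuclideanSpace ℝ (Fin N) → ℝ} (hu : IsNontrivialRadialSolution α β u) :
    ∃ l : ℝ, 0 < l ∧
      ((∀ᵐ x, u x = bubbleScaled α β l x) ∨ ∀ᵐ x, u x = -bubbleScaled α β l x) := by
  obtain ⟨v, W, P, Q, hS, hP, hae, hi⟩ := exists_radialSystem hN hk0 ht0 hk ht hu.1 hu.2.1
  obtain ⟨A, B, hA, hB⟩ := hS.exists_tendsto hk0 ht0 hP
  rcases lt_trichotomy A 0 with h | rfl | h
  · obtain ⟨l, hl, h1⟩ := exists_bubbleScaled_ae_eq hN hk0 ht0 hk ht hS.neg hA.neg hB.neg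
      (by simpa using hi) (u := fun x => -u x) (hae.mono fun x hx => by rw [hx]) (neg_pos.2 h)
    exact ⟨l, hl, Or.inr (h1.mono fun x hx => by linarith)⟩
  · refine absurd ?_ hu.2.2
    have hp : 2 + 2 * t / k ≠ 0 := by positivity
    filter_upwards [hae, ae_ne_zero hN] with x h1 hx
    rw [h1]
    exact hS.eq_of_initial_eq hk0 ht0 (radialSystem_zero k t) hA tendsto_const_nhds hB
      tendsto_const_nhds hi (by simp [Real.zero_rpow hp]) _ (norm_pos_iff.2 hx)
  · obtain ⟨l, hl, h1⟩ := exists_bubbleScaled_ae_eq hN hk0 ht0 hk ht hS hA hB hi hae h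
    exact ⟨l, hl, Or.inl h1⟩

end WeightedCKN

theorem theorem1p2 (N : ℕ) (α β : ℝ) (hN : 5 ≤ N) (hα : 2 - (N : ℝ) < α)
    (hβ : α - 2 < β) (hβ' : β ≤ (N : ℝ) / ((N : ℝ) - 2) * α) :
    (∀ l : ℝ, 0 < l →
      WeightedCKN.IsNontrivialRadialSolution α β
        (WeightedCKN.bubbleScaled α β l : EuclideanSpace ℝ (Fin N) → ℝ) ∧
      WeightedCKN.IsNontrivialRadialSolution α β
        (fun x : EuclideanSpace ℝ (Fin N) => -WeightedCKN.bubbleScaled α β l x)) ∧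
    (∀ u : EuclideanSpace ℝ (Fin N) → ℝ, WeightedCKN.IsNontrivialRadialSolution α β u →
      ∃ l : ℝ, 0 < l ∧
        ((∀ᵐ x, u x = WeightedCKN.bubbleScaled α β l x) ∨
          (∀ᵐ x, u x = -WeightedCKN.bubbleScaled α β l x))) := by
  have hN5 : (5 : ℝ) ≤ N := by exact_mod_cast hN
  have hN0 : N ≠ 0 := by omega
  have hk0 : 0 < ((N : ℝ) - 4 + 2 * α - β) / 2 := by
    have h2 : (0 : ℝ) < N - 2 := by linarith
    rw [div_mul_eq_mul_div, le_div_iff₀ h2] at hβ'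
    have h3 : 0 < ((N : ℝ) - 4) * (N - 2 + α) := mul_pos (by linarith) (by linarith)
    -- The upper bound on `β` gives `(N - 2) (N - 4 + 2 α - β) ≥ (N - 4) (N - 2 + α)`.
    have h4 : 0 < ((N : ℝ) - 4 + 2 * α - β) * (N - 2) := by nlinarith
    exact half_pos (pos_of_mul_pos_left h4 h2.le)
  have ht0 : 0 < 2 + β - α := by linarith
  have hk : 2 * (((N : ℝ) - 4 + 2 * α - β) / 2) = N - 4 + 2 * α - β := by ring
  refine ⟨fun l hl => ?_, fun u hu => hu.exists_bubbleScaled hN0 hk0 ht0 hk rfl⟩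
  have h := WeightedCKN.isNontrivialRadialSolution_bubbleScaled hN0 hk0 ht0 hk rfl hl
  exact ⟨h, h.neg⟩
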